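/- Let $L,\rho,\mu>0$. Let $\Phi:\mathbb R\to[0,\infty)$ be continuous on $\mathbb R$ and $C^2$ on $\mathbb R\setminus\{-1,1\}$, constant on $(-\infty,-1]$ and constant on $[1,\infty)$, convex on $[-1,1]$, nonincreasing on $[-1,0]$, nondecreasing on $[0,1]$, with $\Phi(s)\ge\kappa s^2$ on $[-1,1]$ for some constant $\kappa>0$, and such that the one-sided limits $\Phi'(1^-)=\lim_{s\to1^-}\Phi'(s)$ and $\Phi'(-1^+)=\lim_{s\to-1^+}\Phi'(s)$ exist and are finite. Let $u_0\in H^2(0,L)$ and $u_1\in L^2(0,L)$. Then the problem $$\rho\,\partial_{tt}^2u=-\mu\,\partial_{xxxx}^4u-\Phi'(u)\quad(t>0,\ 0<x<L),$$ $$\partial_{xx}^2u=\partial_{xxx}^3u=0\ \text{ at } x=0 \text{ and } x=L,\qquad u(0,\cdot)=u_0,\quad \partial_tu(0,\cdot)=u_1,$$ has a global dissipative solution, that is, there is a function $u:[0,\infty)\times[0,L]\to\mathbb R$ such that: (i) $u$ is continuous on $[0,\infty)\times[0,L]$; (ii) the weak derivatives $\partial_tu$ and $\partial_{xx}^2u$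 on $(0,\infty)\times(0,L)$ exist and belong to $L^\infty(0,\infty;L^2(0,L))$; (iii) there is a measurable function $h_u:[0,\infty)\times[0,L]\to\mathbb R$ with $h_u(t,x)=\Phi'(u(t,x))$ where $|u(t,x)|<1$, $h_u(t,x)=0$ where $|u(t,x)|>1$, $h_u(t,x)\in[0,\Phi'(1^-)]$ where $u(t,x)=1$, and $h_u(t,x)\in[\Phi'(-1^+),0]$ where $u(t,x)=-1$, such that for every $\varphi\in C^\infty(\mathbb R^2)$ with compact support $$\int_0^\infty\!\!\int_0^L\left(\rho u\,\partial_{tt}^2\varphi+\mu\,\partial_{xx}^2u\,\partial_{xx}^2\varphi+h_u\varphi\right)dx\,dt-\int_0^L\rho u_1(x)\varphi(0,x)\,dx+\int_0^L\rho u_0(x)\,\partial_t\varphi(0,x)\,dx=0;$$ (iv) for almost every $t>0$, $$\int_0^L\left(\frac{\rho(\partial_tu(t,x))^2+\mu(\partial_{xx}^2u(t,x))^2}{2}+\Phi(u(t,x))\right)dx\le\int_0^L\left(\frac{\rho(u_1(x))^2+\mu(u_0''(x))^2}{2}+\Phi(u_0(x))\right)dx.$$ -/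

import Mathlib

open Set MeasureTheory Filter Topology
open scoped ContDiff

namespace Beam

noncomputable section

/-- The adhesion potentials: `Φ` is continuous, `C²` away from `±1`, nonnegative, constant on
`(-∞,-1]` and on `[1,∞)` (possibly two different constants), convex on `[-1,1]`, decreasing on
`[-1,0]`, increasing on `[0,1]`, above a positive multiple of `u²` on `[-1,1]`, and the
discontinuities of `Φ'` at `±1` are jumps: the one-sided limits `Φ'(1⁻)` and `Φ'(-1⁺)` are
finite. -/
structure IsAdhesionPotential (Φ : ℝ → ℝ) : Prop where
  continuous : Continuous Φ
  contDiffOn : ContDiffOn ℝ 2 Φ ({1, -1} : Set ℝ)ᶜ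
  nonneg : ∀ s, 0 ≤ Φ s
  const_left : ∀ s ≤ -1, Φ s = Φ (-1)
  const_right : ∀ s, 1 ≤ s → Φ s = Φ 1
  convexOn : ConvexOn ℝ (Icc (-1) 1) Φ
  antitoneOn : AntitoneOn Φ (Icc (-1) 0)
  monotoneOn : MonotoneOn Φ (Icc 0 1)
  coercive : ∃ κ : ℝ, 0 < κ ∧ ∀ s ∈ Icc (-1 : ℝ) 1, κ * s ^ 2 ≤ Φ s
  limit_one : ∃ a : ℝ, Tendsto (deriv Φ) (𝓝[<] 1) (𝓝 a)
  limit_neg_one : ∃ b : ℝ, Tendsto (deriv Φ) (𝓝[>] (-1)) (𝓝 b)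

/-- The set `∂Φ'(s)` of admissible values of the discontinuous force at displacement `s`:
`{Φ'(s)}` for `|s| < 1`, `{0}` for `|s| > 1`, `[0, Φ'(1⁻)]` for `s = 1` and `[Φ'(-1⁺), 0]` for
`s = -1`. -/
def forceSubdiff (Φ : ℝ → ℝ) (s : ℝ) : Set ℝ :=
  {h | (|s| < 1 → h = deriv Φ s) ∧
       (1 < |s| → h = 0) ∧
       (s = 1 → h ∈ Icc 0 (Function.leftLim (deriv Φ) 1)) ∧
       (s = -1 → h ∈ Icc (Function.rightLim (deriv Φ) (-1)) 0)}

/-- `g` is the weak derivative of order `k` of `f` on the open set `U ⊆ ℝ`. -/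
def HasWeakDeriv (k : ℕ) (U : Set ℝ) (f g : ℝ → ℝ) : Prop :=
  LocallyIntegrableOn f U ∧ LocallyIntegrableOn g U ∧
    ∀ φ : ℝ → ℝ, ContDiff ℝ ∞ φ → HasCompactSupport φ → tsupport φ ⊆ U →
      ∫ x in U, f x * iteratedDeriv k φ x = (-1) ^ k * ∫ x in U, g x * φ x

/-- `f ∈ H²(0,L)`: `f` and its weak derivatives of orders one and two lie in `L²(0,L)`. -/
def MemH2 (L : ℝ) (f : ℝ → ℝ) : Prop :=
  MemLp f 2 (volume.restrict (Ioo 0 L)) ∧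
  (∃ f₁, HasWeakDeriv 1 (Ioo 0 L) f f₁ ∧ MemLp f₁ 2 (volume.restrict (Ioo 0 L))) ∧
  (∃ f₂, HasWeakDeriv 2 (Ioo 0 L) f f₂ ∧ MemLp f₂ 2 (volume.restrict (Ioo 0 L)))

/-- Classical `k`-th derivative in time of a function of `(t, x)`. -/
def partialT (k : ℕ) (φ : ℝ × ℝ → ℝ) (p : ℝ × ℝ) : ℝ :=
  iteratedDeriv k (fun s => φ (s, p.2)) p.1

/-- Classical `k`-th derivative in space of a function of `(t, x)`. -/
def partialX (k : ℕ) (φ : ℝ × ℝ → ℝ) (p : ℝ × ℝ) : ℝ :=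
  iteratedDeriv k (fun y => φ (p.1, y)) p.2

/-- `g` is the weak `k`-th time derivative of `f` on the open set `U` of points `(t, x)`. -/
def HasWeakPartialT (k : ℕ) (U : Set (ℝ × ℝ)) (f g : ℝ × ℝ → ℝ) : Prop :=
  LocallyIntegrableOn f U ∧ LocallyIntegrableOn g U ∧
    ∀ φ : ℝ × ℝ → ℝ, ContDiff ℝ ∞ φ → HasCompactSupport φ → tsupport φ ⊆ U →
      ∫ p in U, f p * partialT k φ p = (-1) ^ k * ∫ p in U, g p * φ p

/-- `g` is the weak `k`-th space derivative of `f` on the open set `U` of points `(t, x)`. -/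
def HasWeakPartialX (k : ℕ) (U : Set (ℝ × ℝ)) (f g : ℝ × ℝ → ℝ) : Prop :=
  LocallyIntegrableOn f U ∧ LocallyIntegrableOn g U ∧
    ∀ φ : ℝ × ℝ → ℝ, ContDiff ℝ ∞ φ → HasCompactSupport φ → tsupport φ ⊆ U →
      ∫ p in U, f p * partialX k φ p = (-1) ^ k * ∫ p in U, g p * φ p

/-- The open space-time strip `(0,∞) × (0,L)`. -/
def strip (L : ℝ) : Set (ℝ × ℝ) := Ioi 0 ×ˢ Ioo 0 L

/-- `f ∈ L^∞(0,∞; L²(0,L))`: `f` is measurable on the strip and its `L²(0,L)` norms at almost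
every time are bounded by one finite constant. -/
def MemLinftyL2 (L : ℝ) (f : ℝ × ℝ → ℝ) : Prop :=
  AEStronglyMeasurable f (volume.restrict (strip L)) ∧
    ∃ C : ENNReal, C < ⊤ ∧ ∀ᵐ t ∂(volume.restrict (Ioi (0 : ℝ))),
      eLpNorm (fun x => f (t, x)) 2 (volume.restrict (Ioo 0 L)) ≤ C

/-- The energy of a state with velocity `v`, second space derivative `w` and displacement `z`. -/
def energy (ρ μ L : ℝ) (Φ v w z : ℝ → ℝ) : ℝ :=
  ∫ x in Ioo 0 L, ((ρ * v x ^ 2 + μ * w x ^ 2) / 2 + Φ (z x))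

/-- `u` is a dissipative solution of `ρ u_tt = -μ u_xxxx - Φ'(u)` on `(0,∞) × (0,L)` with
`u_xx = u_xxx = 0` at `x = 0, L` and initial data `u = u₀`, `u_t = u₁`. The boundary conditions
and the initial conditions are carried by the weak formulation, whose test functions are
arbitrary on the boundary of the strip. The functions `v`, `w` and `w₀` are the weak derivatives
`u_t`, `u_xx` and `u₀''`, and `h` is the selection `h_u ∈ ∂Φ'(u)`. -/
def IsDissipativeSolution (ρ μ L : ℝ) (Φ u₀ u₁ : ℝ → ℝ) (u : ℝ × ℝ → ℝ) : Prop :=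
  ContinuousOn u (Ici 0 ×ˢ Icc 0 L) ∧
  ∃ v w h : ℝ × ℝ → ℝ, ∃ w₀ : ℝ → ℝ,
    HasWeakPartialT 1 (strip L) u v ∧ MemLinftyL2 L v ∧
    HasWeakPartialX 2 (strip L) u w ∧ MemLinftyL2 L w ∧
    HasWeakDeriv 2 (Ioo 0 L) u₀ w₀ ∧
    AEStronglyMeasurable h (volume.restrict (strip L)) ∧
    (∀ p ∈ (Ici 0 ×ˢ Icc 0 L : Set (ℝ × ℝ)), h p ∈ forceSubdiff Φ (u p)) ∧
    (∀ φ : ℝ × ℝ → ℝ, ContDiff ℝ ∞ φ → HasCompactSupport φ →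
      (∫ p in strip L, (ρ * u p * partialT 2 φ p + μ * w p * partialX 2 φ p + h p * φ p))
        - (∫ x in Ioo 0 L, ρ * u₁ x * φ (0, x))
        + (∫ x in Ioo 0 L, ρ * u₀ x * partialT 1 φ (0, x)) = 0) ∧
    (∀ᵐ t ∂(volume.restrict (Ioi (0 : ℝ))),
      energy ρ μ L Φ (fun x => v (t, x)) (fun x => w (t, x)) (fun x => u (t, x))
        ≤ energy ρ μ L Φ u₁ w₀ u₀)

end

end Beam

/-! The proof is a Galerkin-free regularisation. There are three obstacles: `Φ'` jumps at `±1`, the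
elastic force is unbounded on `L²(0,L)`, and `u₁` is only square integrable. With `δ = ε = 1/(n+1)`,
the potential `Φ` is replaced by its forward average over `[s, s+δ]`, whose derivative is the
Lipschitz difference quotient `(Φ(s+δ) - Φ(s))/δ`, and `ε` times the `H²` inner product is added to
the kinetic form. On the Hilbert space `H²(0,L)` the mass form is then coercive and the force is a
Lipschitz functional, so the equation becomes an ordinary differential equation with global,
energy-conserving solutions (`exists_global_solution`, `exists_newton_solution`,
`exists_regularized_solution`). The state space imposes no boundary values, so `u_xx = u_xxx = 0`
comes out as the natural boundary condition.

The energy bounds `u_t` and `u_xx` in `L²(0,L)`, uniformly in time and in `n`. The potential is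
bounded and does not control the size of `u`; that comes from the initial state and the velocity
bound, locally in time. Displacements are Lipschitz in time with values in `L²` and locally bounded
in `H²`; interpolating between the two makes them equicontinuous in `(t,x)`
(`equicontinuous_dispField`). Along an ultrafilter they converge locally uniformly to a continuous
`u`, while velocities, curvatures and forces converge weakly in a weighted `L²` of the strip
(`exists_weakLim`). The equation is linear in these three, so it passes to the limit
(`WeakLim.integral_motion`), the additional inertia being of order `√ε`.

Two nonlinear facts remain. First, the limit force is admissible: uniform convergence of the
displacements confines the difference quotients near a given value of `u` to an interval determined
by the convexity and monotonicity of `Φ`, and interval bounds survive weak limits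
(`WeakLim.ae_mem_forceSubdiff`). Second, the energy inequality holds at almost every time: `a² ≥ 2ab
- b²` gives lower semicontinuity of the energy integrated over any bounded measurable set of times,
and these sets are arbitrary (`ae_energy_le`). -/

namespace Beam

/-! ### Slope and growth bounds for adhesion potentials. -/

namespace IsAdhesionPotential

variable {Φ : ℝ → ℝ}

theorem differentiableAt (hΦ : IsAdhesionPotential Φ) {s : ℝ} (h1 : s ≠ 1) (h2 : s ≠ -1) :
    DifferentiableAt ℝ Φ s := by
  have hopen : IsOpen (({1, -1} : Set ℝ)ᶜ) := (Set.toFinite _).isClosed.isOpen_compl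
  exact (hΦ.contDiffOn.contDiffAt (hopen.mem_nhds (by simp [h1, h2]))).differentiableAt (by norm_num)

theorem continuousOn_deriv (hΦ : IsAdhesionPotential Φ) : ContinuousOn (deriv Φ) (Ioo (-1) 1) := by
  have hopen : IsOpen (({1, -1} : Set ℝ)ᶜ) := (Set.toFinite _).isClosed.isOpen_compl
  refine (hΦ.contDiffOn.continuousOn_deriv_of_isOpen hopen (by norm_num)).mono ?_
  intro s hs
  simp only [mem_compl_iff, mem_insert_iff, mem_singleton_iff, not_or]
  exact ⟨hs.2.ne, hs.1.ne'⟩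

theorem monotoneOn_deriv (hΦ : IsAdhesionPotential Φ) : MonotoneOn (deriv Φ) (Ioo (-1) 1) :=
  (hΦ.convexOn.subset Ioo_subset_Icc_self (convex_Ioo _ _)).monotoneOn_deriv
    fun _ hs => hΦ.differentiableAt hs.2.ne hs.1.ne'

theorem tendsto_leftLim (hΦ : IsAdhesionPotential Φ) :
    Tendsto (deriv Φ) (𝓝[<] 1) (𝓝 (Function.leftLim (deriv Φ) 1)) := by
  obtain ⟨a, ha⟩ := hΦ.limit_one
  rwa [leftLim_eq_of_tendsto ha]

theorem tendsto_rightLim (hΦ : IsAdhesionPotential Φ) :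
    Tendsto (deriv Φ) (𝓝[>] (-1)) (𝓝 (Function.rightLim (deriv Φ) (-1))) := by
  obtain ⟨a, ha⟩ := hΦ.limit_neg_one
  rwa [rightLim_eq_of_tendsto ha]

/-- Convexity makes `Φ'` increasing on `(-1,1)`, so its limit at `1` bounds all its values there. -/
theorem deriv_le_leftLim (hΦ : IsAdhesionPotential Φ) {s : ℝ} (hs : s ∈ Ioo (-1 : ℝ) 1) :
    deriv Φ s ≤ Function.leftLim (deriv Φ) 1 := by
  refine ge_of_tendsto hΦ.tendsto_leftLim ?_
  filter_upwards [Ioo_mem_nhdsLT hs.2] with r hr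
  exact hΦ.monotoneOn_deriv hs ⟨hs.1.trans hr.1, hr.2⟩ hr.1.le

theorem rightLim_le_deriv (hΦ : IsAdhesionPotential Φ) {s : ℝ} (hs : s ∈ Ioo (-1 : ℝ) 1) :
    Function.rightLim (deriv Φ) (-1) ≤ deriv Φ s := by
  refine le_of_tendsto hΦ.tendsto_rightLim ?_
  filter_upwards [Ioo_mem_nhdsGT hs.1] with r hr
  exact hΦ.monotoneOn_deriv ⟨hr.1, hr.2.trans hs.2⟩ hs hr.2.le

theorem eq_min (hΦ : IsAdhesionPotential Φ) (s : ℝ) : Φ s = Φ (min s 1) := by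
  rcases le_total s 1 with h | h
  · rw [min_eq_left h]
  · rw [min_eq_right h, hΦ.const_right s h]

theorem eq_max (hΦ : IsAdhesionPotential Φ) (s : ℝ) : Φ s = Φ (max s (-1)) := by
  rcases le_total s (-1) with h | h
  · rw [max_eq_right h, hΦ.const_left s h]
  · rw [max_eq_left h]

theorem le_of_nonneg (hΦ : IsAdhesionPotential Φ) {s r : ℝ} (hs : 0 ≤ s) (hsr : s ≤ r) :
    Φ s ≤ Φ r := by
  rw [hΦ.eq_min s, hΦ.eq_min r]
  exact hΦ.monotoneOn ⟨le_min hs zero_le_one, min_le_right _ _⟩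
    ⟨le_min (hs.trans hsr) zero_le_one, min_le_right _ _⟩ (min_le_min_right _ hsr)

theorem le_of_nonpos (hΦ : IsAdhesionPotential Φ) {s r : ℝ} (hr : r ≤ 0) (hsr : s ≤ r) :
    Φ r ≤ Φ s := by
  rw [hΦ.eq_max s, hΦ.eq_max r]
  exact hΦ.antitoneOn ⟨le_max_right _ _, max_le (hsr.trans hr) (by norm_num)⟩
    ⟨le_max_right _ _, max_le hr (by norm_num)⟩ (max_le_max_right _ hsr)

theorem sub_le_Icc (hΦ : IsAdhesionPotential Φ) {s r : ℝ} (hs : 0 ≤ s) (hsr : s ≤ r)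
    (hr : r ≤ 1) : Φ r - Φ s ≤ Function.leftLim (deriv Φ) 1 * (r - s) := by
  refine (convex_Icc (0 : ℝ) 1).image_sub_le_mul_sub_of_deriv_le hΦ.continuous.continuousOn
    ?_ ?_ s ⟨hs, hsr.trans hr⟩ r ⟨hs.trans hsr, hr⟩ hsr
  · rw [interior_Icc]
    exact fun x hx => (hΦ.differentiableAt hx.2.ne
      (by linarith [hx.1])).differentiableWithinAt
  · rw [interior_Icc]
    exact fun x hx => hΦ.deriv_le_leftLim ⟨by linarith [hx.1], hx.2⟩

theorem le_sub_Icc (hΦ : IsAdhesionPotential Φ) {s r : ℝ} (hs : -1 ≤ s) (hsr : s ≤ r)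
    (hr : r ≤ 0) : Function.rightLim (deriv Φ) (-1) * (r - s) ≤ Φ r - Φ s := by
  refine (convex_Icc (-1 : ℝ) 0).mul_sub_le_image_sub_of_le_deriv hΦ.continuous.continuousOn
    ?_ ?_ s ⟨hs, hsr.trans hr⟩ r ⟨hs.trans hsr, hr⟩ hsr
  · rw [interior_Icc]
    exact fun x hx => (hΦ.differentiableAt (by linarith [hx.2])
      hx.1.ne').differentiableWithinAt
  · rw [interior_Icc]
    exact fun x hx => hΦ.rightLim_le_deriv ⟨hx.1, by linarith [hx.2]⟩

theorem leftLim_nonneg (hΦ : IsAdhesionPotential Φ) : 0 ≤ Function.leftLim (deriv Φ) 1 := by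
  have h1 := hΦ.sub_le_Icc le_rfl zero_le_one le_rfl
  have h2 := hΦ.le_of_nonneg le_rfl zero_le_one
  linarith

theorem rightLim_nonpos (hΦ : IsAdhesionPotential Φ) : Function.rightLim (deriv Φ) (-1) ≤ 0 := by
  have h1 := hΦ.le_sub_Icc le_rfl (by norm_num : (-1 : ℝ) ≤ 0) le_rfl
  have h2 := hΦ.le_of_nonpos le_rfl (by norm_num : (-1 : ℝ) ≤ 0)
  linarith

/-- Truncation at `1` does not change `Φ` and does not increase distances, which carries the slope
bound from `[0,1]` to the half-line. -/
theorem sub_le (hΦ : IsAdhesionPotential Φ) {s r : ℝ} (hs : 0 ≤ s) (hsr : s ≤ r) :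
    Φ r - Φ s ≤ Function.leftLim (deriv Φ) 1 * (r - s) := by
  rw [hΦ.eq_min s, hΦ.eq_min r]
  refine (hΦ.sub_le_Icc (le_min hs zero_le_one) (min_le_min_right _ hsr)
    (min_le_right _ _)).trans (mul_le_mul_of_nonneg_left ?_ hΦ.leftLim_nonneg)
  rcases le_total r 1 with h | h <;> rcases le_total s 1 with h' | h' <;> (simp [*]; try linarith)

theorem le_sub (hΦ : IsAdhesionPotential Φ) {s r : ℝ} (hr : r ≤ 0) (hsr : s ≤ r) :
    Function.rightLim (deriv Φ) (-1) * (r - s) ≤ Φ r - Φ s := by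
  rw [hΦ.eq_max s, hΦ.eq_max r]
  refine le_trans (mul_le_mul_of_nonpos_left ?_ hΦ.rightLim_nonpos)
    (hΦ.le_sub_Icc (le_max_right _ _) (max_le_max_right _ hsr) (max_le hr (by norm_num)))
  rcases le_total r (-1) with h | h <;> rcases le_total s (-1) with h' | h' <;> (simp [*]; try linarith)

theorem exists_lipschitz (hΦ : IsAdhesionPotential Φ) :
    ∃ K : NNReal, LipschitzWith K Φ := by
  have ha := hΦ.leftLim_nonneg
  have hb := hΦ.rightLim_nonpos
  set a := Function.leftLim (deriv Φ) 1 with ha'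
  set b := Function.rightLim (deriv Φ) (-1) with hb'
  have key : ∀ s r, s ≤ r → |Φ r - Φ s| ≤ (a - b) * (r - s) := by
    intro s r hsr
    rw [abs_le]
    rcases le_total 0 s with hs | hs
    · have h1 := hΦ.sub_le hs hsr
      have h2 := hΦ.le_of_nonneg hs hsr
      constructor <;> nlinarith
    · rcases le_total r 0 with hr | hr
      · have h1 := hΦ.le_sub hr hsr
        have h2 := hΦ.le_of_nonpos hr hsr
        constructor <;> nlinarith
      · have h1 := hΦ.sub_le le_rfl hr
        have h2 := hΦ.le_of_nonneg le_rfl hr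
        have h3 := hΦ.le_sub le_rfl hs
        have h4 := hΦ.le_of_nonpos le_rfl hs
        constructor <;> nlinarith
  -- Since `b ≤ 0 ≤ a`, the number `a - b` dominates the slopes on both sides of `0`.
  refine ⟨NNReal.mk (a - b) (by linarith), LipschitzWith.of_dist_le_mul fun x y => ?_⟩
  rw [Real.dist_eq, Real.dist_eq, NNReal.coe_mk]
  rcases le_total x y with h | h
  · rw [abs_sub_comm, abs_sub_comm x, abs_of_nonneg (sub_nonneg.2 h)]
    exact key x y h
  · rw [abs_of_nonneg (sub_nonneg.2 h)]
    exact key y x h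

theorem le_max_ends (hΦ : IsAdhesionPotential Φ) (s : ℝ) : Φ s ≤ Φ (-1) + Φ 1 := by
  have h1 := hΦ.nonneg 1
  have h2 := hΦ.nonneg (-1)
  rcases le_total 0 s with h | h
  · have := hΦ.le_of_nonneg h (le_max_left s 1)
    rw [hΦ.const_right _ (le_max_right s 1)] at this
    linarith
  · have := hΦ.le_of_nonpos h (min_le_left s (-1))
    rw [hΦ.const_left _ (min_le_right s (-1))] at this
    linarith

end IsAdhesionPotential

/-! ### Regularisation of the potential by forward averages. -/

/-- The forward difference quotient of `Φ` with step `δ`, a Lipschitz substitute for `Φ'`. -/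
noncomputable def diffQuot (Φ : ℝ → ℝ) (δ s : ℝ) : ℝ := (Φ (s + δ) - Φ s) / δ

/-- The forward average of `Φ` with step `δ`, a primitive of `diffQuot Φ δ`. -/
noncomputable def fwdAverage (Φ : ℝ → ℝ) (δ s : ℝ) : ℝ :=
  ((∫ r in (0 : ℝ)..(s + δ), Φ r) - ∫ r in (0 : ℝ)..s, Φ r) / δ

theorem hasDerivAt_fwdAverage {Φ : ℝ → ℝ} (hΦ : Continuous Φ) (δ s : ℝ) :
    HasDerivAt (fwdAverage Φ δ) (diffQuot Φ δ s) s := by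
  have h := fun x => intervalIntegral.integral_hasDerivAt_right (hΦ.intervalIntegrable 0 x)
    hΦ.stronglyMeasurable.stronglyMeasurableAtFilter hΦ.continuousAt
  exact ((h (s + δ)).comp_add_const s δ |>.sub (h s)).div_const δ

/-- The constant `2K/δ` blows up as `δ → 0`; it serves only to solve the equation for fixed `δ`. The
uniform control is the bound in `abs_diffQuot_le`. -/
theorem lipschitzWith_diffQuot {Φ : ℝ → ℝ} {K : NNReal} (hΦ : LipschitzWith K Φ) {δ : ℝ}
    (hδ : 0 < δ) : ∃ K' : NNReal, LipschitzWith K' (diffQuot Φ δ) := by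
  refine ⟨NNReal.mk (2 * K / δ) (by positivity), LipschitzWith.of_dist_le_mul fun x y => ?_⟩
  have h1 := hΦ.dist_le_mul (x + δ) (y + δ)
  have h2 := hΦ.dist_le_mul x y
  simp only [Real.dist_eq, NNReal.coe_mk, diffQuot] at *
  rw [← sub_div, abs_div, abs_of_pos hδ, div_mul_eq_mul_div]
  gcongr
  rw [add_sub_add_right_eq_sub] at h1
  calc |Φ (x + δ) - Φ x - (Φ (y + δ) - Φ y)| = |(Φ (x + δ) - Φ (y + δ)) - (Φ x - Φ y)| := by
        congr 1; ring
    _ ≤ _ := (abs_sub _ _).trans (by linarith)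

theorem abs_diffQuot_le {Φ : ℝ → ℝ} {K : NNReal} (hΦ : LipschitzWith K Φ) {δ : ℝ}
    (hδ : 0 < δ) (s : ℝ) : |diffQuot Φ δ s| ≤ K := by
  have h1 := hΦ.dist_le_mul (s + δ) s
  simp only [Real.dist_eq, diffQuot, add_sub_cancel_left, abs_of_pos hδ] at *
  rwa [abs_div, abs_of_pos hδ, div_le_iff₀ hδ]

/-- The forward average is the mean of `Φ` over `[s, s+δ]`, where `Φ` varies by at most `K δ`. -/
theorem abs_fwdAverage_sub_le {Φ : ℝ → ℝ} {K : NNReal} (hΦ : LipschitzWith K Φ) {δ : ℝ}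
    (hδ : 0 < δ) (s : ℝ) : |fwdAverage Φ δ s - Φ s| ≤ K * δ := by
  have hc := hΦ.continuous
  have h : fwdAverage Φ δ s - Φ s = (∫ r in s..(s + δ), (Φ r - Φ s)) / δ := by
    rw [fwdAverage, intervalIntegral.integral_interval_sub_left (hc.intervalIntegrable _ _)
      (hc.intervalIntegrable _ _), intervalIntegral.integral_sub (hc.intervalIntegrable _ _)
      (by simp), intervalIntegral.integral_const]
    simp; field_simp
  rw [h, abs_div, abs_of_pos hδ, div_le_iff₀ hδ]
  have := intervalIntegral.norm_integral_le_of_norm_le_const (a := s) (b := s + δ)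
    (f := fun r => Φ r - Φ s) (C := K * δ) ?_
  · simpa [abs_of_pos hδ] using this
  · intro r hr
    rw [uIoc_of_le (by linarith)] at hr
    refine (hΦ.dist_le_mul r s).trans ?_
    gcongr
    rw [Real.dist_eq, abs_of_pos (by linarith [hr.1])]
    linarith [hr.2]

theorem exists_diffQuot_eq_deriv {Φ : ℝ → ℝ} (hΦ : IsAdhesionPotential Φ) {δ s : ℝ} (hδ : 0 < δ)
    (h1 : -1 < s) (h2 : s + δ < 1) : ∃ r ∈ Ioo s (s + δ), diffQuot Φ δ s = deriv Φ r := by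
  obtain ⟨r, hr, h⟩ := exists_deriv_eq_slope Φ (a := s) (b := s + δ) (by linarith)
    hΦ.continuous.continuousOn (fun x hx => (hΦ.differentiableAt (by linarith [hx.2])
      (by linarith [hx.1])).differentiableWithinAt)
  exact ⟨r, hr, by rw [h, diffQuot]; simp⟩

/-- Here `[s, s+δ]` may straddle `1`: this is what puts the limit force at `u = 1` into the whole
interval between `0` and `Φ'(1⁻)`. -/
theorem diffQuot_mem_of_nonneg {Φ : ℝ → ℝ} (hΦ : IsAdhesionPotential Φ) {δ s : ℝ} (hδ : 0 < δ)
    (hs : 0 ≤ s) : diffQuot Φ δ s ∈ Icc 0 (Function.leftLim (deriv Φ) 1) := by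
  have h1 := hΦ.sub_le hs (r := s + δ) (by linarith)
  have h2 := hΦ.le_of_nonneg hs (r := s + δ) (by linarith)
  rw [add_sub_cancel_left] at h1
  exact ⟨div_nonneg (by linarith) hδ.le, by rwa [diffQuot, div_le_iff₀ hδ]⟩

theorem diffQuot_mem_of_nonpos {Φ : ℝ → ℝ} (hΦ : IsAdhesionPotential Φ) {δ s : ℝ} (hδ : 0 < δ)
    (hs : s + δ ≤ 0) : diffQuot Φ δ s ∈ Icc (Function.rightLim (deriv Φ) (-1)) 0 := by
  have h1 := hΦ.le_sub hs (s := s) (by linarith)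
  have h2 := hΦ.le_of_nonpos hs (s := s) (by linarith)
  rw [add_sub_cancel_left] at h1
  exact ⟨by rwa [diffQuot, le_div_iff₀ hδ], div_nonpos_of_nonpos_of_nonneg (by linarith) hδ.le⟩

theorem diffQuot_eq_zero {Φ : ℝ → ℝ} (hΦ : IsAdhesionPotential Φ) {δ s : ℝ} (hδ : 0 < δ)
    (hs : 1 ≤ s ∨ s + δ ≤ -1) : diffQuot Φ δ s = 0 := by
  rcases hs with hs | hs
  · rw [diffQuot, hΦ.const_right s hs, hΦ.const_right _ (by linarith), sub_self, zero_div]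
  · rw [diffQuot, hΦ.const_left _ hs, hΦ.const_left s (by linarith), sub_self, zero_div]

/-- On compact subintervals of `(-1,1)` the difference quotients are close to `Φ'`, also when
the argument is perturbed. -/
theorem exists_diffQuot_close {Φ : ℝ → ℝ} (hΦ : IsAdhesionPotential Φ) {η ε : ℝ} (hη : 0 < η)
    (hε : 0 < ε) : ∃ τ > 0, ∀ δ, 0 < δ → δ < τ → ∀ s r, |r| ≤ 1 - η → |s - r| < τ →
      |diffQuot Φ δ s - deriv Φ r| ≤ ε := by
  have hsub : Icc (-1 + η / 2) (1 - η / 2) ⊆ Ioo (-1 : ℝ) 1 := fun x hx =>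
    ⟨by linarith [hx.1], by linarith [hx.2]⟩
  have hu := isCompact_Icc.uniformContinuousOn_of_continuous (hΦ.continuousOn_deriv.mono hsub)
  rw [Metric.uniformContinuousOn_iff] at hu
  obtain ⟨τ, hτ, h⟩ := hu ε hε
  -- The mean value point `q` lies within `δ + |s - r|` of `r`. The first entry makes this smaller
  -- than the modulus `τ`, the second smaller than `η/2`, so that `q` stays in the compact interval.
  refine ⟨min (τ / 2) (η / 4), by positivity, fun δ hδ hδ' s r hr hsr => ?_⟩
  have a1 := lt_min_iff.1 hδ'
  have a2 := lt_min_iff.1 hsr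
  have a3 := abs_lt.1 a2.1
  have a4 := abs_lt.1 a2.2
  have a5 := abs_le.1 hr
  obtain ⟨q, hq, e⟩ := exists_diffQuot_eq_deriv hΦ hδ (s := s) (by linarith) (by linarith)
  rw [e, ← Real.dist_eq]
  refine (h q ⟨?_, ?_⟩ r ⟨?_, ?_⟩ ?_).le
  any_goals linarith [hq.1, hq.2]
  rw [Real.dist_eq, abs_lt]
  constructor <;> linarith [hq.1, hq.2]

end Beam

namespace Beam

/-! ### Global solutions of Lipschitz differential equations. -/

section GlobalODE

variable {E : Type*} [NormedAddCommGroup E] [NormedSpace ℝ E]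

/-- Integration gains a factor `1/l` against the weight `exp (l|t|)`; this is what makes Picard
iteration a contraction on the whole line. -/
theorem abs_integral_exp_abs_le {l : ℝ} (hl : 0 < l) (t : ℝ) :
    |∫ s in (0 : ℝ)..t, Real.exp (l * |s|)| ≤ Real.exp (l * |t|) / l := by
  have pos : ∀ t : ℝ, 0 ≤ t → |∫ s in (0 : ℝ)..t, Real.exp (l * |s|)| ≤ Real.exp (l * |t|) / l := by
    intro t ht
    have h : (∫ s in (0 : ℝ)..t, Real.exp (l * |s|)) = ∫ s in (0 : ℝ)..t, Real.exp (l * s) := by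
      refine intervalIntegral.integral_congr fun s hs => ?_
      rw [uIcc_of_le ht] at hs
      simp only [abs_of_nonneg hs.1]
    rw [h, intervalIntegral.integral_comp_mul_left Real.exp hl.ne', integral_exp, abs_of_nonneg ht, smul_eq_mul,
      mul_zero, Real.exp_zero, abs_of_nonneg]
    · rw [div_eq_inv_mul]
      have := inv_pos.2 hl
      gcongr
      linarith
    · have : 1 ≤ Real.exp (l * t) := Real.one_le_exp (by positivity)
      have := inv_pos.2 hl
      exact mul_nonneg this.le (by linarith)
  rcases le_total 0 t with ht | ht
  · exact pos t ht
  · have h := pos (-t) (by linarith)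
    rw [abs_neg] at h
    have h2 : (∫ s in (0 : ℝ)..(-t), Real.exp (l * |s|)) = -∫ s in (0 : ℝ)..t, Real.exp (l * |s|) := by
      have := intervalIntegral.integral_comp_neg (a := 0) (b := t) fun s => Real.exp (l * |s|)
      simp only [abs_neg, neg_zero] at this
      rw [this, intervalIntegral.integral_symm]
    rwa [h2, abs_neg] at h

variable [CompleteSpace E]

open scoped BoundedContinuousFunction

/-- A globally Lipschitz autonomous differential equation has solutions on all of `ℝ`. -/
theorem exists_global_solution {F : E → E} {K : NNReal} (hF : LipschitzWith K F) (x₀ : E) :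
    ∃ x : ℝ → E, x 0 = x₀ ∧ ∀ t, HasDerivAt x (F (x t)) t := by
  -- The contraction constant will be `K/l ≤ 1/2`; the `+ 1` keeps `l` positive when `K = 0`.
  set l : ℝ := 2 * (K + 1) with hl
  have hK : (0 : ℝ) ≤ K := K.2
  have hl0 : 0 < l := by positivity
  -- the unknown is `z t = exp (-l|t|) • x t`
  have hcont : ∀ z : ℝ →ᵇ E, Continuous fun s => F (Real.exp (l * |s|) • z s) := fun z =>
    hF.continuous.comp ((by fun_prop : Continuous fun s : ℝ => Real.exp (l * |s|)).smul z.continuous)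
  let P : (ℝ →ᵇ E) → ℝ → E := fun z t => x₀ + ∫ s in (0 : ℝ)..t, F (Real.exp (l * |s|) • z s)
  have hPd : ∀ z t, HasDerivAt (P z) (F (Real.exp (l * |t|) • z t)) t := fun z t =>
    (intervalIntegral.integral_hasDerivAt_right ((hcont z).intervalIntegrable _ _)
      (hcont z).stronglyMeasurable.stronglyMeasurableAtFilter (hcont z).continuousAt).const_add x₀
  have hPc : ∀ z, Continuous (P z) := fun z =>
    continuous_iff_continuousAt.2 fun t => (hPd z t).continuousAt
  have hee : ∀ t : ℝ, Real.exp (-(l * |t|)) * Real.exp (l * |t|) = 1 := fun t => by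
    rw [← Real.exp_add]; simp
  have hdiff : ∀ (z w : ℝ →ᵇ E) t, ‖P z t - P w t‖ ≤ K * dist z w * (Real.exp (l * |t|) / l) := by
    intro z w t
    have : P z t - P w t = ∫ s in (0 : ℝ)..t,
        (F (Real.exp (l * |s|) • z s) - F (Real.exp (l * |s|) • w s)) := by
      simp only [P]
      rw [intervalIntegral.integral_sub ((hcont z).intervalIntegrable _ _)
        ((hcont w).intervalIntegrable _ _)]
      abel
    rw [this]
    have hint : IntervalIntegrable (fun s => K * dist z w * Real.exp (l * |s|)) volume 0 t :=
      (by fun_prop : Continuous fun s : ℝ => K * dist z w * Real.exp (l * |s|)).intervalIntegrable _ _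
    refine (intervalIntegral.norm_integral_le_abs_of_norm_le (Eventually.of_forall fun s => ?_)
      hint).trans ?_
    · rw [← dist_eq_norm]
      refine (hF.dist_le_mul _ _).trans ?_
      rw [dist_smul₀, Real.norm_of_nonneg (Real.exp_pos _).le]
      have h := z.dist_coe_le_dist (g := w) s
      calc K * (Real.exp (l * |s|) * dist (z s) (w s)) ≤ K * (Real.exp (l * |s|) * dist z w) := by
            gcongr
        _ = _ := by ring
    · rw [intervalIntegral.integral_const_mul, abs_mul, abs_of_nonneg (by positivity)]
      exact mul_le_mul_of_nonneg_left (abs_integral_exp_abs_le hl0 t) (by positivity)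
  -- `P 0` is affine in `t`, hence dominated by the weight. With `hdiff` this shows that the
  -- weighted Picard map preserves boundedness.
  have hP0 : ∀ t, ‖P 0 t‖ ≤ (‖x₀‖ + ‖F 0‖ / l) * Real.exp (l * |t|) := by
    intro t
    have h1 : 1 ≤ Real.exp (l * |t|) := Real.one_le_exp (by positivity)
    have h2 : |t| ≤ Real.exp (l * |t|) / l := by
      rw [le_div_iff₀ hl0]
      linarith [Real.add_one_le_exp (l * |t|)]
    have h3 : P 0 t = x₀ + t • F 0 := by simp [P]
    rw [h3]
    refine (norm_add_le _ _).trans ?_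
    rw [norm_smul, Real.norm_eq_abs, add_mul]
    have a := mul_le_mul_of_nonneg_left h1 (norm_nonneg x₀)
    have b := mul_le_mul_of_nonneg_right h2 (norm_nonneg (F 0))
    have e : Real.exp (l * |t|) / l * ‖F 0‖ = ‖F 0‖ / l * Real.exp (l * |t|) := by ring
    linarith
  have hTb : ∀ z t, ‖Real.exp (-(l * |t|)) • P z t‖ ≤ (‖x₀‖ + ‖F 0‖ / l) + K * dist z 0 / l := by
    intro z t
    have h : ‖P z t‖ ≤ ((‖x₀‖ + ‖F 0‖ / l) + K * dist z 0 / l) * Real.exp (l * |t|) := by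
      calc ‖P z t‖ ≤ ‖P z t - P 0 t‖ + ‖P 0 t‖ := by
            simpa using norm_add_le (P z t - P 0 t) (P 0 t)
        _ ≤ _ := add_le_add (hdiff z 0 t) (hP0 t)
        _ = _ := by ring
    rw [norm_smul, Real.norm_of_nonneg (Real.exp_pos _).le]
    calc _ ≤ Real.exp (-(l * |t|)) * (((‖x₀‖ + ‖F 0‖ / l) + K * dist z 0 / l) * Real.exp (l * |t|)) :=
          mul_le_mul_of_nonneg_left h (Real.exp_pos _).le
      _ = ((‖x₀‖ + ‖F 0‖ / l) + K * dist z 0 / l) * (Real.exp (-(l * |t|)) * Real.exp (l * |t|)) := by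
          ring
      _ = _ := by rw [hee, mul_one]
  let T : (ℝ →ᵇ E) → (ℝ →ᵇ E) := fun z => BoundedContinuousFunction.ofNormedAddCommGroup
    (fun t => Real.exp (-(l * |t|)) • P z t)
    ((by fun_prop : Continuous fun s : ℝ => Real.exp (-(l * |s|))).smul (hPc z)) _ (hTb z)
  have hT : ContractingWith (1 / 2) T := by
    refine ⟨by rw [one_div]; exact inv_lt_one_of_one_lt₀ one_lt_two, LipschitzWith.of_dist_le_mul fun z w => ?_⟩
    refine (BoundedContinuousFunction.dist_le (by positivity)).2 fun t => ?_
    have : T z t - T w t = Real.exp (-(l * |t|)) • (P z t - P w t) := by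
      simp [T, smul_sub]
    rw [dist_eq_norm, this, norm_smul, Real.norm_of_nonneg (Real.exp_pos _).le]
    calc _ ≤ Real.exp (-(l * |t|)) * (K * dist z w * (Real.exp (l * |t|) / l)) :=
          mul_le_mul_of_nonneg_left (hdiff z w t) (Real.exp_pos _).le
      _ = (K / l) * dist z w * (Real.exp (-(l * |t|)) * Real.exp (l * |t|)) := by ring
      _ ≤ _ := by
        rw [hee, mul_one]
        refine mul_le_mul_of_nonneg_right ?_ dist_nonneg
        rw [div_le_iff₀ hl0]
        push_cast
        linarith
  obtain ⟨z, hz⟩ : ∃ z, T z = z := ⟨hT.fixedPoint, hT.fixedPoint_isFixedPt⟩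
  have hzP : ∀ t, Real.exp (l * |t|) • z t = P z t := by
    intro t
    have : z t = Real.exp (-(l * |t|)) • P z t := by
      conv_lhs => rw [← hz]
      rfl
    rw [this, smul_smul, mul_comm, hee, one_smul]
  refine ⟨P z, by simp [P], fun t => ?_⟩
  rw [← hzP t]
  exact hPd z t

end GlobalODE

/-! ### Newton's equation in a Hilbert space. -/

section Hamiltonian

variable {X : Type*} [NormedAddCommGroup X] [InnerProductSpace ℝ X] [CompleteSpace X]

/-- Newton's equation `M c'' = -V'(c)` with a coercive symmetric mass form and a potential with
Lipschitz derivative has global solutions, which conserve the energy. -/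
theorem exists_newton_solution {M : X →L[ℝ] X →L[ℝ] ℝ} (hM : IsCoercive M)
    (hsymm : ∀ x y, M x y = M y x) {V : X → ℝ} {G : X → X →L[ℝ] ℝ} {K : NNReal}
    (hG : LipschitzWith K G) (hV : ∀ x, HasFDerivAt V (G x) x) (c₀ d₀ : X) :
    ∃ c d a : ℝ → X, c 0 = c₀ ∧ d 0 = d₀ ∧ (∀ t, HasDerivAt c (d t) t) ∧
      (∀ t, HasDerivAt d (a t) t) ∧ Continuous a ∧ (∀ t e, M (a t) e = - G (c t) e) ∧
      ∀ t, M (d t) (d t) / 2 + V (c t) = M d₀ d₀ / 2 + V c₀ := by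
  -- Lax–Milgram inverts the mass form; composed with the Riesz isomorphism it gives `R φ`, the
  -- solution of `M (R φ) = φ`.
  let N : X →L[ℝ] X := hM.continuousLinearEquivOfBilin.symm
  let R : (X →L[ℝ] ℝ) → X := fun φ => N ((InnerProductSpace.toDual ℝ X).symm φ)
  have hRl : LipschitzWith (‖N‖₊ * 1) R :=
    N.lipschitz.comp (InnerProductSpace.toDual ℝ X).symm.lipschitz
  have hR : ∀ φ e, M (R φ) e = φ e := by
    intro φ e
    rw [← hM.continuousLinearEquivOfBilin_apply]
    simp [R, N]
  let F : X × X → X × X := fun p => (p.2, - R (G p.1))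
  have hF : LipschitzWith (max 1 ((‖N‖₊ * 1) * (K * 1))) F :=
    LipschitzWith.prodMk LipschitzWith.prod_snd
      (hRl.comp (hG.comp LipschitzWith.prod_fst)).neg
  obtain ⟨x, hx0, hx⟩ := exists_global_solution hF (c₀, d₀)
  have hc : ∀ t, HasDerivAt (fun t => (x t).1) (x t).2 t := fun t => (hx t).fst
  have hd : ∀ t, HasDerivAt (fun t => (x t).2) (- R (G (x t).1)) t := fun t => (hx t).snd
  have hxc : Continuous x := continuous_iff_continuousAt.2 fun t => (hx t).continuousAt
  refine ⟨fun t => (x t).1, fun t => (x t).2, fun t => - R (G (x t).1), by simp [hx0], by simp [hx0],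
    hc, hd, (hRl.continuous.comp (hG.continuous.comp hxc.fst)).neg, fun t e => by simp [hR], ?_⟩
  -- By symmetry of `M` the kinetic term has derivative `M a d = -G(c) d`, which cancels the
  -- derivative of `V` along the curve.
  have hE : ∀ t, HasDerivAt (fun t => M (x t).2 (x t).2 / 2 + V (x t).1) 0 t := by
    intro t
    have h1 : HasDerivAt (fun t => M (x t).2 (x t).2)
        (M (- R (G (x t).1)) (x t).2 + M (x t).2 (- R (G (x t).1))) t :=
      (M.hasFDerivAt.comp_hasDerivAt t (hd t)).clm_apply (hd t)
    have h2 := (hV (x t).1).comp_hasDerivAt t (hc t)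
    refine ((h1.div_const 2).add h2).congr_deriv ?_
    rw [hsymm (x t).2, map_neg, neg_apply, hR]
    ring
  intro t
  have := is_const_of_deriv_eq_zero (fun t => (hE t).differentiableAt) (fun t => (hE t).deriv) t 0
  simpa [hx0] using this

end Hamiltonian

end Beam

/-! ### The `H²` state space and its displacement fields. -/

namespace Beam

open scoped RealInnerProductSpace

/-- Lebesgue measure on the reference configuration `(0,L)`. -/
noncomputable abbrev seg (L : ℝ) : Measure ℝ := volume.restrict (Ioo 0 L)

/-- The state space: a displacement in `H²(0,L)` is recorded by its value and slope at `0` and by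
its second derivative in `L²(0,L)`. -/
abbrev StateSpace (L : ℝ) := WithLp 2 (EuclideanSpace ℝ (Fin 2) × Lp ℝ 2 (seg L))

/-- `primAt L x g = ∫₀ˣ g`, where `g` is extended by zero outside `(0,L)`. -/
noncomputable def primAt (L x : ℝ) : Lp ℝ 2 (seg L) →L[ℝ] ℝ :=
  innerSL ℝ (indicatorConstLp 2 (measurableSet_Iic (a := x)) (measure_ne_top (seg L) _) (1 : ℝ))

theorem integrable_indicator_Lp {L : ℝ} (g : Lp ℝ 2 (seg L)) :
    Integrable ((Ioo 0 L).indicator g) volume := by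
  rw [integrable_indicator_iff measurableSet_Ioo]
  exact (Lp.memLp g).integrable one_le_two

theorem primAt_eq (L x : ℝ) (g : Lp ℝ 2 (seg L)) :
    primAt L x g = ∫ y in (0 : ℝ)..x, (Ioo 0 L).indicator g y := by
  have hi := integrable_indicator_Lp g
  have h1 : ∀ z, (∫ y in Iic z, g y ∂(seg L)) = ∫ y in Iic z, (Ioo 0 L).indicator g y := by
    intro z
    rw [setIntegral_indicator measurableSet_Ioo, Measure.restrict_restrict measurableSet_Iic]
  have h0 : (∫ y in Iic (0 : ℝ), (Ioo 0 L).indicator g y) = 0 := by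
    refine setIntegral_eq_zero_of_forall_eq_zero fun y hy => ?_
    exact indicator_of_notMem (fun h => absurd h.1 (not_lt.2 hy)) _
  rw [primAt, innerSL_apply_apply, L2.inner_indicatorConstLp_one, h1,
    ← intervalIntegral.integral_Iic_sub_Iic hi.integrableOn hi.integrableOn, h0, sub_zero]

theorem abs_primAt_le {L : ℝ} (hL : 0 ≤ L) (x : ℝ) (g : Lp ℝ 2 (seg L)) :
    |primAt L x g| ≤ √L * ‖g‖ := by
  refine (abs_real_inner_le_norm _ _).trans (mul_le_mul_of_nonneg_right ?_ (norm_nonneg g))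
  refine norm_indicatorConstLp_le.trans ?_
  rw [norm_one, one_mul, Real.sqrt_eq_rpow]
  have e : (1 : ℝ) / (2 : ENNReal).toReal = 1 / 2 := by norm_num
  rw [e]
  refine Real.rpow_le_rpow measureReal_nonneg ?_ (by norm_num)
  refine (measureReal_mono (subset_univ _)).trans ?_
  simp [measureReal_def, hL]

/-- Joint continuity follows from continuity in `x` for fixed `g` and a Lipschitz bound in `g` that
is uniform in `x`. -/
theorem continuous_primAt {L : ℝ} (hL : 0 ≤ L) :
    Continuous fun p : Lp ℝ 2 (seg L) × ℝ => primAt L p.2 p.1 := by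
  refine continuous_prod_of_continuous_lipschitzWith _ (NNReal.mk (√L) (Real.sqrt_nonneg _))
    (fun g => ?_) fun x => LipschitzWith.of_dist_le_mul fun g g' => ?_
  · simp only [primAt_eq]
    exact intervalIntegral.continuous_primitive
      (fun _ _ => (integrable_indicator_Lp g).intervalIntegrable) 0
  · rw [Real.dist_eq, ← map_sub, dist_eq_norm]
    exact abs_primAt_le hL x _

theorem norm_fst_le {L : ℝ} (c : StateSpace L) : ‖c.fst‖ ≤ ‖c‖ := by
  have := WithLp.prod_norm_sq_eq_of_L2 c
  exact abs_le_of_sq_le_sq' (by nlinarith [sq_nonneg ‖c.snd‖]) (norm_nonneg _) |>.2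

theorem norm_snd_le {L : ℝ} (c : StateSpace L) : ‖c.snd‖ ≤ ‖c‖ := by
  have := WithLp.prod_norm_sq_eq_of_L2 c
  exact abs_le_of_sq_le_sq' (by nlinarith [sq_nonneg ‖c.fst‖]) (norm_nonneg _) |>.2

theorem abs_fst_le {L : ℝ} (c : StateSpace L) (i : Fin 2) : |c.fst i| ≤ ‖c‖ :=
  (PiLp.norm_apply_le c.fst i).trans (norm_fst_le c)

theorem memLp_seg {L : ℝ} {f : ℝ → ℝ} (hf : Continuous f) : MemLp f 2 (seg L) := by
  obtain ⟨C, hC⟩ := (isCompact_Icc (a := (0 : ℝ)) (b := L)).exists_bound_of_continuousOn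
    hf.continuousOn
  refine MemLp.of_bound hf.aestronglyMeasurable C ?_
  filter_upwards [ae_restrict_mem measurableSet_Ioo] with x hx
  exact hC x (Ioo_subset_Icc_self hx)

theorem integrable_seg {L : ℝ} {f : ℝ → ℝ} (hf : Continuous f) : Integrable f (seg L) :=
  (memLp_seg hf).integrable one_le_two

/-- The displacement field of a state. -/
noncomputable def disp (L : ℝ) [Fact (0 < L)] : StateSpace L →ₗ[ℝ] ℝ → ℝ where
  toFun c x := c.fst 0 + c.fst 1 * x + ∫ s in (0 : ℝ)..x, primAt L s c.snd
  map_add' c e := by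
    have hL : 0 ≤ L := (Fact.out : 0 < L).le
    have h : ∀ g : Lp ℝ 2 (seg L), Continuous fun s => primAt L s g := fun g =>
      (continuous_primAt hL).comp (by fun_prop : Continuous fun s : ℝ => (g, s))
    ext x
    simp only [WithLp.add_fst, WithLp.add_snd, PiLp.add_apply, map_add, Pi.add_apply]
    rw [intervalIntegral.integral_add ((h _).intervalIntegrable _ _)
      ((h _).intervalIntegrable _ _)]
    ring
  map_smul' r c := by
    ext x
    simp only [WithLp.smul_fst, WithLp.smul_snd, PiLp.smul_apply, map_smul, Pi.smul_apply,
      smul_eq_mul, intervalIntegral.integral_const_mul, RingHom.id_apply]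
    ring

/-- The slope of the displacement field of a state. -/
noncomputable def slopeAt (L : ℝ) (c : StateSpace L) (x : ℝ) : ℝ := c.fst 1 + primAt L x c.snd

variable {L : ℝ} [hL : Fact (0 < L)]

theorem disp_apply (c : StateSpace L) (x : ℝ) :
    disp L c x = c.fst 0 + c.fst 1 * x + ∫ s in (0 : ℝ)..x, primAt L s c.snd := rfl

theorem continuous_primAt_snd (g : Lp ℝ 2 (seg L)) : Continuous fun s => primAt L s g :=
  (continuous_primAt hL.out.le).comp (by fun_prop : Continuous fun s : ℝ => (g, s))

theorem hasDerivAt_disp (c : StateSpace L) (x : ℝ) : HasDerivAt (disp L c) (slopeAt L c x) x := by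
  have hc := continuous_primAt_snd c.snd
  have h1 := intervalIntegral.integral_hasDerivAt_right (hc.intervalIntegrable 0 x)
    hc.stronglyMeasurable.stronglyMeasurableAtFilter hc.continuousAt
  have h2 : HasDerivAt (fun x : ℝ => c.fst 0 + c.fst 1 * x) (c.fst 1) x := by
    simpa using ((hasDerivAt_id x).const_mul (c.fst 1)).const_add (c.fst 0)
  exact h2.add h1

theorem continuous_disp_uncurry : Continuous fun p : StateSpace L × ℝ => disp L p.1 p.2 := by
  have h1 : Continuous fun p : StateSpace L × ℝ => ∫ s in (0 : ℝ)..p.2, primAt L s p.1.snd := by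
    refine intervalIntegral.continuous_parametric_primitive_of_continuous
      (f := fun (c : StateSpace L) s => primAt L s c.snd) ?_
    exact (continuous_primAt hL.out.le).comp
      (by fun_prop : Continuous fun p : StateSpace L × ℝ => (p.1.snd, p.2))
  have h2 : ∀ i, Continuous fun p : StateSpace L × ℝ => p.1.fst i := fun i => by fun_prop
  exact ((h2 0).add ((h2 1).mul continuous_snd)).add h1

theorem continuous_disp (c : StateSpace L) : Continuous (disp L c) :=
  continuous_disp_uncurry.comp (by fun_prop : Continuous fun x : ℝ => (c, x))

theorem abs_slopeAt_le (c : StateSpace L) (x : ℝ) : |slopeAt L c x| ≤ (1 + √L) * ‖c‖ := by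
  have h1 := abs_fst_le c 1
  have h2 := (abs_primAt_le hL.out.le x c.snd).trans
    (mul_le_mul_of_nonneg_left (norm_snd_le c) (Real.sqrt_nonneg L))
  exact (abs_add_le _ _).trans (by linarith)

theorem abs_disp_sub_le (c : StateSpace L) (x y : ℝ) :
    |disp L c x - disp L c y| ≤ (1 + √L) * ‖c‖ * |x - y| :=
  Convex.norm_image_sub_le_of_norm_hasDerivWithin_le (s := univ)
    (fun z _ => (hasDerivAt_disp c z).hasDerivWithinAt) (fun z _ => abs_slopeAt_le c z) convex_univ
    (mem_univ y) (mem_univ x)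

/-- A bound for the supremum norm of displacement fields on `[0,L]`. -/
noncomputable def dispBound (L : ℝ) : ℝ := 1 + (1 + √L) * L

theorem dispBound_pos : 0 < dispBound L := by
  have := hL.out
  unfold dispBound
  positivity

theorem abs_disp_le (c : StateSpace L) {x : ℝ} (hx : x ∈ Icc 0 L) :
    |disp L c x| ≤ dispBound L * ‖c‖ := by
  have h1 := abs_disp_sub_le c x 0
  have h2 : disp L c 0 = c.fst 0 := by simp [disp_apply]
  have h3 := abs_fst_le c 0
  rw [h2, sub_zero, abs_of_nonneg hx.1] at h1
  have h4 : (1 + √L) * ‖c‖ * x ≤ (1 + √L) * ‖c‖ * L :=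
    mul_le_mul_of_nonneg_left hx.2 (by positivity)
  have h5 := abs_sub_abs_le_abs_sub (disp L c x) (c.fst 0)
  unfold dispBound
  linarith

/-- The displacement field as an element of `L²(0,L)`. -/
noncomputable def dispL2 (L : ℝ) [hL : Fact (0 < L)] : StateSpace L →L[ℝ] Lp ℝ 2 (seg L) :=
  LinearMap.mkContinuous
    { toFun := fun c => (memLp_seg (continuous_disp c)).toLp _
      map_add' := fun c e => by
        rw [← MemLp.toLp_add]
        congr 1
        exact map_add _ _ _
      map_smul' := fun r c => by
        rw [RingHom.id_apply, ← MemLp.toLp_const_smul]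
        congr 1
        exact map_smul _ _ _ }
    ((seg L).real univ ^ ((2 : ENNReal).toReal)⁻¹ * dispBound L) (fun c => by
      rw [mul_assoc]
      refine Lp.norm_le_of_ae_bound (mul_nonneg dispBound_pos.le (norm_nonneg _)) ?_
      filter_upwards [(memLp_seg (continuous_disp c)).coeFn_toLp,
        ae_restrict_mem measurableSet_Ioo] with x hx hx'
      simp only [LinearMap.coe_mk, AddHom.coe_mk]
      rw [hx]
      exact abs_disp_le c (Ioo_subset_Icc_self hx'))

theorem dispL2_apply (c : StateSpace L) : dispL2 L c = (memLp_seg (continuous_disp c)).toLp _ := rfl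

theorem coeFn_dispL2 (c : StateSpace L) : dispL2 L c =ᵐ[seg L] disp L c :=
  (memLp_seg (continuous_disp c)).coeFn_toLp

theorem inner_toLp {α : Type*} [MeasurableSpace α] {m : Measure α} {f g : α → ℝ} (hf : MemLp f 2 m)
    (hg : MemLp g 2 m) : ⟪hf.toLp f, hg.toLp g⟫ = ∫ x, f x * g x ∂m := by
  rw [L2.inner_def]
  refine integral_congr_ae ?_
  filter_upwards [hf.coeFn_toLp, hg.coeFn_toLp] with x h1 h2
  rw [h1, h2]
  simp [mul_comm]

theorem norm_toLp_sq {α : Type*} [MeasurableSpace α] {m : Measure α} {f : α → ℝ} (hf : MemLp f 2 m) :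
    ‖hf.toLp f‖ ^ 2 = ∫ x, f x ^ 2 ∂m := by
  rw [← real_inner_self_eq_norm_sq, inner_toLp]
  simp [sq]

theorem norm_Lp_sq {α : Type*} [MeasurableSpace α] {m : Measure α} (f : Lp ℝ 2 m) :
    ‖f‖ ^ 2 = ∫ x, f x ^ 2 ∂m := by
  rw [← norm_toLp_sq (Lp.memLp f), Lp.toLp_coeFn]

theorem norm_dispL2_sq (c : StateSpace L) : ‖dispL2 L c‖ ^ 2 = ∫ x, disp L c x ^ 2 ∂(seg L) :=
  norm_toLp_sq (memLp_seg (continuous_disp c))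

theorem integral_seg (f : ℝ → ℝ) : ∫ x, f x ∂(seg L) = ∫ x in (0 : ℝ)..L, f x := by
  rw [intervalIntegral.integral_of_le hL.out.le, integral_Ioc_eq_integral_Ioo]

/-- The `H²` norm is controlled by the `L²` norms of the displacement and of its second
derivative. -/
theorem exists_norm_sq_le (L : ℝ) [hL : Fact (0 < L)] :
    ∃ C : ℝ, 0 ≤ C ∧ ∀ c : StateSpace L, ‖c‖ ^ 2 ≤ C * (‖dispL2 L c‖ ^ 2 + ‖c.snd‖ ^ 2) := by
  have hl := hL.out
  set q : ℝ := min 1 (L ^ 2) with hq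
  have hq0 : 0 < q := by positivity
  refine ⟨16 / (L * q) * (2 + 2 * L ^ 4) + 1, by positivity, fun c => ?_⟩
  set a := c.fst 0 with ha
  set b := c.fst 1 with hb
  set g := c.snd with hg
  -- The affine part `a + b x` is the displacement minus this double primitive of `g`. Hence its
  -- `L²` norm is controlled, and that norm controls `a` and `b`.
  have hr : ∀ x ∈ Icc 0 L, |∫ s in (0 : ℝ)..x, primAt L s g| ≤ √L * ‖g‖ * L := by
    intro x hx
    rw [← Real.norm_eq_abs]
    refine (intervalIntegral.norm_integral_le_of_norm_le_const (C := √L * ‖g‖) fun s _ =>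
      abs_primAt_le hl.le s g).trans ?_
    rw [sub_zero, abs_of_nonneg hx.1]
    exact mul_le_mul_of_nonneg_left hx.2 (by positivity)
  have hp : ∀ x ∈ Icc 0 L, (a + b * x) ^ 2 ≤ 2 * disp L c x ^ 2 + 2 * (L ^ 3 * ‖g‖ ^ 2) := by
    intro x hx
    have h1 := hr x hx
    have h2 : (∫ s in (0 : ℝ)..x, primAt L s g) ^ 2 ≤ L ^ 3 * ‖g‖ ^ 2 := by
      rw [← sq_abs]
      calc _ ≤ (√L * ‖g‖ * L) ^ 2 := pow_le_pow_left₀ (abs_nonneg _) h1 2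
        _ = (√L) ^ 2 * L ^ 2 * ‖g‖ ^ 2 := by ring
        _ = _ := by rw [Real.sq_sqrt hl.le]; ring
    have h3 : a + b * x = disp L c x - ∫ s in (0 : ℝ)..x, primAt L s g := by
      rw [disp_apply]; ring
    rw [h3]
    nlinarith [sq_nonneg (disp L c x + ∫ s in (0 : ℝ)..x, primAt L s g)]
  have hint : ∫ x in (0 : ℝ)..L, (a + b * x) ^ 2 = L * (a ^ 2 + a * (b * L) + (b * L) ^ 2 / 3) := by
    have h : ∀ x ∈ uIcc 0 L, HasDerivAt (fun x : ℝ => a ^ 2 * x + a * b * x ^ 2 + b ^ 2 * x ^ 3 / 3)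
        ((a + b * x) ^ 2) x := by
      intro x _
      have := (((hasDerivAt_id x).const_mul (a ^ 2)).add ((hasDerivAt_pow 2 x).const_mul (a * b))).add
        (((hasDerivAt_pow 3 x).const_mul (b ^ 2)).div_const 3)
      refine this.congr_deriv ?_
      simp; ring
    rw [intervalIntegral.integral_eq_sub_of_hasDerivAt h
      ((by fun_prop : Continuous fun x : ℝ => (a + b * x) ^ 2).intervalIntegrable _ _)]
    ring
  have hd : Continuous fun x => disp L c x ^ 2 := (continuous_disp c).pow 2
  have hle : ∫ x in (0 : ℝ)..L, (a + b * x) ^ 2 ≤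
      2 * ‖dispL2 L c‖ ^ 2 + 2 * (L ^ 4 * ‖g‖ ^ 2) := by
    have h1 := intervalIntegral.integral_mono_on hl.le
      ((by fun_prop : Continuous fun x : ℝ => (a + b * x) ^ 2).intervalIntegrable (μ := volume) _ _)
      (((hd.const_mul 2).add continuous_const).intervalIntegrable _ _) hp
    have hd2 : IntervalIntegrable (fun x => 2 * disp L c x ^ 2) volume 0 L :=
      (hd.const_mul 2).intervalIntegrable _ _
    simp only [Pi.add_apply] at h1
    rw [intervalIntegral.integral_add hd2 (by simp),
      intervalIntegral.integral_const_mul, intervalIntegral.integral_const,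
      ← integral_seg fun x => disp L c x ^ 2,
      ← norm_dispL2_sq] at h1
    refine h1.trans_eq ?_
    simp only [sub_zero, smul_eq_mul]
    ring
  -- The form `a² + a B + B²/3` with `B = b L` is positive definite and its least eigenvalue is
  -- slightly above `1/16`; the factor `q` passes from `b L` back to `b`.
  have hlow : L * q / 16 * (a ^ 2 + b ^ 2) ≤ L * (a ^ 2 + a * (b * L) + (b * L) ^ 2 / 3) := by
    have h1 : q * a ^ 2 ≤ a ^ 2 := by nlinarith [min_le_left 1 (L ^ 2), sq_nonneg a]
    have h2 : q * b ^ 2 ≤ (b * L) ^ 2 := by nlinarith [min_le_right 1 (L ^ 2), sq_nonneg b]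
    have h3 : (a ^ 2 + (b * L) ^ 2) / 16 ≤ a ^ 2 + a * (b * L) + (b * L) ^ 2 / 3 := by
      nlinarith [sq_nonneg (15 * a + 8 * (b * L))]
    have h4 : q / 16 * (a ^ 2 + b ^ 2) ≤ a ^ 2 + a * (b * L) + (b * L) ^ 2 / 3 := by nlinarith
    calc _ = L * (q / 16 * (a ^ 2 + b ^ 2)) := by ring
      _ ≤ _ := mul_le_mul_of_nonneg_left h4 hl.le
  have hab : a ^ 2 + b ^ 2 ≤ 16 / (L * q) * (2 * ‖dispL2 L c‖ ^ 2 + 2 * (L ^ 4 * ‖g‖ ^ 2)) := by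
    rw [div_mul_eq_mul_div, le_div_iff₀ (by positivity)]
    rw [hint] at hle
    nlinarith
  have hn : ‖c‖ ^ 2 = a ^ 2 + b ^ 2 + ‖g‖ ^ 2 := by
    rw [WithLp.prod_norm_sq_eq_of_L2, EuclideanSpace.norm_sq_eq, Fin.sum_univ_two]
    simp [ha, hb, hg]
  rw [hn]
  refine (add_le_add_left hab _).trans ?_
  have e1 : 0 ≤ 16 / (L * q) * (2 * ‖g‖ ^ 2) := by positivity
  have e2 : 0 ≤ 16 / (L * q) * (2 * L ^ 4 * ‖dispL2 L c‖ ^ 2) := by positivity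
  nlinarith [sq_nonneg ‖dispL2 L c‖]

/-- Interpolation: the supremum of the displacement is small if its `L²` norm is. -/
theorem abs_disp_le_interpolation (c : StateSpace L) {x η : ℝ} (hx : x ∈ Icc 0 L) (hη : 0 < η)
    (hηL : η ≤ L) :
    |disp L c x| ≤ ‖dispL2 L c‖ / √η + (1 + √L) * ‖c‖ * η := by
  have hl := hL.out
  set M := (1 + √L) * ‖c‖ with hM
  have hM0 : 0 ≤ M := by positivity
  -- The window `[y, y + η]` contains `x` and stays inside `[0,L]`, also near the right end. The
  -- value at `x` is compared with the mean over it: the slope bound gives the error, Cauchy–Schwarz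
  -- the mean.
  set y := min x (L - η) with hy
  have hy0 : 0 ≤ y := le_min hx.1 (by linarith)
  have hyx : y ≤ x := min_le_left _ _
  have hxy : x ≤ y + η := by
    rcases min_cases x (L - η) with h | h <;> rw [hy, h.1] <;> linarith [hx.2]
  have hyL : y + η ≤ L := by linarith [min_le_right x (L - η)]
  have hc := continuous_disp c
  have hsub : Ioc y (y + η) ⊆ Ioc 0 L := Ioc_subset_Ioc hy0 hyL
  have h1 : η * |disp L c x| ≤ (∫ s in y..(y + η), |disp L c s|) + M * η * η := by
    have : ∫ s in y..(y + η), |disp L c x| ≤ ∫ s in y..(y + η), (|disp L c s| + M * η) := by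
      refine intervalIntegral.integral_mono_on (by linarith) (by simp)
        ((by fun_prop : Continuous fun s => |disp L c s| + M * η).intervalIntegrable _ _) ?_
      intro s hs
      have h2 := abs_disp_sub_le c x s
      have h3 : |x - s| ≤ η := abs_le.2 ⟨by linarith [hs.2], by linarith [hs.1]⟩
      have h4 := mul_le_mul_of_nonneg_left h3 hM0
      have h5 := abs_sub_abs_le_abs_sub (disp L c x) (disp L c s)
      linarith
    rw [intervalIntegral.integral_add (hc.abs.intervalIntegrable _ _) (by simp)] at this
    simpa [mul_comm, mul_assoc] using this
  have h2 : (∫ s in y..(y + η), |disp L c s|) ≤ √η * ‖dispL2 L c‖ := by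
    have hs : MeasurableSet (Ioc y (y + η)) := measurableSet_Ioc
    have hrestr : (seg L).restrict (Ioc y (y + η)) = volume.restrict (Ioc y (y + η)) := by
      rw [seg, Measure.restrict_congr_set (Ioo_ae_eq_Ioc (a := (0 : ℝ)) (b := L)),
        Measure.restrict_restrict hs, inter_eq_left.2 hsub]
    have habs := (memLp_seg (L := L) hc.abs)
    have h3 : (∫ s in y..(y + η), |disp L c s|) =
        ⟪indicatorConstLp 2 hs (measure_ne_top (seg L) _) (1 : ℝ), habs.toLp _⟫ := by
      rw [L2.inner_indicatorConstLp_one, hrestr, intervalIntegral.integral_of_le (by linarith)]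
      refine (integral_congr_ae ?_).symm
      rw [← hrestr]
      exact ae_restrict_of_ae habs.coeFn_toLp
    rw [h3]
    refine (real_inner_le_norm _ _).trans (mul_le_mul ?_ ?_ (norm_nonneg _) (Real.sqrt_nonneg _))
    · refine norm_indicatorConstLp_le.trans ?_
      rw [norm_one, one_mul, Real.sqrt_eq_rpow]
      have e : (1 : ℝ) / (2 : ENNReal).toReal = 1 / 2 := by norm_num
      rw [e]
      refine Real.rpow_le_rpow measureReal_nonneg ?_ (by norm_num)
      rw [measureReal_def, ← Measure.restrict_apply_univ, hrestr]
      simp [hη.le]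
    · refine (abs_le_of_sq_le_sq' ?_ (norm_nonneg _)).2
      rw [norm_toLp_sq, norm_dispL2_sq]
      simp
  have hsη : 0 < √η := Real.sqrt_pos.2 hη
  have h4 : η * |disp L c x| ≤ η * (‖dispL2 L c‖ / √η + M * η) := by
    have : η * (‖dispL2 L c‖ / √η + M * η) = √η * ‖dispL2 L c‖ + M * η * η := by
      have hh : η / √η = √η := Real.div_sqrt
      calc _ = (η / √η) * ‖dispL2 L c‖ + M * η * η := by ring
        _ = _ := by rw [hh]
    rw [this]
    linarith
  exact le_of_mul_le_mul_left h4 hη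

end Beam

/-! ### The problem with regularised inertia and smooth force. -/

namespace Beam

open scoped RealInnerProductSpace

variable {L : ℝ} [hL : Fact (0 < L)]

/-- The inertia of the regularised problem: the physical one plus `ε` times that of the
`H²` norm. -/
noncomputable def massForm (L : ℝ) [Fact (0 < L)] (ρ ε : ℝ) :
    StateSpace L →L[ℝ] StateSpace L →L[ℝ] ℝ :=
  ρ • (innerSL ℝ : Lp ℝ 2 (seg L) →L[ℝ] Lp ℝ 2 (seg L) →L[ℝ] ℝ).bilinearComp (dispL2 L) (dispL2 L) +
    ε • (innerSL ℝ : StateSpace L →L[ℝ] StateSpace L →L[ℝ] ℝ)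

theorem massForm_apply (ρ ε : ℝ) (c e : StateSpace L) :
    massForm L ρ ε c e = ρ * ⟪dispL2 L c, dispL2 L e⟫ + ε * ⟪c, e⟫ := by
  rfl

theorem massForm_symm (ρ ε : ℝ) (c e : StateSpace L) :
    massForm L ρ ε c e = massForm L ρ ε e c := by
  rw [massForm_apply, massForm_apply, real_inner_comm, real_inner_comm c]

theorem massForm_self (ρ ε : ℝ) (c : StateSpace L) :
    massForm L ρ ε c c = ρ * ‖dispL2 L c‖ ^ 2 + ε * ‖c‖ ^ 2 := by
  rw [massForm_apply, real_inner_self_eq_norm_sq, real_inner_self_eq_norm_sq]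

theorem isCoercive_massForm {ρ ε : ℝ} (hρ : 0 ≤ ρ) (hε : 0 < ε) :
    IsCoercive (massForm L ρ ε) := by
  refine ⟨ε, hε, fun c => ?_⟩
  rw [massForm_self]
  nlinarith [mul_nonneg hρ (sq_nonneg ‖dispL2 L c‖)]

/-- The composition of a continuous function with a displacement field, in `L²(0,L)`. -/
noncomputable def compDisp {ψ : ℝ → ℝ} (hψ : Continuous ψ) (c : StateSpace L) : Lp ℝ 2 (seg L) :=
  (memLp_seg (hψ.comp (continuous_disp c))).toLp _

theorem coeFn_compDisp {ψ : ℝ → ℝ} (hψ : Continuous ψ) (c : StateSpace L) :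
    compDisp hψ c =ᵐ[seg L] fun x => ψ (disp L c x) :=
  (memLp_seg (hψ.comp (continuous_disp c))).coeFn_toLp

theorem inner_compDisp {ψ : ℝ → ℝ} (hψ : Continuous ψ) (c e : StateSpace L) :
    ⟪compDisp hψ c, dispL2 L e⟫ = ∫ x, ψ (disp L c x) * disp L e x ∂(seg L) :=
  inner_toLp (memLp_seg (hψ.comp (continuous_disp c))) (memLp_seg (continuous_disp e))

/-- The Lipschitz bound for `ψ` holds pointwise in `x`, hence in `L²`, and the displacement depends
linearly and boundedly on the state. -/
theorem lipschitzWith_compDisp {ψ : ℝ → ℝ} {K : NNReal} (hψ : LipschitzWith K ψ) :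
    LipschitzWith (K * ‖dispL2 L‖₊) (compDisp (L := L) hψ.continuous) := by
  have h : LipschitzWith (‖dispL2 L‖₊) (dispL2 L) := (dispL2 L).lipschitz
  refine LipschitzWith.of_dist_le_mul fun c e => ?_
  have h1 : dist (compDisp hψ.continuous c) (compDisp hψ.continuous e) ≤
      K * dist (dispL2 L c) (dispL2 L e) := by
    rw [dist_eq_norm, dist_eq_norm]
    refine Lp.norm_le_mul_norm_of_ae_le_mul ?_
    filter_upwards [Lp.coeFn_sub (compDisp hψ.continuous c) (compDisp hψ.continuous e),
      Lp.coeFn_sub (dispL2 L c) (dispL2 L e), coeFn_compDisp hψ.continuous c,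
      coeFn_compDisp hψ.continuous e, coeFn_dispL2 c, coeFn_dispL2 e] with x h1 h2 h3 h4 h5 h6
    rw [h1, h2, Pi.sub_apply, Pi.sub_apply, h3, h4, h5, h6, ← dist_eq_norm, ← dist_eq_norm]
    exact hψ.dist_le_mul _ _
  refine h1.trans ?_
  rw [NNReal.coe_mul, mul_assoc]
  exact mul_le_mul_of_nonneg_left (h.dist_le_mul c e) K.2

/-- The derivative of the elastic plus adhesive energy. -/
noncomputable def forceForm (μ : ℝ) {ψ : ℝ → ℝ} (hψ : Continuous ψ) (c : StateSpace L) :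
    StateSpace L →L[ℝ] ℝ :=
  μ • (innerSL ℝ c.snd).comp (WithLp.sndL 2 ℝ _ _) + (innerSL ℝ (compDisp hψ c)).comp (dispL2 L)

theorem forceForm_apply (μ : ℝ) {ψ : ℝ → ℝ} (hψ : Continuous ψ) (c e : StateSpace L) :
    forceForm μ hψ c e = μ * ⟪c.snd, e.snd⟫ + ∫ x, ψ (disp L c x) * disp L e x ∂(seg L) := by
  rw [← inner_compDisp hψ]
  simp [forceForm, WithLp.sndL]

theorem exists_lipschitzWith_forceForm (μ : ℝ) {ψ : ℝ → ℝ} {K : NNReal} (hψ : LipschitzWith K ψ) :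
    ∃ K' : NNReal, LipschitzWith K' (forceForm (L := L) μ hψ.continuous) := by
  have h1 : LipschitzWith _ fun c : StateSpace L =>
      μ • (innerSL ℝ c.snd).comp (WithLp.sndL 2 ℝ (EuclideanSpace ℝ (Fin 2)) (Lp ℝ 2 (seg L))) :=
    ((μ • (ContinuousLinearMap.compL ℝ (StateSpace L) (Lp ℝ 2 (seg L)) ℝ).flip
      (WithLp.sndL 2 ℝ _ _)).comp ((innerSL ℝ : Lp ℝ 2 (seg L) →L[ℝ] _).comp
        (WithLp.sndL 2 ℝ (EuclideanSpace ℝ (Fin 2)) (Lp ℝ 2 (seg L))))).lipschitz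
  have h2 : LipschitzWith _ fun c : StateSpace L =>
      (innerSL ℝ (compDisp hψ.continuous c)).comp (dispL2 L) :=
    ((((ContinuousLinearMap.compL ℝ (StateSpace L) (Lp ℝ 2 (seg L)) ℝ).flip
      (dispL2 L)).comp (innerSL ℝ : Lp ℝ 2 (seg L) →L[ℝ] _)).lipschitz).comp
        (lipschitzWith_compDisp hψ)
  exact ⟨_, h1.add h2⟩

theorem hasFDerivAt_of_sq_remainder {E F : Type*} [NormedAddCommGroup E] [NormedSpace ℝ E]
    [NormedAddCommGroup F] [NormedSpace ℝ F] {f : E → F} {f' : E →L[ℝ] F} {x : E} {C : ℝ}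
    (h : ∀ e, ‖f (x + e) - f x - f' e‖ ≤ C * ‖e‖ ^ 2) : HasFDerivAt f f' x := by
  rw [hasFDerivAt_iff_isLittleO_nhds_zero]
  refine (Asymptotics.IsBigO.of_bound C (g := fun e : E => ‖e‖ ^ 2) ?_).trans_isLittleO ?_
  · exact Eventually.of_forall fun e => by simpa using h e
  · exact Asymptotics.isLittleO_norm_pow_id one_lt_two

/-- The function `y ↦ Ψ y - ψ r * y` has derivative at most `K |s|` between `r` and `r + s`. No
second derivative of `Ψ` is needed. -/
theorem abs_taylor_le {Ψ ψ : ℝ → ℝ} (hΨ : ∀ s, HasDerivAt Ψ (ψ s) s) {K : NNReal}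
    (hψ : LipschitzWith K ψ) (r s : ℝ) : |Ψ (r + s) - Ψ r - ψ r * s| ≤ K * s ^ 2 := by
  have h := Convex.norm_image_sub_le_of_norm_hasDerivWithin_le (s := uIcc r (r + s))
    (f := fun y => Ψ y - ψ r * y) (f' := fun y => ψ y - ψ r) (C := K * |s|)
    (x := r) (y := r + s) (fun y _ => ?_) (fun y hy => ?_) (convex_uIcc _ _) left_mem_uIcc
    right_mem_uIcc
  · have e : Ψ (r + s) - Ψ r - ψ r * s = Ψ (r + s) - ψ r * (r + s) - (Ψ r - ψ r * r) := by ring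
    rw [e, ← sq_abs]
    refine h.trans_eq ?_
    rw [add_sub_cancel_left, Real.norm_eq_abs]
    ring
  · have := ((hΨ y).sub ((hasDerivAt_id y).const_mul (ψ r))).hasDerivWithinAt (s := uIcc r (r + s))
    rw [mul_one] at this
    exact this
  · refine (hψ.dist_le_mul y r).trans (mul_le_mul_of_nonneg_left ?_ K.2)
    have := abs_sub_left_of_mem_uIcc hy
    rw [add_sub_cancel_left] at this
    rwa [Real.dist_eq]

/-- The elastic part is quadratic, and the pointwise Taylor remainder of the adhesive part
integrates to at most `K` times the squared `L²` norm of the increment. -/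
theorem hasFDerivAt_potential (μ : ℝ) {Ψ ψ : ℝ → ℝ} (hΨ : ∀ s, HasDerivAt Ψ (ψ s) s) {K : NNReal}
    (hψ : LipschitzWith K ψ) (c : StateSpace L) :
    HasFDerivAt (fun c : StateSpace L => μ / 2 * ‖c.snd‖ ^ 2 + ∫ x, Ψ (disp L c x) ∂(seg L))
      (forceForm μ hψ.continuous c) c := by
  have hΨc : Continuous Ψ := continuous_iff_continuousAt.2 fun s => (hΨ s).continuousAt
  refine hasFDerivAt_of_sq_remainder (C := |μ| / 2 + K * ‖dispL2 L‖ ^ 2) fun e => ?_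
  rw [Real.norm_eq_abs]
  have i1 : ∀ c : StateSpace L, Integrable (fun x => Ψ (disp L c x)) (seg L) := fun c =>
    integrable_seg (hΨc.comp (continuous_disp c))
  have i2 : Integrable (fun x => ψ (disp L c x) * disp L e x) (seg L) :=
    integrable_seg ((hψ.continuous.comp (continuous_disp c)).mul (continuous_disp e))
  have i3 : Integrable (fun x => disp L e x ^ 2) (seg L) := integrable_seg ((continuous_disp e).pow 2)
  have h1 : |∫ x, (Ψ (disp L (c + e) x) - Ψ (disp L c x) - ψ (disp L c x) * disp L e x) ∂(seg L)| ≤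
      K * ‖dispL2 L e‖ ^ 2 := by
    rw [norm_dispL2_sq, ← integral_const_mul]
    refine (norm_integral_le_integral_norm _).trans (integral_mono (((i1 _).sub (i1 _)).sub i2).norm
      (i3.const_mul _) fun x => ?_)
    rw [map_add]
    exact abs_taylor_le hΨ hψ _ _
  have i4 : Integrable (fun x => Ψ (disp L (c + e) x) - Ψ (disp L c x)) (seg L) :=
    (i1 _).sub (i1 _)
  rw [integral_sub i4 i2, integral_sub (i1 _) (i1 _)] at h1
  have h2 : ‖(c + e).snd‖ ^ 2 = ‖c.snd‖ ^ 2 + 2 * ⟪c.snd, e.snd⟫ + ‖e.snd‖ ^ 2 := by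
    rw [WithLp.add_snd, norm_add_sq_real]
  have h3 : ‖dispL2 L e‖ ^ 2 ≤ ‖dispL2 L‖ ^ 2 * ‖e‖ ^ 2 := by
    rw [← mul_pow]
    exact pow_le_pow_left₀ (norm_nonneg _) ((dispL2 L).le_opNorm e) 2
  have h4 : ‖e.snd‖ ^ 2 ≤ ‖e‖ ^ 2 := pow_le_pow_left₀ (norm_nonneg _) (norm_snd_le e) 2
  rw [forceForm_apply, h2]
  set A := ∫ x, Ψ (disp L (c + e) x) ∂(seg L)
  set B := ∫ x, Ψ (disp L c x) ∂(seg L)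
  set D := ∫ x, ψ (disp L c x) * disp L e x ∂(seg L)
  have e1 : μ / 2 * (‖c.snd‖ ^ 2 + 2 * ⟪c.snd, e.snd⟫ + ‖e.snd‖ ^ 2) + A - (μ / 2 * ‖c.snd‖ ^ 2 + B) -
      (μ * ⟪c.snd, e.snd⟫ + D) = μ / 2 * ‖e.snd‖ ^ 2 + (A - B - D) := by ring
  rw [e1]
  refine (abs_add_le _ _).trans ?_
  rw [abs_mul, abs_div, abs_of_nonneg (sq_nonneg ‖e.snd‖), abs_two, add_mul]
  refine add_le_add (mul_le_mul_of_nonneg_left h4 (by positivity)) (h1.trans ?_)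
  rw [mul_assoc]
  exact mul_le_mul_of_nonneg_left h3 K.2

/-- Solutions of the problem with inertia regularised by `ε` and force `ψ = Ψ'`: weak formulation
on `[0,T]` against curves of test states vanishing at time `T`, and energy bound. -/
theorem exists_regularized_solution {ρ ε : ℝ} (μ : ℝ) (hρ : 0 < ρ) (hε : 0 < ε)
    {Ψ ψ : ℝ → ℝ} (hΨ : ∀ s, HasDerivAt Ψ (ψ s) s) {K : NNReal} (hψ : LipschitzWith K ψ)
    (c₀ : StateSpace L) (v₀ : Lp ℝ 2 (seg L)) :
    ∃ c d : ℝ → StateSpace L, c 0 = c₀ ∧ (∀ t, HasDerivAt c (d t) t) ∧ Continuous d ∧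
      (∀ t, ρ / 2 * ‖dispL2 L (d t)‖ ^ 2 + ε / 2 * ‖d t‖ ^ 2 + μ / 2 * ‖(c t).snd‖ ^ 2 +
        ∫ x, Ψ (disp L (c t) x) ∂(seg L) ≤
        ρ / 2 * ‖v₀‖ ^ 2 + μ / 2 * ‖c₀.snd‖ ^ 2 + ∫ x, Ψ (disp L c₀ x) ∂(seg L)) ∧
      ∀ e e' : ℝ → StateSpace L, (∀ t, HasDerivAt e (e' t) t) → Continuous e' → ∀ T, e T = 0 →
        ∫ t in (0 : ℝ)..T, (-(ρ * ⟪dispL2 L (d t), dispL2 L (e' t)⟫ + ε * ⟪d t, e' t⟫) +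
          (μ * ⟪(c t).snd, (e t).snd⟫ + ⟪compDisp hψ.continuous (c t), dispL2 L (e t)⟫)) =
          ρ * ⟪v₀, dispL2 L (e 0)⟫ := by
  obtain ⟨K', hK'⟩ := exists_lipschitzWith_forceForm (L := L) μ hψ
  have hM := isCoercive_massForm (L := L) hρ.le hε
  let m₀ : StateSpace L →L[ℝ] ℝ := ρ • (innerSL ℝ v₀).comp (dispL2 L)
  -- An `L²` velocity is not a state, so `d₀` represents the functional `e ↦ ρ ⟪v₀, e⟫` in the
  -- regularised mass form. The boundary term at time `0` is then exactly the required one.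
  set d₀ : StateSpace L := hM.continuousLinearEquivOfBilin.symm ((InnerProductSpace.toDual ℝ _).symm m₀)
    with hd₀
  have hd₀' : ∀ e, massForm L ρ ε d₀ e = ρ * ⟪v₀, dispL2 L e⟫ := by
    intro e
    rw [← hM.continuousLinearEquivOfBilin_apply, hd₀, ContinuousLinearEquiv.apply_symm_apply,
      InnerProductSpace.toDual_symm_apply]
    simp [m₀]
  obtain ⟨c, d, a, hc0, hd0, hc, hd, ha, heq, hE⟩ := exists_newton_solution hM
    (massForm_symm ρ ε) hK' (hasFDerivAt_potential μ hΨ hψ) c₀ d₀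
  have hcc : Continuous c := continuous_iff_continuousAt.2 fun t => (hc t).continuousAt
  have hdc : Continuous d := continuous_iff_continuousAt.2 fun t => (hd t).continuousAt
  refine ⟨c, d, hc0, hc, hdc, fun t => ?_, fun e e' he he' T hT => ?_⟩
  · have h := hE t
    -- This choice does not increase the kinetic energy: `M d₀ d₀ = ρ ⟪v₀, d₀⟫ ≤ ρ ‖v₀‖² / 2 + M d₀
    -- d₀ / 2`.
    have h0 : massForm L ρ ε d₀ d₀ ≤ ρ * ‖v₀‖ ^ 2 := by
      have h1 := hd₀' d₀
      have h2 := massForm_self ρ ε d₀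
      have h3 := real_inner_le_norm v₀ (dispL2 L d₀)
      have h4 : ρ * ⟪v₀, dispL2 L d₀⟫ ≤ ρ / 2 * ‖v₀‖ ^ 2 + ρ / 2 * ‖dispL2 L d₀‖ ^ 2 := by
        nlinarith [sq_nonneg (‖v₀‖ - ‖dispL2 L d₀‖)]
      nlinarith [mul_nonneg hε.le (sq_nonneg ‖d₀‖)]
    rw [massForm_self] at h
    linarith
  · have hec : Continuous e := continuous_iff_continuousAt.2 fun t => (he t).continuousAt
    -- The weak formulation is the integral of this derivative over `[0,T]`, with the acceleration
    -- replaced by minus the force.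
    have hder : ∀ t, HasDerivAt (fun t => massForm L ρ ε (d t) (e t))
        (massForm L ρ ε (a t) (e t) + massForm L ρ ε (d t) (e' t)) t := fun t =>
      ((massForm L ρ ε).hasFDerivAt.comp_hasDerivAt t (hd t)).clm_apply (he t)
    have hcont : Continuous fun t => massForm L ρ ε (a t) (e t) + massForm L ρ ε (d t) (e' t) := by
      fun_prop
    have h := intervalIntegral.integral_eq_sub_of_hasDerivAt (a := 0) (b := T) (fun t _ => hder t)
      (hcont.intervalIntegrable _ _)
    rw [hT, map_zero, hd0, hd₀', zero_sub] at h
    rw [← neg_eq_iff_eq_neg, ← intervalIntegral.integral_neg] at h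
    rw [← h]
    refine intervalIntegral.integral_congr fun t _ => ?_
    simp only [heq, forceForm_apply, massForm_apply, inner_compDisp]
    ring

end Beam

/-! ### Weak derivatives on an interval and the description of `H²(0,L)`. -/

namespace Beam

open scoped RealInnerProductSpace

theorem integrable_mul_of_contDiff {L : ℝ} {f φ : ℝ → ℝ} (hf : Integrable f (seg L))
    (hφ : Continuous φ) : Integrable (fun x => f x * φ x) (seg L) := by
  obtain ⟨C, hC⟩ := (isCompact_Icc (a := (0 : ℝ)) (b := L)).exists_bound_of_continuousOn
    hφ.continuousOn
  refine hf.mul_bdd (c := C) hφ.aestronglyMeasurable ?_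
  filter_upwards [ae_restrict_mem measurableSet_Ioo] with x hx
  exact hC x (Ioo_subset_Icc_self hx)

theorem eq_zero_of_tsupport_subset_Ioo {L : ℝ} {φ : ℝ → ℝ} (h : tsupport φ ⊆ Ioo 0 L) :
    φ 0 = 0 ∧ φ L = 0 :=
  ⟨image_eq_zero_of_notMem_tsupport fun h0 => lt_irrefl _ (h h0).1,
    image_eq_zero_of_notMem_tsupport fun h0 => lt_irrefl _ (h h0).2⟩

/-- The primitive from `0` vanishes to the left of the support of `θ`, and to the right of it
because `θ` has mean zero. -/
theorem exists_contDiff_primitive {L : ℝ} {θ : ℝ → ℝ} (hθ : ContDiff ℝ ∞ θ)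
    (hcs : HasCompactSupport θ) (hsub : tsupport θ ⊆ Ioo 0 L) (h0 : ∫ x in Ioo 0 L, θ x = 0) :
    ∃ φ : ℝ → ℝ, ContDiff ℝ ∞ φ ∧ HasCompactSupport φ ∧ tsupport φ ⊆ Ioo 0 L ∧ deriv φ = θ := by
  rcases (tsupport θ).eq_empty_or_nonempty with hemp | hne
  · refine ⟨fun _ => 0, contDiff_const, HasCompactSupport.zero, by simp [tsupport], ?_⟩
    rw [tsupport_eq_empty_iff] at hemp
    ext x
    simp [hemp]
  have hK : IsCompact (tsupport θ) := hcs
  set α := sInf (tsupport θ)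
  set β := sSup (tsupport θ)
  have hα : α ∈ Ioo 0 L := hsub (hK.sInf_mem hne)
  have hβ : β ∈ Ioo 0 L := hsub (hK.sSup_mem hne)
  have hz : ∀ x, x ∉ Icc α β → θ x = 0 := fun x hx => image_eq_zero_of_notMem_tsupport fun h =>
    hx ⟨csInf_le hK.bddBelow h, le_csSup hK.bddAbove h⟩
  have hc : Continuous θ := hθ.continuous
  have hd : ∀ x, HasDerivAt (fun x => ∫ s in (0 : ℝ)..x, θ s) (θ x) x := fun x =>
    intervalIntegral.integral_hasDerivAt_right (hc.intervalIntegrable _ _)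
      hc.stronglyMeasurable.stronglyMeasurableAtFilter hc.continuousAt
  have hsupp : Function.support (fun x => ∫ s in (0 : ℝ)..x, θ s) ⊆ Icc α β := by
    intro x hx
    by_contra hx'
    apply hx
    rcases lt_or_ge x α with h | h
    · refine (intervalIntegral.integral_congr (g := fun _ => 0) fun s hs => ?_).trans (by simp)
      refine hz s fun hs' => ?_
      have : s ≤ max 0 x := hs.2
      exact absurd hs'.1 (not_le.2 (this.trans_lt (max_lt hα.1 h)))
    · have h2 : β < x := not_le.1 fun h2 => hx' ⟨h, h2⟩
      have h3 : ∫ s in (0 : ℝ)..L, θ s = 0 := by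
        rw [intervalIntegral.integral_of_le (hα.1.trans hα.2).le, integral_Ioc_eq_integral_Ioo, h0]
      have h4 : ∫ s in L..x, θ s = 0 := by
        refine (intervalIntegral.integral_congr (g := fun _ => 0) fun s hs => ?_).trans (by simp)
        refine hz s fun hs' => ?_
        have : min L x ≤ s := hs.1
        exact absurd hs'.2 (not_le.2 ((lt_min hβ.2 h2).trans_le this))
      have := intervalIntegral.integral_add_adjacent_intervals (hc.intervalIntegrable (μ := volume) 0 L)
        (hc.intervalIntegrable L x)
      simp only
      rw [← this, h3, h4, add_zero]
  have htsupp : tsupport (fun x => ∫ s in (0 : ℝ)..x, θ s) ⊆ Icc α β :=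
    closure_minimal hsupp isClosed_Icc
  have hder : deriv (fun x => ∫ s in (0 : ℝ)..x, θ s) = θ := funext fun x => (hd x).deriv
  refine ⟨fun x => ∫ s in (0 : ℝ)..x, θ s, ?_, HasCompactSupport.of_support_subset_isCompact
    isCompact_Icc hsupp, htsupp.trans fun x hx => ⟨hα.1.trans_le hx.1, hx.2.trans_lt hβ.2⟩, hder⟩
  rw [contDiff_infty_iff_deriv, hder]
  exact ⟨fun x => (hd x).differentiableAt, hθ⟩

/-- The lemma of du Bois-Reymond. -/
theorem ae_eq_const_of_integral_mul_deriv {L : ℝ} (hL : 0 < L) {f : ℝ → ℝ}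
    (hf : Integrable f (seg L))
    (h : ∀ φ : ℝ → ℝ, ContDiff ℝ ∞ φ → HasCompactSupport φ → tsupport φ ⊆ Ioo 0 L →
      ∫ x in Ioo 0 L, f x * deriv φ x = 0) : ∃ a, f =ᵐ[seg L] fun _ => a := by
  let b : ContDiffBump (L / 2) := ⟨L / 8, L / 4, by positivity, by linarith⟩
  set η : ℝ → ℝ := b.normed volume with hη
  have hηs : ContDiff ℝ ∞ η := b.contDiff_normed
  have hηc : HasCompactSupport η := b.hasCompactSupport_normed
  have hηt : tsupport η ⊆ Ioo 0 L := by
    rw [hη, b.tsupport_normed_eq, Real.closedBall_eq_Icc]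
    exact fun x hx => ⟨by linarith [hx.1, hx.2, show b.rOut = L / 4 from rfl],
      by linarith [hx.1, hx.2, show b.rOut = L / 4 from rfl]⟩
  have hη1 : ∫ x in Ioo 0 L, η x = 1 := by
    rw [setIntegral_eq_integral_of_forall_compl_eq_zero, b.integral_normed]
    exact fun x hx => image_eq_zero_of_notMem_tsupport fun h => hx (hηt h)
  set a := ∫ x in Ioo 0 L, f x * η x with ha
  refine ⟨a, ?_⟩
  have hfa : Integrable (fun x => f x - a) (seg L) := hf.sub (integrable_const a)
  have key := isOpen_Ioo.ae_eq_zero_of_integral_contDiff_smul_eq_zero (μ := volume)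
    (U := Ioo 0 L) (f := fun x => f x - a) (IntegrableOn.locallyIntegrableOn hfa) ?_
  · rw [Filter.EventuallyEq, ae_restrict_iff' measurableSet_Ioo]
    filter_upwards [key] with x hx hx'
    linarith [hx hx']
  · intro ψ hψ hψc hψt
    set m := ∫ x in Ioo 0 L, ψ x with hm
    have hψi : Integrable ψ (seg L) := integrable_seg hψ.continuous
    have hηi : Integrable η (seg L) := integrable_seg hηs.continuous
    -- Subtracting `m` times a bump of unit mass makes the mean zero, so any test function is a
    -- derivative up to a multiple of `η`; that multiple produces the constant `a`.
    obtain ⟨φ, h1, h2, h3, h4⟩ := exists_contDiff_primitive (L := L) (θ := fun x => ψ x - m * η x)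
      (hψ.sub (contDiff_const.mul hηs)) (hψc.sub hηc.mul_left)
      ((tsupport_sub ψ _).trans (union_subset hψt ((tsupport_mul_subset_right).trans hηt)))
      (by rw [integral_sub hψi (hηi.const_mul m), integral_const_mul, hη1, ← hm]; ring)
    have h5 := h φ h1 h2 h3
    rw [h4] at h5
    have i1 := integrable_mul_of_contDiff hf hψ.continuous
    have i2 := integrable_mul_of_contDiff hf hηs.continuous
    have e1 : ∫ x in Ioo 0 L, f x * (ψ x - m * η x) = (∫ x in Ioo 0 L, f x * ψ x) - m * a := by
      rw [ha, ← integral_const_mul, ← integral_sub i1 (i2.const_mul m)]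
      exact integral_congr_ae (Eventually.of_forall fun x => by simp only; ring)
    have e2 : ∫ x, ψ x • (f x - a) = ∫ x in Ioo 0 L, (f x * ψ x - a * ψ x) := by
      rw [setIntegral_eq_integral_of_forall_compl_eq_zero]
      · exact integral_congr_ae (Eventually.of_forall fun x => by simp only [smul_eq_mul]; ring)
      · intro x hx
        rw [image_eq_zero_of_notMem_tsupport fun h => hx (hψt h)]
        ring
    rw [e2, integral_sub i1 (hψi.const_mul a), integral_const_mul, ← hm]
    linarith

variable {L : ℝ} [hL : Fact (0 < L)]

/-- As `g` is merely square integrable, its primitive is only absolutely continuous: integration by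
parts is used in that class and Lebesgue differentiation identifies the derivative. -/
theorem integral_primAt_mul_deriv (g : Lp ℝ 2 (seg L)) {φ : ℝ → ℝ} (hφ : ContDiff ℝ 1 φ)
    (h0 : φ 0 = 0) (h1 : φ L = 0) :
    ∫ x in Ioo 0 L, primAt L x g * deriv φ x = -∫ x in Ioo 0 L, g x * φ x := by
  have hl := hL.out
  have hi := integrable_indicator_Lp g
  have hac : AbsolutelyContinuousOnInterval (fun x => primAt L x g) 0 L := by
    simp only [primAt_eq]
    exact hi.intervalIntegrable.absolutelyContinuousOnInterval_intervalIntegral left_mem_uIcc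
  have hφa : AbsolutelyContinuousOnInterval φ 0 L :=
    hφ.contDiffOn.absolutelyContinuousOnInterval
  have h := hac.integral_mul_deriv_eq_deriv_mul hφa
  rw [h0, h1, mul_zero, mul_zero, sub_zero, zero_sub] at h
  have e := integral_seg (L := L) fun x => primAt L x g * deriv φ x
  rw [h] at e
  rw [e, intervalIntegral.integral_of_le hl.le, integral_Ioc_eq_integral_Ioo]
  congr 1
  refine integral_congr_ae ?_
  rw [Filter.EventuallyEq, ae_restrict_iff' measurableSet_Ioo]
  filter_upwards [LocallyIntegrable.ae_hasDerivAt_integral hi.locallyIntegrable] with x hx hx'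
  have h2 := hx 0
  simp only [← primAt_eq] at h2
  rw [h2.deriv, indicator_of_mem hx']

theorem integral_disp_mul_deriv (c : StateSpace L) {φ : ℝ → ℝ} (hφ : ContDiff ℝ 1 φ)
    (h0 : φ 0 = 0) (h1 : φ L = 0) :
    ∫ x in Ioo 0 L, disp L c x * deriv φ x = -∫ x in Ioo 0 L, slopeAt L c x * φ x := by
  have hs : Continuous (slopeAt L c) := continuous_const.add (continuous_primAt_snd c.snd)
  have h := intervalIntegral.integral_mul_deriv_eq_deriv_mul (a := 0) (b := L)
    (fun x _ => hasDerivAt_disp c x) (fun x _ => (hφ.differentiable (by norm_num) x).hasDerivAt)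
    (hs.intervalIntegrable _ _) ((hφ.continuous_deriv le_rfl).intervalIntegrable _ _)
  rw [h0, h1, mul_zero, mul_zero, sub_zero, zero_sub] at h
  have e := integral_seg (L := L) fun x => disp L c x * deriv φ x
  have e' := integral_seg (L := L) fun x => slopeAt L c x * φ x
  rw [e, h, e']

theorem integral_slopeAt_mul_deriv (c : StateSpace L) {φ : ℝ → ℝ} (hφ : ContDiff ℝ 1 φ)
    (h0 : φ 0 = 0) (h1 : φ L = 0) :
    ∫ x in Ioo 0 L, slopeAt L c x * deriv φ x = -∫ x in Ioo 0 L, c.snd x * φ x := by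
  have hd := hφ.continuous_deriv le_rfl
  have i1 : Integrable (fun x => c.fst 1 * deriv φ x) (seg L) := integrable_seg (continuous_const.mul hd)
  have i2 : Integrable (fun x => primAt L x c.snd * deriv φ x) (seg L) :=
    integrable_seg ((continuous_primAt_snd c.snd).mul hd)
  have e := integral_seg (L := L) fun x => deriv φ x
  rw [intervalIntegral.integral_deriv_eq_sub (fun x _ => hφ.differentiable (by norm_num) x)
    (hd.intervalIntegrable _ _), h0, h1, sub_zero] at e
  simp only [slopeAt, add_mul]
  rw [integral_add i1 i2, integral_const_mul, e, mul_zero, zero_add, integral_primAt_mul_deriv _ hφ h0 h1]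

theorem integral_disp_mul_deriv_deriv (c : StateSpace L) {φ : ℝ → ℝ} (hφ : ContDiff ℝ ∞ φ)
    (hsub : tsupport φ ⊆ Ioo 0 L) :
    ∫ x in Ioo 0 L, disp L c x * deriv (deriv φ) x = ∫ x in Ioo 0 L, c.snd x * φ x := by
  have h := eq_zero_of_tsupport_subset_Ioo hsub
  have h' := eq_zero_of_tsupport_subset_Ioo (tsupport_deriv_subset.trans hsub)
  have hd : ContDiff ℝ ∞ (deriv φ) := (contDiff_infty_iff_deriv.1 hφ).2
  rw [integral_disp_mul_deriv c (hd.of_le (by exact_mod_cast le_top)) h'.1 h'.2,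
    integral_slopeAt_mul_deriv c (hφ.of_le (by exact_mod_cast le_top)) h.1 h.2, neg_neg]

/-- Functions in `H²(0,L)` are displacement fields of states. -/
theorem exists_state_of_memH2 {u₀ : ℝ → ℝ} (h : MemH2 L u₀) :
    ∃ (w₀ : ℝ → ℝ) (c : StateSpace L), HasWeakDeriv 2 (Ioo 0 L) u₀ w₀ ∧
      c.snd =ᵐ[seg L] w₀ ∧ u₀ =ᵐ[seg L] disp L c := by
  have hl := hL.out
  obtain ⟨hu, ⟨f₁, hw1, hf1⟩, ⟨f₂, hw2, hf2⟩⟩ := h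
  set g : Lp ℝ 2 (seg L) := hf2.toLp f₂ with hg
  have hgf : g =ᵐ[seg L] f₂ := hf2.coeFn_toLp
  have hu1 : Integrable u₀ (seg L) := hu.integrable one_le_two
  have hf11 : Integrable f₁ (seg L) := hf1.integrable one_le_two
  have hpc := continuous_primAt_snd g
  -- The first weak derivative and the primitive of the second have the same weak derivative, so
  -- they differ by a constant, the slope at `0`.
  obtain ⟨b, hb⟩ := ae_eq_const_of_integral_mul_deriv hl (f := fun x => f₁ x - primAt L x g)
    (hf11.sub (integrable_seg hpc)) (by
      intro φ hφ hφc hφt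
      have hd : ContDiff ℝ ∞ (deriv φ) := (contDiff_infty_iff_deriv.1 hφ).2
      have h0 := eq_zero_of_tsupport_subset_Ioo hφt
      have h1 := hw1.2.2 (deriv φ) hd hφc.deriv (tsupport_deriv_subset.trans hφt)
      have h2 := hw2.2.2 φ hφ hφc hφt
      have h3 := integral_primAt_mul_deriv g (hφ.of_le (by exact_mod_cast le_top)) h0.1 h0.2
      have h4 : ∫ x in Ioo 0 L, g x * φ x = ∫ x in Ioo 0 L, f₂ x * φ x :=
        integral_congr_ae (hgf.mono fun x hx => by simp only [hx])
      rw [iteratedDeriv_one] at h1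
      rw [iteratedDeriv_succ, iteratedDeriv_one] at h2
      simp only [sub_mul]
      rw [integral_sub (integrable_mul_of_contDiff hf11 hd.continuous)
        (integrable_mul_of_contDiff (integrable_seg hpc) hd.continuous), h3, h4]
      linarith)
  let c' : StateSpace L := WithLp.toLp 2 (!₂[(0 : ℝ), b], g)
  have hs : f₁ =ᵐ[seg L] slopeAt L c' := by
    filter_upwards [hb] with x hx
    simp only [slopeAt, c', WithLp.toLp_fst, WithLp.toLp_snd]
    simp
    linarith
  -- The same argument one order lower yields the value at `0`.
  obtain ⟨a, ha⟩ := ae_eq_const_of_integral_mul_deriv hl (f := fun x => u₀ x - disp L c' x)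
    (hu1.sub (integrable_seg (continuous_disp c'))) (by
      intro φ hφ hφc hφt
      have hd : ContDiff ℝ ∞ (deriv φ) := (contDiff_infty_iff_deriv.1 hφ).2
      have h0 := eq_zero_of_tsupport_subset_Ioo hφt
      have h1 := hw1.2.2 φ hφ hφc hφt
      have h3 := integral_disp_mul_deriv c' (hφ.of_le (by exact_mod_cast le_top)) h0.1 h0.2
      have h4 : ∫ x in Ioo 0 L, f₁ x * φ x = ∫ x in Ioo 0 L, slopeAt L c' x * φ x :=
        integral_congr_ae (hs.mono fun x hx => by simp only [hx])
      rw [iteratedDeriv_one] at h1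
      simp only [sub_mul]
      rw [integral_sub (integrable_mul_of_contDiff hu1 hd.continuous)
        (integrable_mul_of_contDiff (integrable_seg (continuous_disp c')) hd.continuous), h3, h1, h4]
      ring)
  refine ⟨f₂, WithLp.toLp 2 (!₂[a, b], g), hw2, hgf, ?_⟩
  filter_upwards [ha] with x hx
  simp only [disp_apply, c', WithLp.toLp_fst, WithLp.toLp_snd] at hx ⊢
  simp at hx ⊢
  linarith

end Beam

/-! ### Test functions as curves of states. -/

namespace Beam

open scoped RealInnerProductSpace

/-- The time derivative as a directional derivative. -/
noncomputable def dt (φ : ℝ × ℝ → ℝ) (p : ℝ × ℝ) : ℝ := fderiv ℝ φ p (1, 0)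

/-- The space derivative as a directional derivative. -/
noncomputable def dx (φ : ℝ × ℝ → ℝ) (p : ℝ × ℝ) : ℝ := fderiv ℝ φ p (0, 1)

section Partial

variable {φ : ℝ × ℝ → ℝ}

theorem contDiff_dt (hφ : ContDiff ℝ ∞ φ) : ContDiff ℝ ∞ (dt φ) :=
  (hφ.fderiv_right (m := ∞) (by exact_mod_cast le_top)).clm_apply contDiff_const

theorem contDiff_dx (hφ : ContDiff ℝ ∞ φ) : ContDiff ℝ ∞ (dx φ) :=
  (hφ.fderiv_right (m := ∞) (by exact_mod_cast le_top)).clm_apply contDiff_const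

theorem tsupport_dt_subset : tsupport (dt φ) ⊆ tsupport φ :=
  (closure_mono fun p hp => by
    rw [Function.mem_support] at hp ⊢
    intro h
    exact hp (by rw [dt, h]; rfl)).trans (tsupport_fderiv_subset ℝ)

theorem tsupport_dx_subset : tsupport (dx φ) ⊆ tsupport φ :=
  (closure_mono fun p hp => by
    rw [Function.mem_support] at hp ⊢
    intro h
    exact hp (by rw [dx, h]; rfl)).trans (tsupport_fderiv_subset ℝ)

theorem hasCompactSupport_dt (h : HasCompactSupport φ) : HasCompactSupport (dt φ) :=
  h.of_isClosed_subset isClosed_closure tsupport_dt_subset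

theorem hasCompactSupport_dx (h : HasCompactSupport φ) : HasCompactSupport (dx φ) :=
  h.of_isClosed_subset isClosed_closure tsupport_dx_subset

theorem hasDerivAt_time (hφ : ContDiff ℝ ∞ φ) (t x : ℝ) :
    HasDerivAt (fun s => φ (s, x)) (dt φ (t, x)) t :=
  (hφ.differentiable (by simp) (t, x)).hasFDerivAt.comp_hasDerivAt t
    ((hasDerivAt_id t).prodMk (hasDerivAt_const t x))

theorem hasDerivAt_space (hφ : ContDiff ℝ ∞ φ) (t x : ℝ) :
    HasDerivAt (fun y => φ (t, y)) (dx φ (t, x)) x :=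
  (hφ.differentiable (by simp) (t, x)).hasFDerivAt.comp_hasDerivAt x
    ((hasDerivAt_const x t).prodMk (hasDerivAt_id x))

theorem partialT_one (hφ : ContDiff ℝ ∞ φ) : partialT 1 φ = dt φ := by
  ext p
  rw [partialT, iteratedDeriv_one, (hasDerivAt_time hφ p.1 p.2).deriv]

theorem partialT_two (hφ : ContDiff ℝ ∞ φ) : partialT 2 φ = dt (dt φ) := by
  ext p
  rw [partialT, iteratedDeriv_succ, iteratedDeriv_one]
  have : deriv (fun s => φ (s, p.2)) = fun s => dt φ (s, p.2) :=
    funext fun s => (hasDerivAt_time hφ s p.2).deriv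
  rw [this, (hasDerivAt_time (contDiff_dt hφ) p.1 p.2).deriv]

theorem deriv_deriv_slice (hφ : ContDiff ℝ ∞ φ) (t : ℝ) :
    deriv (deriv fun y => φ (t, y)) = fun x => dx (dx φ) (t, x) := by
  have : deriv (fun y => φ (t, y)) = fun y => dx φ (t, y) :=
    funext fun y => (hasDerivAt_space hφ t y).deriv
  rw [this]
  exact funext fun x => (hasDerivAt_space (contDiff_dx hφ) t x).deriv

theorem partialX_two (hφ : ContDiff ℝ ∞ φ) : partialX 2 φ = dx (dx φ) := by
  ext p
  rw [partialX, iteratedDeriv_succ, iteratedDeriv_one, deriv_deriv_slice hφ]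

theorem exists_time_bound (h : HasCompactSupport φ) :
    ∃ T > 0, ∀ t x, T ≤ t → (t, x) ∉ tsupport φ := by
  obtain ⟨R, hR, hsub⟩ := h.isBounded.subset_closedBall_lt 0 0
  refine ⟨R + 1, by linarith, fun t x ht hp => ?_⟩
  have h1 := hsub hp
  rw [mem_closedBall_zero_iff] at h1
  have h2 := (_root_.norm_fst_le (t, x)).trans h1
  rw [Real.norm_eq_abs] at h2
  linarith [le_abs_self t]

end Partial

/-- The slice at time `t` of a continuous function, in `L²(0,L)`. -/
noncomputable def sliceL2 (L : ℝ) {ψ : ℝ × ℝ → ℝ} (hψ : Continuous ψ) (t : ℝ) : Lp ℝ 2 (seg L) :=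
  (memLp_seg (hψ.comp (by fun_prop : Continuous fun x : ℝ => (t, x)))).toLp (fun x => ψ (t, x))

theorem coeFn_sliceL2 {L : ℝ} {ψ : ℝ × ℝ → ℝ} (hψ : Continuous ψ) (t : ℝ) :
    sliceL2 L hψ t =ᵐ[seg L] fun x => ψ (t, x) :=
  (memLp_seg (hψ.comp (by fun_prop : Continuous fun x : ℝ => (t, x)))).coeFn_toLp

/-- A bound for the second time derivative, uniform in `x`, makes the Taylor remainder quadratic in
the supremum norm, hence in `L²`. -/
theorem hasDerivAt_sliceL2 {L : ℝ} {ψ : ℝ × ℝ → ℝ} (hψ : ContDiff ℝ ∞ ψ)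
    (hc : HasCompactSupport ψ) (t : ℝ) :
    HasDerivAt (sliceL2 L hψ.continuous) (sliceL2 L (contDiff_dt hψ).continuous t) t := by
  have h2 := contDiff_dt (contDiff_dt hψ)
  obtain ⟨B, hB⟩ := (hasCompactSupport_dt (hasCompactSupport_dt hc)).exists_bound_of_continuous
    h2.continuous
  have hB0 : 0 ≤ B := (norm_nonneg _).trans (hB 0)
  rw [hasDerivAt_iff_hasFDerivAt]
  refine hasFDerivAt_of_sq_remainder
    (C := (seg L).real univ ^ ((2 : ENNReal).toReal)⁻¹ * B) fun s => ?_
  rw [mul_assoc]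
  refine Lp.norm_le_of_ae_bound (by positivity) ?_
  set a := sliceL2 L hψ.continuous (t + s)
  set b := sliceL2 L hψ.continuous t
  set d := sliceL2 L (contDiff_dt hψ).continuous t
  have e : a - b - (ContinuousLinearMap.toSpanSingleton ℝ d) s = a - b - s • d := by simp
  rw [e]
  filter_upwards [Lp.coeFn_sub (a - b) (s • d), Lp.coeFn_sub a b, Lp.coeFn_smul s d,
    coeFn_sliceL2 hψ.continuous (t + s), coeFn_sliceL2 hψ.continuous t,
    coeFn_sliceL2 (contDiff_dt hψ).continuous t] with x h1 h2 h3 h4 h5 h6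
  rw [h1, Pi.sub_apply, h2, Pi.sub_apply, h3, Pi.smul_apply, h4, h5, h6, smul_eq_mul, mul_comm s]
  have hl : LipschitzWith (NNReal.mk B hB0) fun s => dt ψ (s, x) := by
    refine LipschitzWith.of_dist_le_mul fun r r' => ?_
    exact Convex.norm_image_sub_le_of_norm_hasDerivWithin_le (s := univ)
      (fun z _ => (hasDerivAt_time (contDiff_dt hψ) z x).hasDerivWithinAt) (fun z _ => hB _)
      convex_univ (mem_univ r') (mem_univ r)
  have := abs_taylor_le (fun s => hasDerivAt_time hψ s x) hl t s
  rw [Real.norm_eq_abs, Real.norm_eq_abs, sq_abs]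
  exact this

theorem primAt_toLp {L : ℝ} {f f' : ℝ → ℝ} (hf : ∀ x, HasDerivAt f (f' x) x) (hf' : Continuous f') {x : ℝ}
    (hx : x ∈ Icc 0 L) : primAt L x ((memLp_seg hf').toLp f') = f x - f 0 := by
  rw [primAt_eq, ← intervalIntegral.integral_eq_sub_of_hasDerivAt (fun y _ => hf y)
    (hf'.intervalIntegrable _ _)]
  refine intervalIntegral.integral_congr_ae ?_
  -- The extension by zero vanishes at `L`, which belongs to the domain of integration when `x = L`.
  have h1 : ∀ᵐ y, y ≠ L := by simp [ae_iff, measure_singleton]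
  have h2 := (ae_restrict_iff' measurableSet_Ioo).1 (memLp_seg (L := L) hf').coeFn_toLp
  filter_upwards [h1, h2] with y hy1 hy2 hy3
  rw [uIoc_of_le hx.1] at hy3
  have hy : y ∈ Ioo 0 L := ⟨hy3.1, lt_of_le_of_ne (hy3.2.trans hx.2) hy1⟩
  rw [indicator_of_mem hy, hy2 hy]

variable {L : ℝ} [hL : Fact (0 < L)]

theorem continuous_disp_apply (x : ℝ) : Continuous fun c : StateSpace L => disp L c x :=
  continuous_disp_uncurry.comp (by fun_prop : Continuous fun c : StateSpace L => (c, x))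

/-- Evaluation of the displacement at a point. -/
noncomputable def evalAt (L x : ℝ) [Fact (0 < L)] : StateSpace L →L[ℝ] ℝ where
  toFun c := disp L c x
  map_add' c e := by rw [map_add]; rfl
  map_smul' r c := by rw [map_smul]; rfl
  cont := continuous_disp_apply x

theorem evalAt_apply (x : ℝ) (c : StateSpace L) : evalAt L x c = disp L c x := rfl

theorem dispL2_eq_sliceL2 {c : StateSpace L} {t : ℝ} {ψ : ℝ × ℝ → ℝ} (hψ : Continuous ψ)
    (h : ∀ x ∈ Icc 0 L, disp L c x = ψ (t, x)) : dispL2 L c = sliceL2 L hψ t := by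
  refine Lp.ext ?_
  filter_upwards [coeFn_dispL2 c, coeFn_sliceL2 hψ t, ae_restrict_mem measurableSet_Ioo]
    with x h1 h2 h3
  rw [h1, h2, h x (Ioo_subset_Icc_self h3)]

/-- The slices of a test function form a differentiable curve of states. -/
theorem exists_testCurve {φ : ℝ × ℝ → ℝ} (hφ : ContDiff ℝ ∞ φ) (hc : HasCompactSupport φ) :
    ∃ e e' : ℝ → StateSpace L, (∀ t, HasDerivAt e (e' t) t) ∧ Continuous e' ∧
      (∀ t, dispL2 L (e t) = sliceL2 L hφ.continuous t) ∧
      (∀ t, dispL2 L (e' t) = sliceL2 L (contDiff_dt hφ).continuous t) ∧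
      (∀ t, (e t).snd = sliceL2 L (contDiff_dx (contDiff_dx hφ)).continuous t) ∧
      ∀ t, (∀ x, (t, x) ∉ tsupport φ) → e t = 0 := by
  have h1 := contDiff_dx hφ
  have h2 := contDiff_dx h1
  have c1 := hasCompactSupport_dx hc
  have c2 := hasCompactSupport_dx c1
  let k₀ : StateSpace L := WithLp.toLp 2 (!₂[(1 : ℝ), 0], 0)
  let k₁ : StateSpace L := WithLp.toLp 2 (!₂[(0 : ℝ), 1], 0)
  let ι : Lp ℝ 2 (seg L) →L[ℝ] StateSpace L :=
    ((WithLp.prodContinuousLinearEquiv 2 ℝ (EuclideanSpace ℝ (Fin 2)) (Lp ℝ 2 (seg L))).symm :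
      EuclideanSpace ℝ (Fin 2) × Lp ℝ 2 (seg L) →L[ℝ] StateSpace L).comp
        (ContinuousLinearMap.inr ℝ _ _)
  have hι : ∀ g, (ι g).fst = 0 ∧ (ι g).snd = g := fun g => ⟨rfl, rfl⟩
  -- Value and slope at `0` and second space derivative of the slice: the coordinates of `φ(t,·)` as
  -- a state.
  let e : ℝ → StateSpace L := fun t => φ (t, 0) • k₀ + dx φ (t, 0) • k₁ + ι (sliceL2 L h2.continuous t)
  let e' : ℝ → StateSpace L := fun t => dt φ (t, 0) • k₀ + dt (dx φ) (t, 0) • k₁ +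
    ι (sliceL2 L (contDiff_dt h2).continuous t)
  have he : ∀ t, HasDerivAt e (e' t) t := fun t =>
    (((hasDerivAt_time hφ t 0).smul_const k₀).add ((hasDerivAt_time h1 t 0).smul_const k₁)).add
      (ι.hasFDerivAt.comp_hasDerivAt t (hasDerivAt_sliceL2 h2 c2 t))
  have hsc : Continuous (sliceL2 L (contDiff_dt h2).continuous) :=
    continuous_iff_continuousAt.2 fun t =>
      (hasDerivAt_sliceL2 (contDiff_dt h2) (hasCompactSupport_dt c2) t).continuousAt
  have he' : Continuous e' := by
    have a1 := (contDiff_dt hφ).continuous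
    have a2 := (contDiff_dt h1).continuous
    fun_prop
  have hsnd : ∀ t, (e t).snd = sliceL2 L h2.continuous t := by
    intro t
    simp only [e, WithLp.add_snd, WithLp.smul_snd, k₀, k₁, (hι _).2]
    simp
  have hfst0 : ∀ t, (e t).fst 0 = φ (t, 0) := by
    intro t
    simp only [e, WithLp.add_fst, WithLp.smul_fst, k₀, k₁, (hι _).1]
    simp
  have hfst1 : ∀ t, (e t).fst 1 = dx φ (t, 0) := by
    intro t
    simp only [e, WithLp.add_fst, WithLp.smul_fst, k₀, k₁, (hι _).1]
    simp
  have hdisp : ∀ t, ∀ x ∈ Icc 0 L, disp L (e t) x = φ (t, x) := by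
    intro t x hx
    have hcx : Continuous fun y => dx φ (t, y) := h1.continuous.comp (by fun_prop)
    have b1 : ∫ s in (0 : ℝ)..x, primAt L s (e t).snd =
        ∫ s in (0 : ℝ)..x, (dx φ (t, s) - dx φ (t, 0)) := by
      refine intervalIntegral.integral_congr fun s hs => ?_
      rw [uIcc_of_le hx.1] at hs
      simp only [hsnd]
      exact primAt_toLp (f := fun y => dx φ (t, y)) (hasDerivAt_space h1 t)
        (h2.continuous.comp (by fun_prop : Continuous fun x : ℝ => (t, x))) ⟨hs.1, hs.2.trans hx.2⟩
    rw [disp_apply, hfst0, hfst1, b1, intervalIntegral.integral_sub (hcx.intervalIntegrable _ _)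
      (by simp), intervalIntegral.integral_eq_sub_of_hasDerivAt
        (fun y _ => hasDerivAt_space hφ t y) (hcx.intervalIntegrable _ _)]
    simp
    ring
  -- Evaluation at `x` is continuous and linear, so the displacement of `e'` follows from that of
  -- `e` by uniqueness of derivatives.
  have hdisp' : ∀ t, ∀ x ∈ Icc 0 L, disp L (e' t) x = dt φ (t, x) := by
    intro t x hx
    have b1 : HasDerivAt (fun s => evalAt L x (e s)) (evalAt L x (e' t)) t :=
      (evalAt L x).hasFDerivAt.comp_hasDerivAt t (he t)
    simp only [evalAt_apply, fun s => hdisp s x hx] at b1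
    exact b1.unique (hasDerivAt_time hφ t x)
  refine ⟨e, e', he, he', fun t => dispL2_eq_sliceL2 _ (hdisp t),
    fun t => dispL2_eq_sliceL2 _ (hdisp' t), hsnd, fun t ht => ?_⟩
  have z : ∀ x, φ (t, x) = 0 ∧ dx φ (t, x) = 0 ∧ dx (dx φ) (t, x) = 0 := fun x =>
    ⟨image_eq_zero_of_notMem_tsupport (ht x),
      image_eq_zero_of_notMem_tsupport fun h => ht x (tsupport_dx_subset h),
      image_eq_zero_of_notMem_tsupport fun h => ht x (tsupport_dx_subset (tsupport_dx_subset h))⟩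
  have z2 : sliceL2 L h2.continuous t = 0 := by
    refine Lp.ext ?_
    filter_upwards [coeFn_sliceL2 (L := L) h2.continuous t, Lp.coeFn_zero ℝ 2 (seg L)] with x a b
    rw [a, b, (z x).2.2]
    rfl
  simp only [e, (z 0).1, (z 0).2.1, z2, zero_smul, map_zero, add_zero]

end Beam

/-! ### Weak limits on the space-time strip. -/

namespace Beam

open scoped RealInnerProductSpace

/-- Lebesgue measure on the space-time strip. -/
noncomputable abbrev stripMeasure (L : ℝ) : Measure (ℝ × ℝ) := volume.restrict (strip L)

theorem stripMeasure_eq_prod (L : ℝ) :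
    stripMeasure L = (volume.restrict (Ioi (0 : ℝ))).prod (seg L) := by
  rw [stripMeasure, strip, Measure.volume_eq_prod, Measure.prod_restrict]

theorem measurableSet_strip (L : ℝ) : MeasurableSet (strip L) :=
  measurableSet_Ioi.prod measurableSet_Ioo

theorem isOpen_strip (L : ℝ) : IsOpen (strip L) := isOpen_Ioi.prod isOpen_Ioo

theorem integral_strip {L : ℝ} {H : ℝ × ℝ → ℝ} (hH : Integrable H (stripMeasure L)) :
    ∫ p, H p ∂(stripMeasure L) = ∫ t in Ioi (0 : ℝ), ∫ x, H (t, x) ∂(seg L) := by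
  rw [stripMeasure_eq_prod] at hH ⊢
  exact integral_prod _ hH

theorem stripMeasure_lt_top {L T : ℝ} : stripMeasure L {p | p.1 < T} < ⊤ := by
  have : stripMeasure L {p | p.1 < T} ≤ volume (Ioo 0 T ×ˢ Ioo 0 L) := by
    rw [stripMeasure, Measure.restrict_apply (measurableSet_lt measurable_fst measurable_const)]
    exact measure_mono fun p hp => ⟨⟨hp.2.1, hp.1⟩, hp.2.2⟩
  refine this.trans_lt ?_
  rw [Measure.volume_eq_prod, Measure.prod_prod, Real.volume_Ioo, Real.volume_Ioo]
  exact ENNReal.mul_lt_top ENNReal.ofReal_lt_top ENNReal.ofReal_lt_top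

theorem memLp_exp_mul_of_bounded {L T C : ℝ} {G : ℝ × ℝ → ℝ}
    (hG : AEStronglyMeasurable G (stripMeasure L)) (hC : ∀ p, |G p| ≤ C)
    (hT : ∀ p, T ≤ p.1 → G p = 0) :
    MemLp (fun p => Real.exp p.1 * G p) 2 (stripMeasure L) := by
  have hm : MeasurableSet {p : ℝ × ℝ | p.1 < T} := measurableSet_lt measurable_fst measurable_const
  have h := memLp_indicator_const (μ := stripMeasure L) 2 hm (Real.exp T * C)
    (Or.inr stripMeasure_lt_top.ne)
  refine h.mono ((by fun_prop : Continuous fun p : ℝ × ℝ => Real.exp p.1).aestronglyMeasurable.mul hG)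
    (Eventually.of_forall fun p => ?_)
  by_cases hp : p.1 < T
  · rw [indicator_of_mem (show p ∈ {p : ℝ × ℝ | p.1 < T} from hp), norm_mul, norm_mul,
      Real.norm_of_nonneg (Real.exp_pos _).le, Real.norm_of_nonneg (Real.exp_pos _).le]
    refine mul_le_mul (Real.exp_le_exp.2 hp.le) ((hC p).trans (le_abs_self C)) (norm_nonneg _)
      (Real.exp_pos _).le
  · rw [hT p (not_lt.1 hp)]
    simp

/-- The weights cancel: functions bounded in time with values in `L²(0,L)` are square integrable
only after damping, and test functions of bounded time support absorb the growing weight. -/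
theorem integrable_mul_of_memLp_exp {L : ℝ} {f G : ℝ × ℝ → ℝ}
    (hf : MemLp (fun p => Real.exp (-p.1) * f p) 2 (stripMeasure L))
    (hG : MemLp (fun p => Real.exp p.1 * G p) 2 (stripMeasure L)) :
    Integrable (fun p => f p * G p) (stripMeasure L) := by
  refine (hf.integrable_mul hG).congr (Eventually.of_forall fun p => ?_)
  have : Real.exp (-p.1) * Real.exp p.1 = 1 := by rw [← Real.exp_add]; simp
  calc _ = (Real.exp (-p.1) * Real.exp p.1) * (f p * G p) := by simp only [Pi.mul_apply]; ring
    _ = _ := by rw [this, one_mul]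

/-- Functions with slices bounded in `L²(0,L)` are square integrable with an exponential weight. -/
theorem memLp_exp_mul_of_slices {L A : ℝ} {F : ℝ × ℝ → ℝ}
    (hF : AEStronglyMeasurable F (stripMeasure L)) {f : ℝ → Lp ℝ 2 (seg L)}
    (hf : ∀ t, (fun x => F (t, x)) =ᵐ[seg L] f t) (hA : ∀ t, ‖f t‖ ≤ A) :
    ∃ h : MemLp (fun p => Real.exp (-p.1) * F p) 2 (stripMeasure L), ‖h.toLp _‖ ≤ A := by
  have hA0 : 0 ≤ A := (norm_nonneg _).trans (hA 0)
  have hm : AEStronglyMeasurable (fun p : ℝ × ℝ => Real.exp (-p.1) * F p) (stripMeasure L) :=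
    (by fun_prop : Continuous fun p : ℝ × ℝ => Real.exp (-p.1)).aestronglyMeasurable.mul hF
  have hsl : ∀ t, ∫⁻ x, ‖F (t, x)‖ₑ ^ (2 : ℝ) ∂(seg L) ≤ ENNReal.ofReal A ^ (2 : ℝ) := by
    intro t
    have h1 : ∫⁻ x, ‖F (t, x)‖ₑ ^ (2 : ℝ) ∂(seg L) = ‖f t‖ₑ ^ (2 : ℝ) := by
      have h0 : (fun x => ‖F (t, x)‖ₑ ^ (2 : ℝ)) =ᵐ[seg L] fun x => ‖f t x‖ₑ ^ (2 : ℝ) := by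
        filter_upwards [hf t] with x hx
        rw [hx]
      rw [lintegral_congr_ae h0, Lp.enorm_def]
      exact (eLpNorm_nnreal_pow_eq_lintegral (p := 2) two_ne_zero).symm
    rw [h1]
    refine ENNReal.rpow_le_rpow ?_ two_pos.le
    rw [← ofReal_norm]
    exact ENNReal.ofReal_le_ofReal (hA t)
  have hexp : ∫⁻ t in Ioi (0 : ℝ), ENNReal.ofReal (Real.exp (-t)) = 1 := by
    rw [← ofReal_integral_eq_lintegral_ofReal, integral_exp_neg_Ioi_zero, ENNReal.ofReal_one]
    · exact integrableOn_exp_neg_Ioi 0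
    · exact Eventually.of_forall fun t => (Real.exp_pos _).le
  have hbound : eLpNorm (fun p => Real.exp (-p.1) * F p) 2 (stripMeasure L) ≤ ENNReal.ofReal A := by
    rw [← ENNReal.rpow_le_rpow_iff (two_pos (α := ℝ))]
    refine (eLpNorm_nnreal_pow_eq_lintegral (p := 2) two_ne_zero).trans_le ?_
    rw [stripMeasure_eq_prod] at hm ⊢
    rw [lintegral_prod _ (hm.enorm.pow_const _)]
    calc _ ≤ ∫⁻ t in Ioi (0 : ℝ), ENNReal.ofReal (Real.exp (-t)) * ENNReal.ofReal A ^ (2 : ℝ) := by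
          refine setLIntegral_mono' measurableSet_Ioi fun t ht => ?_
          -- The squared weight `exp (-2t)` is at most `exp (-t)` for `t > 0`, whose integral is
          -- `1`, so the bound `A` is kept.
          have e : ENNReal.ofReal (Real.exp (-t)) ^ (2 : ℝ) ≤ ENNReal.ofReal (Real.exp (-t)) := by
            rw [ENNReal.ofReal_rpow_of_pos (Real.exp_pos _)]
            refine ENNReal.ofReal_le_ofReal ?_
            rw [← Real.exp_mul]
            exact Real.exp_le_exp.2 (by linarith [mem_Ioi.1 ht])
          simp only [enorm_mul, NNReal.coe_ofNat]
          simp_rw [ENNReal.mul_rpow_of_nonneg _ _ (two_pos (α := ℝ)).le]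
          rw [lintegral_const_mul' _ _ (by simp)]
          refine mul_le_mul' ?_ (hsl t)
          rwa [Real.enorm_of_nonneg (Real.exp_pos _).le]
      _ = _ := by
          rw [lintegral_mul_const' _ _ (by simp), hexp, one_mul]
  have hmem : MemLp (fun p => Real.exp (-p.1) * F p) 2 (stripMeasure L) :=
    ⟨hm, hbound.trans_lt ENNReal.ofReal_lt_top⟩
  refine ⟨hmem, ?_⟩
  rw [Lp.norm_toLp]
  exact ENNReal.toReal_le_of_le_ofReal hA0 hbound

/-- Bounded sequences in a Hilbert space converge weakly along ultrafilters. -/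
theorem exists_weak_limit {H : Type*} [NormedAddCommGroup H] [InnerProductSpace ℝ H]
    [CompleteSpace H] (𝒰 : Ultrafilter ℕ) {f : ℕ → H} {A : ℝ} (hA : ∀ n, ‖f n‖ ≤ A) :
    ∃ x : H, ∀ g, Tendsto (fun n => ⟪f n, g⟫) 𝒰 (𝓝 ⟪x, g⟫) := by
  have hb : ∀ g : H, ∃ a, Tendsto (fun n => ⟪f n, g⟫) 𝒰 (𝓝 a) := by
    intro g
    -- An ultrafilter on a compact interval converges, which gives limits for all `g` at once,
    -- without subsequences. They form a bounded linear functional, represented by Riesz.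
    have : (𝒰.map fun n => ⟪f n, g⟫ : Filter ℝ) ≤ 𝓟 (Icc (-(A * ‖g‖)) (A * ‖g‖)) := by
      refine le_principal_iff.2 (Filter.mem_map.2 (Filter.Eventually.of_forall fun n => ?_))
      exact abs_le.1 ((abs_real_inner_le_norm _ _).trans
        (mul_le_mul_of_nonneg_right (hA n) (norm_nonneg _)))
    obtain ⟨a, -, ha⟩ := isCompact_Icc.ultrafilter_le_nhds (𝒰.map fun n => ⟪f n, g⟫) this
    exact ⟨a, ha⟩
  choose ℓ hℓ using hb
  let φ : H →ₗ[ℝ] ℝ :=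
    { toFun := ℓ
      map_add' := fun g g' => tendsto_nhds_unique (hℓ (g + g')) (by
        simpa only [inner_add_right] using (hℓ g).add (hℓ g'))
      map_smul' := fun r g => tendsto_nhds_unique (hℓ (r • g)) (by
        simpa only [inner_smul_right, RingHom.id_apply, smul_eq_mul] using (hℓ g).const_mul r) }
  let φ' : H →L[ℝ] ℝ := φ.mkContinuous A fun g => by
    refine le_of_tendsto (hℓ g).norm (Eventually.of_forall fun n => ?_)
    exact (norm_inner_le_norm _ _).trans (mul_le_mul_of_nonneg_right (hA n) (norm_nonneg _))
  refine ⟨(InnerProductSpace.toDual ℝ H).symm φ', fun g => ?_⟩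
  rw [InnerProductSpace.toDual_symm_apply]
  exact hℓ g

/-- Weak convergence in `L²` of the strip with weight `exp (-2 t)`. -/
structure WeakLim (𝒰 : Filter ℕ) (L : ℝ) (F : ℕ → ℝ × ℝ → ℝ) (f : ℝ × ℝ → ℝ) : Prop where
  memLp_seq : ∀ n, MemLp (fun p => Real.exp (-p.1) * F n p) 2 (stripMeasure L)
  memLp : MemLp (fun p => Real.exp (-p.1) * f p) 2 (stripMeasure L)
  tendsto : ∀ G : ℝ × ℝ → ℝ, MemLp (fun p => Real.exp p.1 * G p) 2 (stripMeasure L) →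
    Tendsto (fun n => ∫ p, F n p * G p ∂(stripMeasure L)) 𝒰 (𝓝 (∫ p, f p * G p ∂(stripMeasure L)))

theorem exists_weakLim {L A : ℝ} (𝒰 : Ultrafilter ℕ) {F : ℕ → ℝ × ℝ → ℝ}
    (hF : ∀ n, AEStronglyMeasurable (F n) (stripMeasure L)) {f : ℕ → ℝ → Lp ℝ 2 (seg L)}
    (hf : ∀ n t, (fun x => F n (t, x)) =ᵐ[seg L] f n t) (hA : ∀ n t, ‖f n t‖ ≤ A) :
    ∃ g, WeakLim 𝒰 L F g := by
  choose h1 h2 using fun n => memLp_exp_mul_of_slices (hF n) (hf n) (hA n)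
  obtain ⟨x, hx⟩ := exists_weak_limit 𝒰 h2
  have ee : ∀ t : ℝ, Real.exp (-t) * Real.exp t = 1 := fun t => by rw [← Real.exp_add]; simp
  refine ⟨fun p => Real.exp p.1 * x p, h1, ?_, fun G hG => ?_⟩
  · refine (Lp.memLp x).ae_eq (Eventually.of_forall fun p => ?_)
    simp only
    rw [← mul_assoc, ee, one_mul]
  · have h := hx (hG.toLp _)
    have e1 : ∀ n, ⟪(h1 n).toLp _, hG.toLp _⟫ = ∫ p, F n p * G p ∂(stripMeasure L) := by
      intro n
      rw [inner_toLp]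
      refine integral_congr_ae (Eventually.of_forall fun p => ?_)
      simp only
      calc _ = (Real.exp (-p.1) * Real.exp p.1) * (F n p * G p) := by ring
        _ = _ := by rw [ee, one_mul]
    have e2 : ⟪x, hG.toLp _⟫ = ∫ p, Real.exp p.1 * x p * G p ∂(stripMeasure L) := by
      conv_lhs => rw [← Lp.toLp_coeFn x (Lp.memLp x)]
      rw [inner_toLp]
      refine integral_congr_ae (Eventually.of_forall fun p => ?_)
      simp only
      ring
    simp only [e1, e2] at h
    exact h

theorem memLp_exp_indicator {L T : ℝ} {D : Set (ℝ × ℝ)} (hD : MeasurableSet D)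
    (hT : ∀ p ∈ D, p.1 < T) :
    MemLp (fun p => Real.exp p.1 * D.indicator (fun _ => (1 : ℝ)) p) 2 (stripMeasure L) := by
  refine memLp_exp_mul_of_bounded (T := T) (C := 1)
    (measurable_const.indicator hD).aestronglyMeasurable (fun p => ?_) fun p hp => ?_
  · by_cases h : p ∈ D <;> simp [h]
  · exact indicator_of_notMem (fun h => absurd (hT p h) (not_lt.2 hp)) _

theorem mul_indicator_one (f : ℝ × ℝ → ℝ) (D : Set (ℝ × ℝ)) :
    (fun p => f p * D.indicator (fun _ => (1 : ℝ)) p) = D.indicator f := by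
  ext p
  by_cases h : p ∈ D <;> simp [h]

theorem integrableOn_of_memLp_exp {L T : ℝ} {f : ℝ × ℝ → ℝ}
    (hf : MemLp (fun p => Real.exp (-p.1) * f p) 2 (stripMeasure L))
    {D : Set (ℝ × ℝ)} (hD : MeasurableSet D) (hT : ∀ p ∈ D, p.1 < T) :
    IntegrableOn f D (stripMeasure L) := by
  have := integrable_mul_of_memLp_exp hf (memLp_exp_indicator hD hT)
  rwa [mul_indicator_one, integrable_indicator_iff hD] at this

theorem WeakLim.tendsto_setIntegral {𝒰 : Filter ℕ} {L T : ℝ} {F : ℕ → ℝ × ℝ → ℝ} {f : ℝ × ℝ → ℝ}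
    (h : WeakLim 𝒰 L F f) {D : Set (ℝ × ℝ)} (hD : MeasurableSet D) (hT : ∀ p ∈ D, p.1 < T) :
    Tendsto (fun n => ∫ p in D, F n p ∂(stripMeasure L)) 𝒰
      (𝓝 (∫ p in D, f p ∂(stripMeasure L))) := by
  have := h.tendsto _ (memLp_exp_indicator hD hT)
  simpa only [mul_indicator_one, integral_indicator hD] using this

/-- Indicators of measurable sets bounded in time are admissible test functions, so the integrals of
the limit over every measurable part of `B` are bounded by those of `g`. -/
theorem WeakLim.ae_le {𝒰 : Filter ℕ} [𝒰.NeBot] {L T C : ℝ} {F : ℕ → ℝ × ℝ → ℝ} {f g : ℝ × ℝ → ℝ}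
    (h : WeakLim 𝒰 L F f) {B : Set (ℝ × ℝ)} (hB : MeasurableSet B) (hT : ∀ p ∈ B, p.1 < T)
    (hg : Measurable g) (hC : ∀ p ∈ B, |g p| ≤ C)
    (hle : ∀ᶠ n in 𝒰, ∀ p ∈ B, p ∈ strip L → F n p ≤ g p) :
    ∀ᵐ p ∂(stripMeasure L), p ∈ B → f p ≤ g p := by
  have hfin : stripMeasure L B < ⊤ := (measure_mono hT).trans_lt stripMeasure_lt_top
  have hgi : IntegrableOn g B (stripMeasure L) := by
    have : IsFiniteMeasure ((stripMeasure L).restrict B) := ⟨by simpa using hfin⟩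
    exact Integrable.of_bound hg.aestronglyMeasurable C (ae_restrict_of_forall_mem hB hC)
  rw [← ae_restrict_iff' hB]
  refine ae_le_of_forall_setIntegral_le (integrableOn_of_memLp_exp h.memLp hB hT) hgi
    fun s hs _ => ?_
  rw [Measure.restrict_restrict hs]
  have hsB : MeasurableSet (s ∩ B) := hs.inter hB
  refine le_of_tendsto (h.tendsto_setIntegral hsB fun p hp => hT p hp.2) ?_
  filter_upwards [hle] with n hn
  refine setIntegral_mono_on_ae (integrableOn_of_memLp_exp (h.memLp_seq n) hsB fun p hp => hT p hp.2)
    (hgi.mono_set inter_subset_right) hsB ?_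
  filter_upwards [ae_restrict_mem (measurableSet_strip L)] with p hp hp'
  exact hn p hp'.2 hp

theorem WeakLim.neg {𝒰 : Filter ℕ} {L : ℝ} {F : ℕ → ℝ × ℝ → ℝ} {f : ℝ × ℝ → ℝ}
    (h : WeakLim 𝒰 L F f) : WeakLim 𝒰 L (fun n p => - F n p) fun p => - f p where
  memLp_seq n := by simp only [mul_neg]; exact (h.memLp_seq n).neg
  memLp := by simp only [mul_neg]; exact h.memLp.neg
  tendsto G hG := by simpa only [neg_mul, integral_neg] using (h.tendsto G hG).neg

theorem WeakLim.ae_ge {𝒰 : Filter ℕ} [𝒰.NeBot] {L T C : ℝ} {F : ℕ → ℝ × ℝ → ℝ} {f g : ℝ × ℝ → ℝ}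
    (h : WeakLim 𝒰 L F f) {B : Set (ℝ × ℝ)} (hB : MeasurableSet B) (hT : ∀ p ∈ B, p.1 < T)
    (hg : Measurable g) (hC : ∀ p ∈ B, |g p| ≤ C)
    (hle : ∀ᶠ n in 𝒰, ∀ p ∈ B, p ∈ strip L → g p ≤ F n p) :
    ∀ᵐ p ∂(stripMeasure L), p ∈ B → g p ≤ f p := by
  filter_upwards [h.neg.ae_le hB hT hg.neg (C := C) (fun p hp => by simpa using hC p hp)
    (hle.mono fun n hn p hp hp' => neg_le_neg (hn p hp hp'))] with p hp hp'
  exact neg_le_neg_iff.1 (hp hp')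

/-- Translates strip integrals against test functions into time integrals of `L²(0,L)` inner
products, the form of the approximate equations. -/
theorem integral_strip_mul_eq {L T : ℝ} (hT : 0 ≤ T) {F ψ : ℝ × ℝ → ℝ} (hψ : Continuous ψ)
    (hψT : ∀ t x, T ≤ t → ψ (t, x) = 0) {f : ℝ → Lp ℝ 2 (seg L)}
    (hf : ∀ t, (fun x => F (t, x)) =ᵐ[seg L] f t)
    (hi : Integrable (fun p => F p * ψ p) (stripMeasure L)) :
    ∫ p, F p * ψ p ∂(stripMeasure L) = ∫ t in (0 : ℝ)..T, ⟪f t, sliceL2 L hψ t⟫ := by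
  have hin : ∀ t, ∫ x, F (t, x) * ψ (t, x) ∂(seg L) = ⟪f t, sliceL2 L hψ t⟫ := by
    intro t
    rw [L2.inner_def]
    refine integral_congr_ae ?_
    filter_upwards [hf t, coeFn_sliceL2 hψ t] with x h1 h2
    rw [h1, h2]
    simp [mul_comm]
  rw [integral_strip hi, intervalIntegral.integral_of_le hT]
  simp only [hin]
  refine (setIntegral_eq_of_subset_of_forall_sdiff_eq_zero measurableSet_Ioi Ioc_subset_Ioi_self
    fun t ht => ?_)
  have h1 : T ≤ t := le_of_not_ge fun h => ht.2 ⟨ht.1, h⟩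
  rw [← hin]
  simp [hψT t _ h1]

/-- Continuous curves in `L²(0,L)` have jointly measurable representatives. -/
theorem exists_measurable_slices {L : ℝ} (hL : 0 ≤ L) {g : ℝ → Lp ℝ 2 (seg L)} (hg : Continuous g) :
    ∃ W : ℝ × ℝ → ℝ, Measurable W ∧ ∀ t, (fun x => W (t, x)) =ᵐ[seg L] g t := by
  have hU : Continuous fun p : ℝ × ℝ => primAt L p.2 (g p.1) :=
    (continuous_primAt hL).comp (by fun_prop : Continuous fun p : ℝ × ℝ => (g p.1, p.2))
  -- Each value of `g` is only a class of functions, but its primitive is jointly continuous. Its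
  -- space difference quotients are therefore measurable in `(t,x)`, and by Lebesgue differentiation
  -- they converge to `g t` almost everywhere.
  let Q : ℕ → ℝ × ℝ → ℝ := fun k p =>
    ((k : ℝ) + 1) * (primAt L (p.2 + ((k : ℝ) + 1)⁻¹) (g p.1) - primAt L p.2 (g p.1))
  have hQ : ∀ k, Continuous (Q k) := fun k => by
    have := hU.comp (by fun_prop : Continuous fun p : ℝ × ℝ => (p.1, p.2 + ((k : ℝ) + 1)⁻¹))
    exact continuous_const.mul (this.sub hU)
  refine ⟨fun p => limsup (fun k => Q k p) atTop, Measurable.limsup fun k => (hQ k).measurable,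
    fun t => ?_⟩
  have hi := integrable_indicator_Lp (g t)
  rw [Filter.EventuallyEq, ae_restrict_iff' measurableSet_Ioo]
  filter_upwards [LocallyIntegrable.ae_hasDerivAt_integral hi.locallyIntegrable] with x hx hx'
  have h2 := hx 0
  simp only [← primAt_eq] at h2
  rw [indicator_of_mem hx'] at h2
  have h3 : Tendsto (fun k : ℕ => ((k : ℝ) + 1)⁻¹) atTop (𝓝[≠] 0) := by
    refine tendsto_nhdsWithin_iff.2 ⟨?_, Eventually.of_forall fun k => ?_⟩
    · simpa [one_div] using tendsto_one_div_add_atTop_nhds_zero_nat (𝕜 := ℝ)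
    · have : (0 : ℝ) < (k : ℝ) + 1 := by positivity
      exact (inv_pos.2 this).ne'
  have h4 := (hasDerivAt_iff_tendsto_slope_zero.1 h2).comp h3
  refine Tendsto.limsup_eq (h4.congr fun k => ?_)
  simp [Q]

theorem integrable_continuous_mul {L T : ℝ} {F G : ℝ × ℝ → ℝ} (hF : Continuous F)
    (hG : Integrable G (stripMeasure L)) (hT : ∀ p, T ≤ p.1 → G p = 0) :
    Integrable (fun p => F p * G p) (stripMeasure L) := by
  obtain ⟨C, hC⟩ := ((isCompact_Icc (a := (0 : ℝ)) (b := T)).prod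
    (isCompact_Icc (a := (0 : ℝ)) (b := L))).exists_bound_of_continuousOn hF.continuousOn
  refine (hG.norm.const_mul C).mono' (hF.aestronglyMeasurable.mul hG.aestronglyMeasurable) ?_
  filter_upwards [ae_restrict_mem (measurableSet_strip L)] with p hp
  by_cases h : T ≤ p.1
  · simp [hT p h]
  · rw [norm_mul]
    exact mul_le_mul_of_nonneg_right (hC p ⟨⟨(mem_Ioi.1 hp.1).le, (not_le.1 h).le⟩,
      Ioo_subset_Icc_self hp.2⟩) (norm_nonneg _)

theorem tendsto_integral_of_uniform {𝒰 : Filter ℕ} {L T : ℝ} {F : ℕ → ℝ × ℝ → ℝ} {f G : ℝ × ℝ → ℝ}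
    (hF : ∀ n, Continuous (F n)) (hf : Continuous f)
    (hu : TendstoUniformlyOn F f 𝒰 (Icc 0 T ×ˢ Icc 0 L)) (hG : Integrable G (stripMeasure L))
    (hT : ∀ p, T ≤ p.1 → G p = 0) :
    Tendsto (fun n => ∫ p, F n p * G p ∂(stripMeasure L)) 𝒰
      (𝓝 (∫ p, f p * G p ∂(stripMeasure L))) := by
  rw [Metric.tendsto_nhds]
  intro ε hε
  set I := ∫ p, ‖G p‖ ∂(stripMeasure L) with hI
  have hI0 : 0 ≤ I := integral_nonneg fun p => norm_nonneg _
  -- Dividing by `I + 1` covers the case `I = 0`.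
  have h1 := Metric.tendstoUniformlyOn_iff.1 hu (ε / (I + 1)) (by positivity)
  filter_upwards [h1] with n hn
  rw [dist_eq_norm, ← integral_sub (integrable_continuous_mul (hF n) hG hT)
    (integrable_continuous_mul hf hG hT)]
  have h2 : ‖∫ p, (F n p * G p - f p * G p) ∂(stripMeasure L)‖ ≤ ε / (I + 1) * I := by
    rw [hI, ← integral_const_mul]
    refine norm_integral_le_of_norm_le (hG.norm.const_mul _) ?_
    filter_upwards [ae_restrict_mem (measurableSet_strip L)] with p hp
    by_cases h : T ≤ p.1
    · simp [hT p h]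
    · rw [← sub_mul, norm_mul]
      refine mul_le_mul_of_nonneg_right ?_ (norm_nonneg _)
      have := hn p ⟨⟨(mem_Ioi.1 hp.1).le, (not_le.1 h).le⟩, Ioo_subset_Icc_self hp.2⟩
      rw [dist_comm, dist_eq_norm] at this
      exact this.le
  refine h2.trans_lt ?_
  rw [div_mul_eq_mul_div, div_lt_iff₀ (by positivity)]
  nlinarith

/-- For equicontinuous families, pointwise convergence and uniform convergence on compact sets agree
(Arzelà–Ascoli). -/
theorem tendstoUniformlyOn_of_equicontinuous {𝒰 : Filter ℕ} {F : ℕ → ℝ × ℝ → ℝ} {f : ℝ × ℝ → ℝ}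
    (hF : Equicontinuous F) (hlim : ∀ p, Tendsto (fun n => F n p) 𝒰 (𝓝 (f p))) {K : Set (ℝ × ℝ)}
    (hK : IsCompact K) : TendstoUniformlyOn F f 𝒰 K := by
  have h := (EquicontinuousOn.tendsto_uniformOnFun_iff_pi (𝔖 := {K : Set (ℝ × ℝ) | IsCompact K})
    (fun K hK => hK) (sUnion_eq_univ_iff.2 fun p => ⟨{p}, isCompact_singleton, mem_singleton p⟩)
    (fun K _ => hF.equicontinuousOn K) 𝒰 f).2 (tendsto_pi_nhds.2 hlim)
  exact UniformOnFun.tendsto_iff_tendstoUniformlyOn.1 h K hK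

end Beam

/-! ### Compactness of the displacement fields. -/

namespace Beam

open scoped RealInnerProductSpace

/-- The displacement field along a curve of states, with the space variable clamped to `[0,L]`. -/
noncomputable def dispField (L : ℝ) [Fact (0 < L)] (c : ℝ → StateSpace L) (p : ℝ × ℝ) : ℝ :=
  disp L (c p.1) (max 0 (min p.2 L))

variable {L : ℝ} [hL : Fact (0 < L)]

theorem clamp_mem (x : ℝ) : max 0 (min x L) ∈ Icc 0 L :=
  ⟨le_max_left _ _, max_le hL.out.le (min_le_right _ _)⟩

theorem dispField_eq (c : ℝ → StateSpace L) (t : ℝ) {x : ℝ} (hx : x ∈ Icc 0 L) :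
    dispField L c (t, x) = disp L (c t) x := by
  rw [dispField, min_eq_left hx.2, max_eq_right hx.1]

theorem continuous_dispField {c : ℝ → StateSpace L} (hc : Continuous c) :
    Continuous (dispField L c) :=
  continuous_disp_uncurry.comp
    (by fun_prop : Continuous fun p : ℝ × ℝ => (c p.1, max 0 (min p.2 L)))

theorem dispField_slice (c : ℝ → StateSpace L) (t : ℝ) :
    (fun x => dispField L c (t, x)) =ᵐ[seg L] dispL2 L (c t) := by
  filter_upwards [coeFn_dispL2 (c t), ae_restrict_mem measurableSet_Ioo] with x h1 h2
  rw [h1, dispField_eq c t (Ioo_subset_Icc_self h2)]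

theorem abs_dispField_le (c : ℝ → StateSpace L) (p : ℝ × ℝ) :
    |dispField L c p| ≤ dispBound L * ‖c p.1‖ := abs_disp_le _ (clamp_mem _)

section Compactness

variable {c d : ℕ → ℝ → StateSpace L} {A : ℝ} {c₀ : StateSpace L}

theorem norm_dispL2_sub_le (hc : ∀ n t, HasDerivAt (c n) (d n t) t)
    (hd : ∀ n t, ‖dispL2 L (d n t)‖ ≤ A) (n : ℕ) (t s : ℝ) :
    ‖dispL2 L (c n t - c n s)‖ ≤ A * |t - s| := by
  rw [map_sub]
  exact Convex.norm_image_sub_le_of_norm_hasDerivWithin_le (s := univ)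
    (f := fun t => dispL2 L (c n t)) (fun z _ => ((dispL2 L).hasFDerivAt.comp_hasDerivAt z
      (hc n z)).hasDerivWithinAt) (fun z _ => hd n z) convex_univ (mem_univ s) (mem_univ t)

/-- The `L²` norm grows at most linearly from the common initial state; with the curvature bound
this controls the `H²` norm on bounded times. -/
theorem exists_bound_norm (hc : ∀ n t, HasDerivAt (c n) (d n t) t)
    (hd : ∀ n t, ‖dispL2 L (d n t)‖ ≤ A) (hg : ∀ n t, ‖(c n t).snd‖ ≤ A) (h0 : ∀ n, c n 0 = c₀)
    (T : ℝ) : ∃ B, ∀ n t, |t| ≤ T → ‖c n t‖ ≤ B := by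
  obtain ⟨C, hC0, hC⟩ := exists_norm_sq_le L
  have hA : 0 ≤ A := (norm_nonneg _).trans (hd 0 0)
  refine ⟨√(C * ((‖dispL2 L c₀‖ + A * T) ^ 2 + A ^ 2)), fun n t ht => ?_⟩
  refine Real.le_sqrt_of_sq_le ((hC _).trans (mul_le_mul_of_nonneg_left (add_le_add ?_ ?_) hC0))
  · refine pow_le_pow_left₀ (norm_nonneg _) ?_ 2
    have h1 := norm_dispL2_sub_le hc hd n t 0
    rw [h0, sub_zero] at h1
    have h2 : dispL2 L (c n t) = dispL2 L c₀ + dispL2 L (c n t - c₀) := by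
      rw [map_sub]; abel
    rw [h2]
    refine (norm_add_le _ _).trans (add_le_add_right (h1.trans ?_) _)
    exact mul_le_mul_of_nonneg_left ht hA
  · exact pow_le_pow_left₀ (norm_nonneg _) (hg n t) 2

/-- For increments over a bounded time lapse the `H²` bound is uniform in time, since the initial
state drops out. -/
theorem exists_bound_norm_sub (hc : ∀ n t, HasDerivAt (c n) (d n t) t)
    (hd : ∀ n t, ‖dispL2 L (d n t)‖ ≤ A) (hg : ∀ n t, ‖(c n t).snd‖ ≤ A) :
    ∃ B, ∀ n t s, |t - s| ≤ 1 → ‖c n t - c n s‖ ≤ B := by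
  obtain ⟨C, hC0, hC⟩ := exists_norm_sq_le L
  have hA : 0 ≤ A := (norm_nonneg _).trans (hd 0 0)
  refine ⟨√(C * (A ^ 2 + (A + A) ^ 2)), fun n t s ht => ?_⟩
  refine Real.le_sqrt_of_sq_le ((hC _).trans (mul_le_mul_of_nonneg_left (add_le_add ?_ ?_) hC0))
  · refine pow_le_pow_left₀ (norm_nonneg _) ((norm_dispL2_sub_le hc hd n t s).trans ?_) 2
    nlinarith
  · refine pow_le_pow_left₀ (norm_nonneg _) ?_ 2
    rw [WithLp.sub_snd]
    exact (norm_sub_le _ _).trans (add_le_add (hg n t) (hg n s))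

/-- Time increments are of order `|t - s|` in `L²` and bounded in `H²`; interpolation on the scale
`η = |t - s|` makes them of order `√|t - s|` in the supremum norm. In space the slopes are bounded.
-/
theorem equicontinuous_dispField (hc : ∀ n t, HasDerivAt (c n) (d n t) t)
    (hd : ∀ n t, ‖dispL2 L (d n t)‖ ≤ A) (hg : ∀ n t, ‖(c n t).snd‖ ≤ A) (h0 : ∀ n, c n 0 = c₀) :
    Equicontinuous fun n => dispField L (c n) := by
  have hl := hL.out
  rintro ⟨t, x⟩
  obtain ⟨B₁, hB₁⟩ := exists_bound_norm hc hd hg h0 |t|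
  obtain ⟨B₂, hB₂⟩ := exists_bound_norm_sub hc hd hg
  refine Metric.equicontinuousAt_of_continuity_modulus (fun p : ℝ × ℝ =>
    A * √|t - p.1| + (1 + √L) * B₂ * |t - p.1| + (1 + √L) * B₁ * |x - p.2|) ?_ _ ?_
  · have : Continuous fun p : ℝ × ℝ =>
        A * √|t - p.1| + (1 + √L) * B₂ * |t - p.1| + (1 + √L) * B₁ * |x - p.2| := by fun_prop
    simpa using this.tendsto (t, x)
  · have hev : ∀ᶠ p : ℝ × ℝ in 𝓝 (t, x), |t - p.1| < min 1 L := by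
      have : Continuous fun p : ℝ × ℝ => |t - p.1| := by fun_prop
      exact this.tendsto (t, x) |>.eventually_lt_const (by simp [hl])
    filter_upwards [hev] with p hp n
    set y := max 0 (min p.2 L) with hy
    set x' := max 0 (min x L) with hx'
    have e : dispField L (c n) (t, x) - dispField L (c n) p =
        disp L (c n t - c n p.1) y + (disp L (c n t) x' - disp L (c n t) y) := by
      rw [map_sub, dispField, dispField, Pi.sub_apply]
      ring
    rw [Real.dist_eq, e]
    refine (abs_add_le _ _).trans (add_le_add ?_ ?_)
    · rcases eq_or_ne t p.1 with h | h
      · rw [← h]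
        simp
      · have hη : 0 < |t - p.1| := abs_pos.2 (sub_ne_zero.2 h)
        have hs : 0 < √|t - p.1| := Real.sqrt_pos.2 hη
        refine (abs_disp_le_interpolation (c n t - c n p.1) (clamp_mem _) hη
          (hp.le.trans (min_le_right _ _))).trans (add_le_add ?_ ?_)
        · rw [div_le_iff₀ hs, mul_assoc, Real.mul_self_sqrt hη.le]
          exact norm_dispL2_sub_le hc hd n t p.1
        · have := hB₂ n t p.1 (hp.le.trans (min_le_left _ _))
          gcongr
    · refine (abs_disp_sub_le _ _ _).trans ?_
      have h1 := hB₁ n t le_rfl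
      have h2 : |x' - y| ≤ |x - p.2| :=
        (abs_max_sub_max_le_max 0 (min x L) 0 (min p.2 L)).trans (by
          rw [sub_self, abs_zero, max_eq_right (abs_nonneg _)]
          refine (abs_min_sub_min_le_max x L p.2 L).trans ?_
          rw [sub_self, abs_zero, max_eq_left (abs_nonneg _)])
      have h3 : 0 ≤ B₁ := (norm_nonneg _).trans h1
      gcongr

theorem exists_pointwise_limit (hc : ∀ n t, HasDerivAt (c n) (d n t) t)
    (hd : ∀ n t, ‖dispL2 L (d n t)‖ ≤ A) (hg : ∀ n t, ‖(c n t).snd‖ ≤ A) (h0 : ∀ n, c n 0 = c₀)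
    (𝒰 : Ultrafilter ℕ) :
    ∃ u : ℝ × ℝ → ℝ, Continuous u ∧
      ∀ K, IsCompact K → TendstoUniformlyOn (fun n => dispField L (c n)) u 𝒰 K := by
  have hlim : ∀ p, ∃ a, Tendsto (fun n => dispField L (c n) p) 𝒰 (𝓝 a) := by
    intro p
    obtain ⟨B, hB⟩ := exists_bound_norm hc hd hg h0 |p.1|
    have : (𝒰.map fun n => dispField L (c n) p : Filter ℝ) ≤
        𝓟 (Icc (-(dispBound L * B)) (dispBound L * B)) := by
      refine le_principal_iff.2 (Filter.mem_map.2 (Filter.Eventually.of_forall fun n => ?_))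
      exact abs_le.1 ((abs_dispField_le _ _).trans
        (mul_le_mul_of_nonneg_left (hB n p.1 le_rfl) dispBound_pos.le))
    obtain ⟨a, -, ha⟩ := isCompact_Icc.ultrafilter_le_nhds _ this
    exact ⟨a, ha⟩
  choose u hu using hlim
  have heq := equicontinuous_dispField hc hd hg h0
  exact ⟨u, Filter.Tendsto.continuous_of_equicontinuous (tendsto_pi_nhds.2 hu) heq, fun K hK =>
    tendstoUniformlyOn_of_equicontinuous heq hu hK⟩

end Compactness

end Beam

/-! ### Approximate solutions. -/

namespace Beam

open scoped RealInnerProductSpace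

theorem continuous_diffQuot {Φ : ℝ → ℝ} (hΦ : Continuous Φ) (δ : ℝ) : Continuous (diffQuot Φ δ) := by
  unfold diffQuot
  fun_prop

theorem continuous_sliceL2 {L : ℝ} {ψ : ℝ × ℝ → ℝ} (hψ : ContDiff ℝ ∞ ψ) (hc : HasCompactSupport ψ) :
    Continuous (sliceL2 L hψ.continuous) :=
  continuous_iff_continuousAt.2 fun t => (hasDerivAt_sliceL2 hψ hc t).continuousAt

theorem exists_time_bound_zero {φ : ℝ × ℝ → ℝ} (hc : HasCompactSupport φ) :
    ∃ T > 0, (∀ t x, T ≤ t → (t, x) ∉ tsupport φ) ∧ ∀ ψ : ℝ × ℝ → ℝ, tsupport ψ ⊆ tsupport φ →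
      ∀ t x, T ≤ t → ψ (t, x) = 0 := by
  obtain ⟨T, hT, h⟩ := exists_time_bound hc
  exact ⟨T, hT, h, fun ψ hψ t x ht => image_eq_zero_of_notMem_tsupport fun h' => h t x ht (hψ h')⟩

theorem memLp_exp_testFunction (L : ℝ) {φ : ℝ × ℝ → ℝ} (hφ : Continuous φ) (hc : HasCompactSupport φ) :
    MemLp (fun p => Real.exp p.1 * φ p) 2 (stripMeasure L) := by
  obtain ⟨T, -, -, hT⟩ := exists_time_bound_zero hc
  obtain ⟨C, hC⟩ := hc.exists_bound_of_continuous hφ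
  exact memLp_exp_mul_of_bounded hφ.aestronglyMeasurable hC fun p hp => hT φ subset_rfl p.1 p.2 hp

variable {L : ℝ} [hL : Fact (0 < L)]

theorem integrable_dispField_mul {c : ℝ → StateSpace L} (hc : Continuous c) {φ : ℝ × ℝ → ℝ}
    (hφ : Continuous φ) (hφc : HasCompactSupport φ) :
    Integrable (fun p => dispField L c p * φ p) (stripMeasure L) := by
  obtain ⟨T, -, -, hT⟩ := exists_time_bound_zero hφc
  exact integrable_continuous_mul (continuous_dispField hc)
    (hφ.integrable_of_hasCompactSupport hφc).restrict fun p hp => hT φ subset_rfl p.1 p.2 hp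

/-- Integration by parts in time for displacement fields. -/
theorem integral_dispField_mul_dt {c d : ℝ → StateSpace L} (hc : ∀ t, HasDerivAt c (d t) t)
    (hd : Continuous d) {φ : ℝ × ℝ → ℝ} (hφ : ContDiff ℝ ∞ φ) (hφc : HasCompactSupport φ) :
    ∫ p, dispField L c p * dt φ p ∂(stripMeasure L) + ⟪dispL2 L (c 0), sliceL2 L hφ.continuous 0⟫ =
      -∫ p, dispField L d p * φ p ∂(stripMeasure L) := by
  obtain ⟨T, hT0, -, hT⟩ := exists_time_bound_zero hφc
  have hcc : Continuous c := continuous_iff_continuousAt.2 fun t => (hc t).continuousAt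
  have hdt := contDiff_dt hφ
  have s1 := continuous_sliceL2 (L := L) hφ hφc
  have s2 := continuous_sliceL2 (L := L) hdt (hasCompactSupport_dt hφc)
  rw [integral_strip_mul_eq hT0.le hdt.continuous (hT _ tsupport_dt_subset) (dispField_slice c)
      (integrable_dispField_mul hcc hdt.continuous (hasCompactSupport_dt hφc)),
    integral_strip_mul_eq hT0.le hφ.continuous (hT _ subset_rfl) (dispField_slice d)
      (integrable_dispField_mul hd hφ.continuous hφc)]
  have hder : ∀ t, HasDerivAt (fun t => ⟪dispL2 L (c t), sliceL2 L hφ.continuous t⟫)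
      (⟪dispL2 L (c t), sliceL2 L hdt.continuous t⟫ +
        ⟪dispL2 L (d t), sliceL2 L hφ.continuous t⟫) t := fun t =>
    ((dispL2 L).hasFDerivAt.comp_hasDerivAt t (hc t)).inner ℝ (hasDerivAt_sliceL2 hφ hφc t)
  have k1 : Continuous fun t => ⟪dispL2 L (c t), sliceL2 L hdt.continuous t⟫ :=
    ((dispL2 L).continuous.comp hcc).inner s2
  have k2 : Continuous fun t => ⟪dispL2 L (d t), sliceL2 L hφ.continuous t⟫ :=
    ((dispL2 L).continuous.comp hd).inner s1
  have h := intervalIntegral.integral_eq_sub_of_hasDerivAt (a := 0) (b := T) (fun t _ => hder t)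
    ((k1.add k2).intervalIntegrable _ _)
  rw [intervalIntegral.integral_add (k1.intervalIntegrable _ _) (k2.intervalIntegrable _ _)] at h
  have hzero : sliceL2 L hφ.continuous T = 0 := by
    refine Lp.ext ?_
    filter_upwards [coeFn_sliceL2 (L := L) hφ.continuous T, Lp.coeFn_zero ℝ 2 (seg L)] with x a b
    rw [a, b, hT φ subset_rfl T x le_rfl]
    rfl
  rw [hzero, inner_zero_right] at h
  linarith

/-- Integration by parts in space for displacement fields. -/
theorem integral_dispField_mul_dx_dx {c : ℝ → StateSpace L} (hc : Continuous c) {W : ℝ × ℝ → ℝ}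
    (hW : ∀ t, (fun x => W (t, x)) =ᵐ[seg L] (c t).snd)
    (hWm : MemLp (fun p => Real.exp (-p.1) * W p) 2 (stripMeasure L)) {φ : ℝ × ℝ → ℝ}
    (hφ : ContDiff ℝ ∞ φ) (hφc : HasCompactSupport φ) (hsub : tsupport φ ⊆ strip L) :
    ∫ p, dispField L c p * dx (dx φ) p ∂(stripMeasure L) = ∫ p, W p * φ p ∂(stripMeasure L) := by
  obtain ⟨T, hT0, -, hT⟩ := exists_time_bound_zero hφc
  have hd2 := contDiff_dx (contDiff_dx hφ)
  have i1 := integrable_dispField_mul hc hd2.continuous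
    (hasCompactSupport_dx (hasCompactSupport_dx hφc))
  have i2 := integrable_mul_of_memLp_exp hWm (memLp_exp_testFunction L hφ.continuous hφc)
  rw [integral_strip i1, integral_strip i2]
  refine setIntegral_congr_fun measurableSet_Ioi fun t _ => ?_
  have h1 : ContDiff ℝ ∞ fun x => φ (t, x) := hφ.comp (contDiff_const.prodMk contDiff_id)
  have h2 : tsupport (fun x => φ (t, x)) ⊆ Ioo 0 L := by
    have : tsupport (fun x => φ (t, x)) ⊆ (fun x => (t, x)) ⁻¹' tsupport φ :=
      closure_minimal (fun x hx => subset_tsupport φ hx)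
        ((isClosed_tsupport φ).preimage (by fun_prop))
    exact fun x hx => (hsub (this hx)).2
  have h := integral_disp_mul_deriv_deriv (c t) h1 h2
  rw [deriv_deriv_slice hφ] at h
  rw [integral_congr_ae (g := fun x => disp L (c t) x * dx (dx φ) (t, x)), h]
  · refine integral_congr_ae ?_
    filter_upwards [hW t] with x hx
    rw [hx]
  · filter_upwards [ae_restrict_mem measurableSet_Ioo] with x hx
    rw [dispField_eq c t (Ioo_subset_Icc_self hx)]

/-- The regularisation parameters. -/
noncomputable def regStep (n : ℕ) : ℝ := 1 / ((n : ℝ) + 1)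

theorem regStep_pos (n : ℕ) : 0 < regStep n := by
  unfold regStep
  positivity

theorem regStep_le_one (n : ℕ) : regStep n ≤ 1 := by
  unfold regStep
  rw [div_le_one (by positivity)]
  linarith [n.cast_nonneg (α := ℝ)]

theorem tendsto_regStep : Tendsto regStep atTop (𝓝 0) := tendsto_one_div_add_atTop_nhds_zero_nat

/-- Approximate solutions with uniform energy bounds which satisfy the weak formulation in the
limit. -/
theorem exists_approximate_solutions {ρ μ : ℝ} (hρ : 0 < ρ) (hμ : 0 ≤ μ) {Φ : ℝ → ℝ}
    (hΦ : IsAdhesionPotential Φ) (c₀ : StateSpace L) (v₀ : Lp ℝ 2 (seg L)) :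
    ∃ (c d : ℕ → ℝ → StateSpace L) (C : ℝ), 0 ≤ C ∧ (∀ n, c n 0 = c₀) ∧
      (∀ n t, HasDerivAt (c n) (d n t) t) ∧ (∀ n, Continuous (d n)) ∧
      (∀ n t, ρ / 2 * ‖dispL2 L (d n t)‖ ^ 2 + μ / 2 * ‖(c n t).snd‖ ^ 2 +
        ∫ x, Φ (disp L (c n t) x) ∂(seg L) ≤
        ρ / 2 * ‖v₀‖ ^ 2 + μ / 2 * ‖c₀.snd‖ ^ 2 + ∫ x, Φ (disp L c₀ x) ∂(seg L) + C * regStep n) ∧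
      ∀ e e' : ℝ → StateSpace L, (∀ t, HasDerivAt e (e' t) t) → Continuous e' → ∀ T, 0 ≤ T → e T = 0 →
        Tendsto (fun n => ∫ t in (0 : ℝ)..T, (-(ρ * ⟪dispL2 L (d n t), dispL2 L (e' t)⟫) +
          μ * ⟪(c n t).snd, (e t).snd⟫ +
            ⟪compDisp (continuous_diffQuot hΦ.continuous (regStep n)) (c n t), dispL2 L (e t)⟫)) atTop
          (𝓝 (ρ * ⟪v₀, dispL2 L (e 0)⟫)) := by
  obtain ⟨K, hK⟩ := hΦ.exists_lipschitz
  choose K' hK' using fun n => lipschitzWith_diffQuot hK (regStep_pos n)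
  choose c d h0 hc hd hE hW using fun n => exists_regularized_solution (L := L) μ hρ (regStep_pos n)
    (hasDerivAt_fwdAverage hΦ.continuous (regStep n)) (hK' n) c₀ v₀
  have hcc : ∀ n, Continuous (c n) := fun n => continuous_iff_continuousAt.2 fun t => (hc n t).continuousAt
  have hPc : ∀ n, Continuous (fwdAverage Φ (regStep n)) := fun n => continuous_iff_continuousAt.2 fun t =>
    (hasDerivAt_fwdAverage hΦ.continuous (regStep n) t).continuousAt
  -- The averaged and the true adhesive energy are compared at time `0` and at time `t`, which gives
  -- the constant `2 * K * L`.
  have hclose : ∀ n (b : StateSpace L), |∫ x, fwdAverage Φ (regStep n) (disp L b x) ∂(seg L) -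
      ∫ x, Φ (disp L b x) ∂(seg L)| ≤ K * L * regStep n := by
    intro n b
    have i1 : Integrable (fun x => fwdAverage Φ (regStep n) (disp L b x)) (seg L) :=
      integrable_seg ((hPc n).comp (continuous_disp b))
    have i2 : Integrable (fun x => Φ (disp L b x)) (seg L) :=
      integrable_seg (hΦ.continuous.comp (continuous_disp b))
    rw [← integral_sub i1 i2, ← Real.norm_eq_abs]
    refine (norm_integral_le_of_norm_le_const (C := K * regStep n) (Eventually.of_forall fun x =>
      abs_fwdAverage_sub_le hK (regStep_pos n) _)).trans_eq ?_
    have : (seg L).real univ = L := by simp [measureReal_def, hL.out.le]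
    rw [this]
    ring
  set E₀ := ρ / 2 * ‖v₀‖ ^ 2 + μ / 2 * ‖c₀.snd‖ ^ 2 + ∫ x, Φ (disp L c₀ x) ∂(seg L) with hE₀
  have hE' : ∀ n t, ρ / 2 * ‖dispL2 L (d n t)‖ ^ 2 + regStep n / 2 * ‖d n t‖ ^ 2 +
      μ / 2 * ‖(c n t).snd‖ ^ 2 + ∫ x, Φ (disp L (c n t) x) ∂(seg L) ≤
      E₀ + 2 * K * L * regStep n := by
    intro n t
    have a1 := hE n t
    have a2 := abs_le.1 (hclose n c₀)
    have a3 := abs_le.1 (hclose n (c n t))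
    rw [hE₀]
    linarith
  have hL0 := hL.out
  refine ⟨c, d, 2 * K * L, by positivity, h0, hc, hd, fun n t => ?_, fun e e' he he' T hT0 hT => ?_⟩
  · have := hE' n t
    have := mul_nonneg (half_pos (regStep_pos n)).le (sq_nonneg ‖d n t‖)
    linarith
  · have hec : Continuous e := continuous_iff_continuousAt.2 fun t => (he t).continuousAt
    obtain ⟨M, hM⟩ := (isCompact_Icc (a := (0 : ℝ)) (b := T)).exists_bound_of_continuousOn
      he'.continuousOn
    have hM0 : 0 ≤ M := (norm_nonneg _).trans (hM 0 ⟨le_rfl, hT0⟩)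
    set E₁ := 2 * (E₀ + 2 * K * L) with hE₁
    -- The energy bounds only `ε ‖d‖²`, so `ε ‖d‖` is of order `√ε`; this suffices for the
    -- contribution of the additional inertia to vanish.
    have hdb : ∀ n t, regStep n * ‖d n t‖ ≤ √(E₁ * regStep n) := by
      intro n t
      refine Real.le_sqrt_of_sq_le ?_
      have a1 := hE' n t
      have a2 : 0 ≤ ∫ x, Φ (disp L (c n t) x) ∂(seg L) := integral_nonneg fun x => hΦ.nonneg _
      have a3 := mul_nonneg (half_pos hρ).le (sq_nonneg ‖dispL2 L (d n t)‖)
      have a4 := mul_nonneg (div_nonneg hμ zero_le_two) (sq_nonneg ‖(c n t).snd‖)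
      have a5 : 2 * K * L * regStep n ≤ 2 * K * L :=
        mul_le_of_le_one_right (by positivity) (regStep_le_one n)
      have a6 : regStep n * ‖d n t‖ ^ 2 ≤ E₁ := by rw [hE₁]; linarith
      calc _ = regStep n * ‖d n t‖ ^ 2 * regStep n := by ring
        _ ≤ _ := mul_le_mul_of_nonneg_right a6 (regStep_pos n).le
    have hres : Tendsto (fun n => ∫ t in (0 : ℝ)..T, regStep n * ⟪d n t, e' t⟫) atTop (𝓝 0) := by
      have hb : ∀ n, ‖∫ t in (0 : ℝ)..T, regStep n * ⟪d n t, e' t⟫‖ ≤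
          √(E₁ * regStep n) * M * T := by
        intro n
        refine (intervalIntegral.norm_integral_le_of_norm_le_const (C := √(E₁ * regStep n) * M)
          fun t ht => ?_).trans_eq (by rw [sub_zero, abs_of_nonneg hT0])
        rw [uIoc_of_le hT0] at ht
        rw [norm_mul, Real.norm_of_nonneg (regStep_pos n).le]
        calc _ ≤ regStep n * (‖d n t‖ * ‖e' t‖) :=
              mul_le_mul_of_nonneg_left (norm_inner_le_norm _ _) (regStep_pos n).le
          _ = (regStep n * ‖d n t‖) * ‖e' t‖ := by ring
          _ ≤ _ := mul_le_mul (hdb n t) (hM t (Ioc_subset_Icc_self ht)) (norm_nonneg _)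
              (Real.sqrt_nonneg _)
      refine squeeze_zero_norm hb ?_
      have : Tendsto (fun n => √(E₁ * regStep n) * M * T) atTop (𝓝 (√(E₁ * 0) * M * T)) :=
        (((tendsto_regStep.const_mul E₁).sqrt).mul_const M).mul_const T
      simpa using this
    -- The regularised identity is exact: the integral in question equals `ρ ⟪v₀, e 0⟫` plus the
    -- vanishing inertia term.
    have hlim := hres.add_const (ρ * ⟪v₀, dispL2 L (e 0)⟫)
    rw [zero_add] at hlim
    refine hlim.congr fun n => ?_
    have hdn := hd n
    have hcn := hcc n
    have k1 : Continuous fun t => regStep n * ⟪d n t, e' t⟫ := by fun_prop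
    have k2 : Continuous fun t => -(ρ * ⟪dispL2 L (d n t), dispL2 L (e' t)⟫ +
        regStep n * ⟪d n t, e' t⟫) + (μ * ⟪(c n t).snd, (e t).snd⟫ +
          ⟪compDisp (hK' n).continuous (c n t), dispL2 L (e t)⟫) := by
      have := (lipschitzWith_compDisp (L := L) (hK' n)).continuous
      fun_prop
    rw [← hW n e e' he he' T hT, ← intervalIntegral.integral_add (k1.intervalIntegrable _ _)
      (k2.intervalIntegrable _ _)]
    refine intervalIntegral.integral_congr fun t _ => ?_
    ring

end Beam

/-! ### Identification of the limit force. -/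

namespace Beam

open scoped RealInnerProductSpace

section ForceLimit

variable {𝒰 : Filter ℕ} [𝒰.NeBot] {L : ℝ} {Φ : ℝ → ℝ} {U : ℕ → ℝ × ℝ → ℝ} {u h : ℝ × ℝ → ℝ}

/-- Bounds on the difference quotients near `D` pass to the weak limit of the forces on the set
where the limit displacement lies in `D`. -/
theorem WeakLim.ae_force_mem (h𝒰 : 𝒰 ≤ atTop) (hu : Continuous u)
    (hU : ∀ K, IsCompact K → TendstoUniformlyOn U u 𝒰 K)
    (hW : WeakLim 𝒰 L (fun n p => diffQuot Φ (regStep n) (U n p)) h)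
    {D : Set ℝ} (hD : MeasurableSet D) {lo hi : ℝ → ℝ} (hlo : Measurable lo) (hhi : Measurable hi)
    {C τ : ℝ} (hloC : ∀ r ∈ D, |lo r| ≤ C) (hhiC : ∀ r ∈ D, |hi r| ≤ C) (hτ : 0 < τ)
    (hb : ∀ δ, 0 < δ → δ < τ → ∀ s r, r ∈ D → |s - r| < τ → diffQuot Φ δ s ∈ Icc (lo r) (hi r)) :
    ∀ᵐ p ∂(stripMeasure L), u p ∈ D → h p ∈ Icc (lo (u p)) (hi (u p)) := by
  -- Uniform convergence and finite measure are available on bounded times only; countably many of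
  -- these cover the strip.
  have key : ∀ T : ℕ, ∀ᵐ p ∂(stripMeasure L), p ∈ u ⁻¹' D ∩ {p | p.1 < (T : ℝ)} →
      h p ∈ Icc (lo (u p)) (hi (u p)) := by
    intro T
    have hB : MeasurableSet (u ⁻¹' D ∩ {p : ℝ × ℝ | p.1 < (T : ℝ)}) :=
      (hu.measurable hD).inter (measurableSet_lt measurable_fst measurable_const)
    have hev : ∀ᶠ n in 𝒰, ∀ p ∈ u ⁻¹' D ∩ {p : ℝ × ℝ | p.1 < (T : ℝ)}, p ∈ strip L →
        diffQuot Φ (regStep n) (U n p) ∈ Icc (lo (u p)) (hi (u p)) := by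
      have h1 := Metric.tendstoUniformlyOn_iff.1 (hU (Icc 0 (T : ℝ) ×ˢ Icc 0 L)
        (isCompact_Icc.prod isCompact_Icc)) τ hτ
      have h2 : ∀ᶠ n in 𝒰, regStep n < τ := h𝒰 (tendsto_regStep.eventually_lt_const hτ)
      filter_upwards [h1, h2] with n hn hn' p hp hps
      refine hb _ (regStep_pos n) hn' _ _ hp.1 ?_
      have := hn p ⟨⟨(mem_Ioi.1 hps.1).le, (show p.1 < (T : ℝ) from hp.2).le⟩,
        Ioo_subset_Icc_self hps.2⟩
      rwa [dist_comm, Real.dist_eq] at this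
    filter_upwards [hW.ae_le hB (fun p hp => hp.2) (hhi.comp hu.measurable)
        (fun p hp => hhiC _ hp.1) (hev.mono fun n hn p hp hps => (hn p hp hps).2),
      hW.ae_ge hB (fun p hp => hp.2) (hlo.comp hu.measurable)
        (fun p hp => hloC _ hp.1) (hev.mono fun n hn p hp hps => (hn p hp hps).1)] with p h1 h2 hp
    exact ⟨h2 hp, h1 hp⟩
  filter_upwards [ae_all_iff.2 key] with p hp hpD
  obtain ⟨T, hT⟩ := exists_nat_gt p.1
  exact hp T ⟨hpD, hT⟩

/-- The weak limit of the approximate forces is an admissible force for the limit displacement. -/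
theorem WeakLim.ae_mem_forceSubdiff (hΦ : IsAdhesionPotential Φ) (h𝒰 : 𝒰 ≤ atTop) (hu : Continuous u)
    (hU : ∀ K, IsCompact K → TendstoUniformlyOn U u 𝒰 K)
    (hW : WeakLim 𝒰 L (fun n p => diffQuot Φ (regStep n) (U n p)) h) :
    ∀ᵐ p ∂(stripMeasure L), h p ∈ forceSubdiff Φ (u p) := by
  obtain ⟨K, hK⟩ := hΦ.exists_lipschitz
  set a := Function.leftLim (deriv Φ) 1 with ha
  set b := Function.rightLim (deriv Φ) (-1) with hb
  -- On `|u| ≤ 1 - 1/(j+1)` the difference quotients are within `1/(k+1)` of `Φ'(u)`. Countably many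
  -- `j`, `k` share one null set and determine `h` where `|u| < 1`.
  have hinner : ∀ j k : ℕ, ∀ᵐ p ∂(stripMeasure L), u p ∈ {r : ℝ | |r| ≤ 1 - regStep j} →
      h p ∈ Icc (deriv Φ (u p) - regStep k) (deriv Φ (u p) + regStep k) := by
    intro j k
    obtain ⟨τ, hτ, hcl⟩ := exists_diffQuot_close hΦ (regStep_pos j) (regStep_pos k)
    have hd : ∀ r, |deriv Φ r| ≤ K := fun r => norm_deriv_le_of_lipschitz hK
    have hk := regStep_pos k
    refine hW.ae_force_mem h𝒰 hu hU (measurableSet_le measurable_id.abs measurable_const)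
      ((measurable_deriv Φ).sub_const _) ((measurable_deriv Φ).add_const _) (C := K + regStep k)
      (fun r _ => ?_) (fun r _ => ?_) hτ fun δ hδ hδτ s r hr hsr => ?_
    · exact (abs_sub _ _).trans (add_le_add (hd r) (abs_of_pos hk).le)
    · exact (abs_add_le _ _).trans (add_le_add (hd r) (abs_of_pos hk).le)
    · have := abs_le.1 (hcl δ hδ hδτ s r hr hsr)
      constructor <;> linarith
  -- With half of the gap for the displacement and half for the step, `[s, s+δ]` remains where `Φ`
  -- is constant.
  have houter : ∀ j : ℕ, ∀ᵐ p ∂(stripMeasure L), u p ∈ {r : ℝ | 1 + regStep j ≤ |r|} →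
      h p ∈ Icc (0 : ℝ) 0 := by
    intro j
    have hj := regStep_pos j
    refine hW.ae_force_mem h𝒰 hu hU (measurableSet_le measurable_const measurable_id.abs)
      (lo := fun _ => 0) (hi := fun _ => 0) measurable_const measurable_const (C := 0) (by simp)
      (by simp) (τ := regStep j / 2) (by positivity) fun δ hδ hδτ s r hr hsr => ?_
    have hz : diffQuot Φ δ s = 0 := by
      refine diffQuot_eq_zero hΦ hδ ?_
      have h1 := abs_lt.1 hsr
      rcases le_abs.1 (show 1 + regStep j ≤ |r| from hr) with h2 | h2
      · left; linarith
      · right; linarith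
    simp [hz]
  -- Where `u = 1` the approximations satisfy `s ≥ 0`, and there all difference quotients lie in the
  -- required interval.
  have hone : ∀ᵐ p ∂(stripMeasure L), u p ∈ ({1} : Set ℝ) → h p ∈ Icc 0 a := by
    refine hW.ae_force_mem h𝒰 hu hU (measurableSet_singleton 1) (lo := fun _ => 0) (hi := fun _ => a)
      measurable_const measurable_const (C := |a|) (by simp) (by simp) (τ := 1 / 2) (by norm_num)
      fun δ hδ hδτ s r hr hsr => ?_
    have h1 := abs_lt.1 hsr
    rw [mem_singleton_iff.1 hr] at h1
    exact diffQuot_mem_of_nonneg hΦ hδ (by linarith)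
  have hneg : ∀ᵐ p ∂(stripMeasure L), u p ∈ ({-1} : Set ℝ) → h p ∈ Icc b 0 := by
    refine hW.ae_force_mem h𝒰 hu hU (measurableSet_singleton (-1)) (lo := fun _ => b)
      (hi := fun _ => 0) measurable_const measurable_const (C := |b|) (by simp) (by simp)
      (τ := 1 / 2) (by norm_num) fun δ hδ hδτ s r hr hsr => ?_
    have h1 := abs_lt.1 hsr
    rw [mem_singleton_iff.1 hr] at h1
    exact diffQuot_mem_of_nonpos hΦ hδ (by linarith)
  have hsmall : ∀ ε : ℝ, 0 < ε → ∃ j, regStep j < ε := fun ε hε =>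
    (tendsto_regStep.eventually_lt_const hε).exists
  filter_upwards [ae_all_iff.2 fun j => ae_all_iff.2 (hinner j), ae_all_iff.2 houter, hone, hneg]
    with p h1 h2 h3 h4
  refine ⟨fun hp => ?_, fun hp => ?_, h3, h4⟩
  · obtain ⟨j, hj⟩ := hsmall (1 - |u p|) (by linarith)
    refine eq_of_forall_dist_le fun ε hε => ?_
    obtain ⟨k, hk⟩ := hsmall ε hε
    have := h1 j k (by linarith)
    rw [Real.dist_eq, abs_le]
    constructor <;> linarith [this.1, this.2]
  · obtain ⟨j, hj⟩ := hsmall (|u p| - 1) (by linarith)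
    have := h2 j (by linarith)
    exact le_antisymm this.2 this.1

end ForceLimit

/-- A pointwise selection of the subdifferential. -/
theorem exists_mem_forceSubdiff {Φ : ℝ → ℝ} (hΦ : IsAdhesionPotential Φ) (s : ℝ) :
    ∃ h, h ∈ forceSubdiff Φ s := by
  refine ⟨if |s| < 1 then deriv Φ s else 0, fun h => if_pos h, fun h => if_neg (not_lt.2 h.le),
    fun h => ?_, fun h => ?_⟩
  · rw [if_neg (by simp [h])]
    exact ⟨le_rfl, hΦ.leftLim_nonneg⟩
  · rw [if_neg (by simp [h])]
    exact ⟨hΦ.rightLim_nonpos, le_rfl⟩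

/-- Cutting off in time turns a weak limit into an admissible test function, so the sequence can be
tested against its own limit. -/
theorem memLp_exp_mul_indicator {L T : ℝ} {f : ℝ × ℝ → ℝ}
    (hf : MemLp (fun p => Real.exp (-p.1) * f p) 2 (stripMeasure L)) {D : Set (ℝ × ℝ)}
    (hD : MeasurableSet D) (hT : ∀ p ∈ D, p.1 < T) :
    MemLp (fun p => Real.exp p.1 * D.indicator f p) 2 (stripMeasure L) := by
  have e : (fun p : ℝ × ℝ => Real.exp p.1 * D.indicator f p) =
      D.indicator fun p => Real.exp (2 * p.1) * (Real.exp (-p.1) * f p) := by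
    ext p
    by_cases hp : p ∈ D
    · rw [indicator_of_mem hp, indicator_of_mem hp, ← mul_assoc, ← Real.exp_add]
      congr 2
      ring
    · simp [hp]
  have hm : AEStronglyMeasurable (D.indicator fun p : ℝ × ℝ => Real.exp (2 * p.1) *
      (Real.exp (-p.1) * f p)) (stripMeasure L) :=
    ((by fun_prop : Continuous fun p : ℝ × ℝ => Real.exp (2 * p.1)).aestronglyMeasurable.mul
      hf.aestronglyMeasurable).indicator hD
  rw [e]
  refine hf.of_le_mul (c := Real.exp (2 * T)) hm (Eventually.of_forall fun p => ?_)
  by_cases hp : p ∈ D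
  · rw [indicator_of_mem hp, norm_mul, Real.norm_of_nonneg (Real.exp_pos _).le]
    have := hT p hp
    gcongr
  · rw [indicator_of_notMem hp, norm_zero]
    positivity

theorem aestronglyMeasurable_of_memLp_exp {L : ℝ} {f : ℝ × ℝ → ℝ}
    (hf : MemLp (fun p => Real.exp (-p.1) * f p) 2 (stripMeasure L)) :
    AEStronglyMeasurable f (stripMeasure L) := by
  refine ((by fun_prop : Continuous fun p : ℝ × ℝ => Real.exp p.1).aestronglyMeasurable.mul
    hf.aestronglyMeasurable).congr (Eventually.of_forall fun p => ?_)
  simp only [Pi.mul_apply]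
  rw [← mul_assoc, ← Real.exp_add, add_neg_cancel, Real.exp_zero, one_mul]

theorem locallyIntegrableOn_of_memLp_exp {L : ℝ} {f : ℝ × ℝ → ℝ}
    (hf : MemLp (fun p => Real.exp (-p.1) * f p) 2 (stripMeasure L)) :
    LocallyIntegrableOn f (strip L) := by
  have h1 : LocallyIntegrableOn (fun p => Real.exp (-p.1) * f p) (strip L) :=
    locallyIntegrableOn_of_locallyIntegrable_restrict (hf.locallyIntegrable one_le_two)
  have h2 := h1.continuousOn_mul (g := fun p : ℝ × ℝ => Real.exp p.1) (by fun_prop)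
    (isOpen_strip L).isLocallyClosed
  have e : (fun p : ℝ × ℝ => Real.exp p.1 * (Real.exp (-p.1) * f p)) = f := by
    ext p
    rw [← mul_assoc, ← Real.exp_add, add_neg_cancel, Real.exp_zero, one_mul]
  exact e ▸ h2

theorem memLinftyL2_of_integral_sq_le {L C : ℝ} {f : ℝ × ℝ → ℝ}
    (hf : AEStronglyMeasurable f (stripMeasure L))
    (h : ∀ᵐ t ∂(volume.restrict (Ioi (0 : ℝ))), Integrable (fun x => f (t, x) ^ 2) (seg L) ∧
      ∫ x, f (t, x) ^ 2 ∂(seg L) ≤ C) : MemLinftyL2 L f := by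
  refine ⟨hf, ENNReal.ofReal √C, ENNReal.ofReal_lt_top, ?_⟩
  rw [stripMeasure_eq_prod] at hf
  filter_upwards [h, hf.prodMk_left] with t ht hm
  have hmem : MemLp (fun x => f (t, x)) 2 (seg L) := (memLp_two_iff_integrable_sq hm).2 ht.1
  rw [← ENNReal.ofReal_toReal hmem.eLpNorm_ne_top, ← Lp.norm_toLp _ hmem]
  refine ENNReal.ofReal_le_ofReal (Real.le_sqrt_of_sq_le ?_)
  rw [norm_toLp_sq]
  exact ht.2

/-! ### Passage to the limit in the energy. -/

section EnergyLimit

variable {𝒰 : Filter ℕ} [𝒰.NeBot] {L ρ μ E₀ C : ℝ} {Φ : ℝ → ℝ} {U V W : ℕ → ℝ × ℝ → ℝ}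
  {u v w : ℝ × ℝ → ℝ}

/-- Lower semicontinuity of the space-time energy over a bounded set of times. -/
theorem integral_energy_indicator_le (hρ : 0 ≤ ρ) (hμ : 0 ≤ μ) (hΦ : Continuous Φ) {B : ℝ}
    (hΦB : ∀ s, |Φ s| ≤ B) {K : NNReal} (hK : LipschitzWith K Φ)
    (h𝒰 : 𝒰 ≤ atTop) (hUc : ∀ n, Continuous (U n))
    (hu : Continuous u) (hU : ∀ K, IsCompact K → TendstoUniformlyOn U u 𝒰 K)
    (hV : WeakLim 𝒰 L V v) (hW : WeakLim 𝒰 L W w)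
    {fv fw : ℕ → ℝ → Lp ℝ 2 (seg L)} (hfv : ∀ n t, (fun x => V n (t, x)) =ᵐ[seg L] fv n t)
    (hfw : ∀ n t, (fun x => W n (t, x)) =ᵐ[seg L] fw n t)
    (hE : ∀ n t, ρ / 2 * ‖fv n t‖ ^ 2 + μ / 2 * ‖fw n t‖ ^ 2 + ∫ x, Φ (U n (t, x)) ∂(seg L) ≤
      E₀ + C * regStep n)
    {A : Set ℝ} (hA : MeasurableSet A) {T : ℝ} (hAT : ∀ t ∈ A, t < T) :
    Integrable (fun p => v p * {p : ℝ × ℝ | p.1 ∈ A}.indicator v p) (stripMeasure L) ∧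
    Integrable (fun p => w p * {p : ℝ × ℝ | p.1 ∈ A}.indicator w p) (stripMeasure L) ∧
    Integrable (fun p => Φ (u p) * {p : ℝ × ℝ | p.1 ∈ A}.indicator (fun _ => 1) p)
      (stripMeasure L) ∧
    ρ / 2 * ∫ p, v p * {p : ℝ × ℝ | p.1 ∈ A}.indicator v p ∂(stripMeasure L) +
      μ / 2 * ∫ p, w p * {p : ℝ × ℝ | p.1 ∈ A}.indicator w p ∂(stripMeasure L) +
      ∫ p, Φ (u p) * {p : ℝ × ℝ | p.1 ∈ A}.indicator (fun _ => 1) p ∂(stripMeasure L) ≤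
      (volume.restrict (Ioi (0 : ℝ))).real A * E₀ := by
  set D : Set (ℝ × ℝ) := {p : ℝ × ℝ | p.1 ∈ A} with hDdef
  have hD : MeasurableSet D := measurable_fst hA
  have hDT : ∀ p ∈ D, p.1 < T := fun p hp => hAT _ hp
  have iv := integrable_mul_of_memLp_exp hV.memLp (memLp_exp_mul_indicator hV.memLp hD hDT)
  have iw := integrable_mul_of_memLp_exp hW.memLp (memLp_exp_mul_indicator hW.memLp hD hDT)
  have i1 : Integrable (D.indicator fun _ => (1 : ℝ)) (stripMeasure L) := by
    rw [integrable_indicator_iff hD]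
    exact integrableOn_const ((measure_mono hDT).trans_lt stripMeasure_lt_top).ne
  have iΦ : ∀ f : ℝ × ℝ → ℝ, Continuous f →
      Integrable (fun p => Φ (f p) * D.indicator (fun _ => (1 : ℝ)) p) (stripMeasure L) := fun f hf =>
    i1.bdd_mul (c := B) (hΦ.comp hf).aestronglyMeasurable (Eventually.of_forall fun p => hΦB _)
  refine ⟨iv, iw, iΦ u hu, ?_⟩
  have hAfin : volume.restrict (Ioi (0 : ℝ)) A < ⊤ := by
    rw [Measure.restrict_apply hA]
    refine (measure_mono (t := Ioo 0 T) fun t ht => ⟨ht.2, hAT t ht.1⟩).trans_lt ?_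
    rw [Real.volume_Ioo]
    exact ENNReal.ofReal_lt_top
  -- By `a² ≥ 2ab - b²` with `a = V n`, `b = v`, the energy is bounded below by an expression affine
  -- in `V n` and `W n`, whose limit is known.
  have hupper : ∀ n, ρ * ∫ p, V n p * D.indicator v p ∂(stripMeasure L) -
        ρ / 2 * ∫ p, v p * D.indicator v p ∂(stripMeasure L) +
      (μ * ∫ p, W n p * D.indicator w p ∂(stripMeasure L) -
        μ / 2 * ∫ p, w p * D.indicator w p ∂(stripMeasure L)) +
      ∫ p, Φ (U n p) * D.indicator (fun _ => (1 : ℝ)) p ∂(stripMeasure L) ≤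
      (volume.restrict (Ioi (0 : ℝ))).real A * (E₀ + C * regStep n) := by
    intro n
    have ivn := integrable_mul_of_memLp_exp (hV.memLp_seq n) (memLp_exp_mul_indicator hV.memLp hD hDT)
    have iwn := integrable_mul_of_memLp_exp (hW.memLp_seq n) (memLp_exp_mul_indicator hW.memLp hD hDT)
    have ivnn := integrable_mul_of_memLp_exp (hV.memLp_seq n)
      (memLp_exp_mul_indicator (hV.memLp_seq n) hD hDT)
    have iwnn := integrable_mul_of_memLp_exp (hW.memLp_seq n)
      (memLp_exp_mul_indicator (hW.memLp_seq n) hD hDT)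
    have iΦn := iΦ (U n) (hUc n)
    have iL := (((ivn.const_mul ρ).sub (iv.const_mul (ρ / 2))).add
      ((iwn.const_mul μ).sub (iw.const_mul (μ / 2)))).add iΦn
    have iR := ((ivnn.const_mul (ρ / 2)).add (iwnn.const_mul (μ / 2))).add iΦn
    have e1 : ρ * ∫ p, V n p * D.indicator v p ∂(stripMeasure L) -
        ρ / 2 * ∫ p, v p * D.indicator v p ∂(stripMeasure L) +
      (μ * ∫ p, W n p * D.indicator w p ∂(stripMeasure L) -
        μ / 2 * ∫ p, w p * D.indicator w p ∂(stripMeasure L)) +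
      ∫ p, Φ (U n p) * D.indicator (fun _ => (1 : ℝ)) p ∂(stripMeasure L) =
      ∫ p, (((fun p => ρ * (V n p * D.indicator v p)) - fun p => ρ / 2 * (v p * D.indicator v p)) +
        ((fun p => μ * (W n p * D.indicator w p)) - fun p => μ / 2 * (w p * D.indicator w p)) +
        fun p => Φ (U n p) * D.indicator (fun _ => (1 : ℝ)) p) p ∂(stripMeasure L) := by
      rw [integral_add' (((ivn.const_mul ρ).sub (iv.const_mul (ρ / 2))).add
          ((iwn.const_mul μ).sub (iw.const_mul (μ / 2)))) iΦn,
        integral_add' ((ivn.const_mul ρ).sub (iv.const_mul (ρ / 2)))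
          ((iwn.const_mul μ).sub (iw.const_mul (μ / 2))),
        integral_sub' (ivn.const_mul ρ) (iv.const_mul (ρ / 2)),
        integral_sub' (iwn.const_mul μ) (iw.const_mul (μ / 2)), integral_const_mul,
        integral_const_mul, integral_const_mul, integral_const_mul]
    rw [e1]
    refine (integral_mono iL iR fun p => ?_).trans ?_
    · simp only [Pi.add_apply, Pi.sub_apply]
      by_cases hp : p ∈ D
      · simp only [indicator_of_mem hp]
        nlinarith [mul_nonneg hρ (sq_nonneg (V n p - v p)), mul_nonneg hμ (sq_nonneg (W n p - w p))]
      · simp [hp]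
    · rw [integral_strip iR]
      have hin : ∀ t, ∫ x, ((fun p => ρ / 2 * (V n p * D.indicator (V n) p)) +
          (fun p => μ / 2 * (W n p * D.indicator (W n) p)) +
          fun p => Φ (U n p) * D.indicator (fun _ => (1 : ℝ)) p) (t, x) ∂(seg L) =
          A.indicator (fun t => ρ / 2 * ‖fv n t‖ ^ 2 + μ / 2 * ‖fw n t‖ ^ 2 +
            ∫ x, Φ (U n (t, x)) ∂(seg L)) t := by
        intro t
        by_cases ht : t ∈ A
        · have hmem : ∀ x, (t, x) ∈ D := fun x => ht
          simp only [Pi.add_apply, indicator_of_mem (hmem _), indicator_of_mem ht, mul_one]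
          have q : ∀ f : Lp ℝ 2 (seg L), Integrable (fun x => f x ^ 2) (seg L) := fun f =>
            (Lp.memLp f).integrable_sq
          have j1 : Integrable (fun x => ρ / 2 * (V n (t, x) * V n (t, x))) (seg L) := by
            refine ((q (fv n t)).const_mul (ρ / 2)).congr ?_
            filter_upwards [hfv n t] with x hx
            rw [hx, sq]
          have j2 : Integrable (fun x => μ / 2 * (W n (t, x) * W n (t, x))) (seg L) := by
            refine ((q (fw n t)).const_mul (μ / 2)).congr ?_
            filter_upwards [hfw n t] with x hx
            rw [hx, sq]
          have j3 : Integrable (fun x => Φ (U n (t, x))) (seg L) :=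
            integrable_seg (hΦ.comp ((hUc n).comp (by fun_prop)))
          have j12 : Integrable (fun x => ρ / 2 * (V n (t, x) * V n (t, x)) +
              μ / 2 * (W n (t, x) * W n (t, x))) (seg L) := j1.add j2
          rw [integral_add j12 j3, integral_add j1 j2, integral_const_mul, integral_const_mul,
            norm_Lp_sq, norm_Lp_sq]
          have q1 : ∫ x, V n (t, x) * V n (t, x) ∂(seg L) = ∫ x, fv n t x ^ 2 ∂(seg L) :=
            integral_congr_ae (by filter_upwards [hfv n t] with x hx; rw [hx, sq])
          have q2 : ∫ x, W n (t, x) * W n (t, x) ∂(seg L) = ∫ x, fw n t x ^ 2 ∂(seg L) :=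
            integral_congr_ae (by filter_upwards [hfw n t] with x hx; rw [hx, sq])
          rw [q1, q2]
        · have hmem : ∀ x, (t, x) ∉ D := fun x => ht
          simp [indicator_of_notMem (hmem _), indicator_of_notMem ht]
      have hiA : Integrable (A.indicator fun _ => E₀ + C * regStep n) (volume.restrict (Ioi (0 : ℝ))) := by
        rw [integrable_indicator_iff hA]
        exact integrableOn_const hAfin.ne
      have hil := iR
      rw [stripMeasure_eq_prod] at hil
      have hil2 := hil.integral_prod_left
      simp only [hin] at hil2 ⊢
      refine (integral_mono hil2 hiA fun t => ?_).trans_eq ?_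
      · by_cases ht : t ∈ A
        · rw [indicator_of_mem ht, indicator_of_mem ht]
          exact hE n t
        · rw [indicator_of_notMem ht, indicator_of_notMem ht]
      · rw [integral_indicator hA, setIntegral_const, smul_eq_mul]
  -- The cross terms converge to the squares of the limits, so `ρ - ρ/2` and `μ - μ/2` leave exactly
  -- the energy of the limit.
  have l1 := hV.tendsto _ (memLp_exp_mul_indicator hV.memLp hD hDT)
  have l2 := hW.tendsto _ (memLp_exp_mul_indicator hW.memLp hD hDT)
  have l3 := tendsto_integral_of_uniform (L := L) (T := T) (F := fun n p => Φ (U n p))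
    (f := fun p => Φ (u p)) (fun n => hΦ.comp (hUc n)) (hΦ.comp hu)
    (hK.uniformContinuous.comp_tendstoUniformlyOn (hU _ (isCompact_Icc.prod isCompact_Icc))) i1
    fun p hp => indicator_of_notMem (fun h => absurd (hDT p h) (not_lt.2 hp)) _
  have l4 : Tendsto (fun n => (volume.restrict (Ioi (0 : ℝ))).real A * (E₀ + C * regStep n)) 𝒰
      (𝓝 ((volume.restrict (Ioi (0 : ℝ))).real A * (E₀ + C * 0))) :=
    (((tendsto_regStep.mono_left h𝒰).const_mul C).const_add E₀).const_mul _
  have := le_of_tendsto_of_tendsto' ((((l1.const_mul ρ).sub_const _).add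
    ((l2.const_mul μ).sub_const _)).add l3) l4 hupper
  rw [mul_zero, add_zero] at this
  linarith

/-- The energy inequality passes to the limit. -/
theorem ae_energy_le (hρ : 0 < ρ) (hμ : 0 < μ) (hΦ : Continuous Φ) {B : ℝ} (hΦ0 : ∀ s, 0 ≤ Φ s)
    (hΦB : ∀ s, |Φ s| ≤ B) {K : NNReal} (hK : LipschitzWith K Φ)
    (h𝒰 : 𝒰 ≤ atTop) (hUc : ∀ n, Continuous (U n))
    (hu : Continuous u) (hU : ∀ K, IsCompact K → TendstoUniformlyOn U u 𝒰 K)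
    (hV : WeakLim 𝒰 L V v) (hW : WeakLim 𝒰 L W w)
    {fv fw : ℕ → ℝ → Lp ℝ 2 (seg L)} (hfv : ∀ n t, (fun x => V n (t, x)) =ᵐ[seg L] fv n t)
    (hfw : ∀ n t, (fun x => W n (t, x)) =ᵐ[seg L] fw n t)
    (hE : ∀ n t, ρ / 2 * ‖fv n t‖ ^ 2 + μ / 2 * ‖fw n t‖ ^ 2 + ∫ x, Φ (U n (t, x)) ∂(seg L) ≤
      E₀ + C * regStep n) :
    ∀ᵐ t ∂(volume.restrict (Ioi (0 : ℝ))),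
      energy ρ μ L Φ (fun x => v (t, x)) (fun x => w (t, x)) (fun x => u (t, x)) ≤ E₀ ∧
      (Integrable (fun x => v (t, x) ^ 2) (seg L) ∧ ∫ x, v (t, x) ^ 2 ∂(seg L) ≤ 2 * E₀ / ρ) ∧
      (Integrable (fun x => w (t, x) ^ 2) (seg L) ∧ ∫ x, w (t, x) ^ 2 ∂(seg L) ≤ 2 * E₀ / μ) := by
  have main := fun {A : Set ℝ} (hA : MeasurableSet A) {T : ℝ} (hAT : ∀ t ∈ A, t < T) =>
    integral_energy_indicator_le hρ.le hμ.le hΦ hΦB hK h𝒰 hUc hu hU hV hW hfv hfw hE hA hAT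
  let e : ℝ → ℝ := fun t => ∫ x, (ρ / 2 * v (t, x) ^ 2 + μ / 2 * w (t, x) ^ 2 + Φ (u (t, x))) ∂(seg L)
  have key : ∀ T : ℕ, ∀ᵐ t ∂(volume.restrict (Ioi (0 : ℝ))), t < (T : ℝ) →
      Integrable (fun x => v (t, x) ^ 2) (seg L) ∧ Integrable (fun x => w (t, x) ^ 2) (seg L) ∧
      e t ≤ E₀ := by
    intro T
    obtain ⟨jv, jw, jΦ, -⟩ := main (measurableSet_Iio (a := (T : ℝ))) fun t ht => ht
    have hslice : ∀ (A : Set ℝ) (t x : ℝ), ρ / 2 * (v (t, x) * {p : ℝ × ℝ | p.1 ∈ A}.indicator v (t, x)) +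
        μ / 2 * (w (t, x) * {p : ℝ × ℝ | p.1 ∈ A}.indicator w (t, x)) +
        Φ (u (t, x)) * {p : ℝ × ℝ | p.1 ∈ A}.indicator (fun _ => (1 : ℝ)) (t, x) =
        A.indicator (fun _ => 1) t * (ρ / 2 * v (t, x) ^ 2 + μ / 2 * w (t, x) ^ 2 + Φ (u (t, x))) := by
      intro A t x
      by_cases ht : t ∈ A
      · have hm : (t, x) ∈ {p : ℝ × ℝ | p.1 ∈ A} := ht
        simp only [indicator_of_mem ht, indicator_of_mem hm]
        ring
      · have hm : (t, x) ∉ {p : ℝ × ℝ | p.1 ∈ A} := ht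
        simp only [indicator_of_notMem ht, indicator_of_notMem hm]
        ring
    have hint : ∀ A : Set ℝ, MeasurableSet A → (∀ t ∈ A, t < (T : ℝ)) →
        Integrable (fun t => A.indicator (fun _ => 1) t * e t) (volume.restrict (Ioi (0 : ℝ))) ∧
        ∫ t in Ioi (0 : ℝ), A.indicator (fun _ => 1) t * e t ≤
          (volume.restrict (Ioi (0 : ℝ))).real A * E₀ := by
      intro A hA hAT
      obtain ⟨kv, kw, kΦ, hle⟩ := main hA hAT
      have k12 := (kv.const_mul (ρ / 2)).add (kw.const_mul (μ / 2))
      rw [← integral_const_mul, ← integral_const_mul, ← integral_add' (kv.const_mul (ρ / 2))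
        (kw.const_mul (μ / 2)), ← integral_add' k12 kΦ, integral_strip (k12.add kΦ)] at hle
      have kk := k12.add kΦ
      rw [stripMeasure_eq_prod] at kk
      have kk2 := kk.integral_prod_left
      simp only [Pi.add_apply, hslice, integral_const_mul] at hle kk2
      exact ⟨kk2, hle⟩
    have hf := (hint (Iio (T : ℝ)) measurableSet_Iio fun t ht => ht).1
    have hfin : volume.restrict (Ioi (0 : ℝ)) (Iio (T : ℝ)) < ⊤ := by
      rw [Measure.restrict_apply measurableSet_Iio]
      refine (measure_mono (t := Ioo 0 (T : ℝ)) fun t ht => ⟨ht.2, ht.1⟩).trans_lt ?_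
      rw [Real.volume_Ioo]
      exact ENNReal.ofReal_lt_top
    have hg : Integrable (fun t => (Iio (T : ℝ)).indicator (fun _ => (1 : ℝ)) t * E₀)
        (volume.restrict (Ioi (0 : ℝ))) := by
      refine Integrable.mul_const ?_ E₀
      rw [integrable_indicator_iff measurableSet_Iio]
      exact integrableOn_const hfin.ne
    -- The integrated inequality holds over every measurable set of times below `T`, hence pointwise
    -- for almost every such time.
    have hle := ae_le_of_forall_setIntegral_le hf hg fun s hs _ => by
      have h1 := (hint (s ∩ Iio (T : ℝ)) (hs.inter measurableSet_Iio) fun t ht => ht.2).2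
      have h2 : ∀ f : ℝ → ℝ, ∫ t in s, (Iio (T : ℝ)).indicator (fun _ => (1 : ℝ)) t * f t
          ∂(volume.restrict (Ioi (0 : ℝ))) =
          ∫ t in Ioi (0 : ℝ), (s ∩ Iio (T : ℝ)).indicator (fun _ => (1 : ℝ)) t * f t := by
        intro f
        rw [← integral_indicator hs]
        refine integral_congr_ae (Eventually.of_forall fun t => ?_)
        simp only
        by_cases h3 : t ∈ s <;> by_cases h4 : t ∈ Iio (T : ℝ) <;> simp [indicator, h3, h4]
      rw [h2, h2 fun _ => E₀]
      refine h1.trans_eq ?_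
      rw [integral_mul_const, integral_indicator (hs.inter measurableSet_Iio), setIntegral_const]
      simp
    have sv := jv
    have sw := jw
    rw [stripMeasure_eq_prod] at sv sw
    filter_upwards [hle, sv.prod_right_ae, sw.prod_right_ae] with t h1 h2 h3 ht
    have hm : ∀ x, (t, x) ∈ {p : ℝ × ℝ | p.1 ∈ Iio (T : ℝ)} := fun x => ht
    simp only [indicator_of_mem (hm _), indicator_of_mem (mem_Iio.2 ht), one_mul, ← sq] at h1 h2 h3
    exact ⟨h2, h3, h1⟩
  have hm : ∀ t, AEStronglyMeasurable (fun x => Φ (u (t, x))) (seg L) := fun t =>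
    (hΦ.comp (hu.comp (by fun_prop : Continuous fun x : ℝ => (t, x)))).aestronglyMeasurable
  filter_upwards [ae_all_iff.2 key] with t ht
  obtain ⟨T, hT⟩ := exists_nat_gt t
  obtain ⟨h1, h2, h3⟩ := ht T hT
  have i3 : Integrable (fun x => Φ (u (t, x))) (seg L) :=
    Integrable.of_bound (hm t) B (Eventually.of_forall fun x => hΦB _)
  have i12 : Integrable (fun x => ρ / 2 * v (t, x) ^ 2 + μ / 2 * w (t, x) ^ 2) (seg L) :=
    (h1.const_mul (ρ / 2)).add (h2.const_mul (μ / 2))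
  have hsum : e t = ρ / 2 * ∫ x, v (t, x) ^ 2 ∂(seg L) + μ / 2 * ∫ x, w (t, x) ^ 2 ∂(seg L) +
      ∫ x, Φ (u (t, x)) ∂(seg L) := by
    simp only [e]
    rw [integral_add i12 i3, integral_add (h1.const_mul (ρ / 2)) (h2.const_mul (μ / 2)),
      integral_const_mul, integral_const_mul]
  have p1 : 0 ≤ ∫ x, v (t, x) ^ 2 ∂(seg L) := integral_nonneg fun x => sq_nonneg _
  have p2 : 0 ≤ ∫ x, w (t, x) ^ 2 ∂(seg L) := integral_nonneg fun x => sq_nonneg _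
  have p3 : 0 ≤ ∫ x, Φ (u (t, x)) ∂(seg L) := integral_nonneg fun x => hΦ0 _
  have q1 := mul_nonneg hρ.le p1
  have q2 := mul_nonneg hμ.le p2
  refine ⟨?_, ⟨h1, ?_⟩, ⟨h2, ?_⟩⟩
  · refine le_trans (le_of_eq ?_) h3
    rw [energy]
    refine integral_congr_ae (Eventually.of_forall fun x => ?_)
    simp only
    ring
  · rw [le_div_iff₀ hρ]
    linarith
  · rw [le_div_iff₀ hμ]
    linarith

end EnergyLimit

end Beam

/-! ### Passage to the limit in the weak identities. -/

namespace Beam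

open scoped RealInnerProductSpace

section WeakForms

variable {L : ℝ} [hL : Fact (0 < L)] {𝒰 : Filter ℕ} {c d : ℕ → ℝ → StateSpace L}
  {c₀ : StateSpace L} {W : ℕ → ℝ × ℝ → ℝ} {u v w h φ : ℝ × ℝ → ℝ}

theorem tendsto_integral_dispField_mul (hcc : ∀ n, Continuous (c n)) (hu : Continuous u)
    (hU : ∀ K, IsCompact K → TendstoUniformlyOn (fun n => dispField L (c n)) u 𝒰 K)
    (hφ : Continuous φ) (hφc : HasCompactSupport φ) :
    Tendsto (fun n => ∫ p, dispField L (c n) p * φ p ∂(stripMeasure L)) 𝒰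
      (𝓝 (∫ p, u p * φ p ∂(stripMeasure L))) := by
  obtain ⟨T, -, -, hT⟩ := exists_time_bound_zero hφc
  exact tendsto_integral_of_uniform (fun n => continuous_dispField (hcc n)) hu
    (hU _ (isCompact_Icc.prod isCompact_Icc)) (hφ.integrable_of_hasCompactSupport hφc).restrict
    fun p hp => hT φ subset_rfl p.1 p.2 hp

variable [𝒰.NeBot]

/-- The weak limit of the velocities is the weak time derivative of the limit displacement, with
the initial displacement as boundary term. -/
theorem WeakLim.integral_mul_dt (hc : ∀ n t, HasDerivAt (c n) (d n t) t)
    (hd : ∀ n, Continuous (d n)) (h0 : ∀ n, c n 0 = c₀) (hu : Continuous u)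
    (hU : ∀ K, IsCompact K → TendstoUniformlyOn (fun n => dispField L (c n)) u 𝒰 K)
    (hV : WeakLim 𝒰 L (fun n => dispField L (d n)) v) (hφ : ContDiff ℝ ∞ φ)
    (hφc : HasCompactSupport φ) :
    ∫ p, u p * dt φ p ∂(stripMeasure L) + ⟪dispL2 L c₀, sliceL2 L hφ.continuous 0⟫ =
      -∫ p, v p * φ p ∂(stripMeasure L) := by
  have hcc : ∀ n, Continuous (c n) := fun n =>
    continuous_iff_continuousAt.2 fun t => (hc n t).continuousAt
  have l1 := tendsto_integral_dispField_mul hcc hu hU (contDiff_dt hφ).continuous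
    (hasCompactSupport_dt hφc)
  have l2 := (hV.tendsto φ (memLp_exp_testFunction L hφ.continuous hφc)).neg
  refine tendsto_nhds_unique (l1.add_const _) (l2.congr fun n => ?_)
  rw [← integral_dispField_mul_dt (hc n) (hd n) hφ hφc, h0]

/-- The weak limit of the curvatures is the weak second space derivative of the limit
displacement. -/
theorem WeakLim.integral_mul_dx_dx (hcc : ∀ n, Continuous (c n)) (hu : Continuous u)
    (hU : ∀ K, IsCompact K → TendstoUniformlyOn (fun n => dispField L (c n)) u 𝒰 K)
    (hW : WeakLim 𝒰 L W w) (hWc : ∀ n t, (fun x => W n (t, x)) =ᵐ[seg L] (c n t).snd)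
    (hφ : ContDiff ℝ ∞ φ) (hφc : HasCompactSupport φ) (hsub : tsupport φ ⊆ strip L) :
    ∫ p, u p * dx (dx φ) p ∂(stripMeasure L) = ∫ p, w p * φ p ∂(stripMeasure L) := by
  have l1 := tendsto_integral_dispField_mul hcc hu hU (contDiff_dx (contDiff_dx hφ)).continuous
    (hasCompactSupport_dx (hasCompactSupport_dx hφc))
  have l2 := hW.tendsto φ (memLp_exp_testFunction L hφ.continuous hφc)
  refine tendsto_nhds_unique l1 (l2.congr fun n => ?_)
  rw [integral_dispField_mul_dx_dx (hcc n) (hWc n) (hW.memLp_seq n) hφ hφc hsub]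

/-- The weak limits satisfy the equation of motion, with the initial velocity as boundary term. -/
theorem WeakLim.integral_motion {ρ μ : ℝ} (h𝒰 : 𝒰 ≤ atTop) {v₀ : Lp ℝ 2 (seg L)}
    {H : ℕ → ℝ × ℝ → ℝ} {fh : ℕ → ℝ → Lp ℝ 2 (seg L)} (hcc : ∀ n, Continuous (c n))
    (hd : ∀ n, Continuous (d n)) (hfhc : ∀ n, Continuous (fh n))
    (hV : WeakLim 𝒰 L (fun n => dispField L (d n)) v)
    (hW : WeakLim 𝒰 L W w) (hWc : ∀ n t, (fun x => W n (t, x)) =ᵐ[seg L] (c n t).snd)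
    (hH : WeakLim 𝒰 L H h) (hfh : ∀ n t, (fun x => H n (t, x)) =ᵐ[seg L] fh n t)
    (hlim : ∀ e e' : ℝ → StateSpace L, (∀ t, HasDerivAt e (e' t) t) → Continuous e' → ∀ T, 0 ≤ T →
      e T = 0 → Tendsto (fun n => ∫ t in (0 : ℝ)..T, (-(ρ * ⟪dispL2 L (d n t), dispL2 L (e' t)⟫) +
        μ * ⟪(c n t).snd, (e t).snd⟫ + ⟪fh n t, dispL2 L (e t)⟫)) atTop
        (𝓝 (ρ * ⟪v₀, dispL2 L (e 0)⟫)))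
    (hφ : ContDiff ℝ ∞ φ) (hφc : HasCompactSupport φ) :
    -(ρ * ∫ p, v p * dt φ p ∂(stripMeasure L)) + μ * ∫ p, w p * dx (dx φ) p ∂(stripMeasure L) +
      ∫ p, h p * φ p ∂(stripMeasure L) = ρ * ⟪v₀, sliceL2 L hφ.continuous 0⟫ := by
  obtain ⟨T, hT0, hTs, hT⟩ := exists_time_bound_zero hφc
  obtain ⟨e, e', he, hec, he0, he1, he2, hez⟩ := exists_testCurve (L := L) hφ hφc
  have hdt := contDiff_dt hφ
  have hdxx := contDiff_dx (contDiff_dx hφ)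
  have mt := memLp_exp_testFunction L hdt.continuous (hasCompactSupport_dt hφc)
  have mx := memLp_exp_testFunction L hdxx.continuous
    (hasCompactSupport_dx (hasCompactSupport_dx hφc))
  have m0 := memLp_exp_testFunction L hφ.continuous hφc
  -- The slices of `φ` vanish at time `T`, as the approximate formulation requires of its test
  -- curves.
  have l1 := (hlim e e' he hec T hT0.le (hez T fun x => hTs T x le_rfl)).mono_left h𝒰
  have l2 := ((((hV.tendsto _ mt).const_mul ρ).neg).add ((hW.tendsto _ mx).const_mul μ)).add
    (hH.tendsto _ m0)
  have heC : Continuous e := continuous_iff_continuousAt.2 fun t => (he t).continuousAt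
  have hsnd : Continuous fun c : StateSpace L => c.snd := by fun_prop
  rw [he0] at l1
  refine tendsto_nhds_unique l2 (l1.congr fun n => ?_)
  rw [integral_strip_mul_eq hT0.le hdt.continuous (hT _ tsupport_dt_subset) (dispField_slice (d n))
      (integrable_mul_of_memLp_exp (hV.memLp_seq n) mt),
    integral_strip_mul_eq hT0.le hdxx.continuous
      (hT _ (tsupport_dx_subset.trans tsupport_dx_subset)) (hWc n)
      (integrable_mul_of_memLp_exp (hW.memLp_seq n) mx),
    integral_strip_mul_eq hT0.le hφ.continuous (hT _ subset_rfl) (hfh n)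
      (integrable_mul_of_memLp_exp (hH.memLp_seq n) m0)]
  simp only [← he0, ← he1, ← he2]
  have k1 : Continuous fun t => ⟪dispL2 L (d n t), dispL2 L (e' t)⟫ :=
    ((dispL2 L).continuous.comp (hd n)).inner ((dispL2 L).continuous.comp hec)
  have k2 : Continuous fun t => ⟪(c n t).snd, (e t).snd⟫ :=
    (hsnd.comp (hcc n)).inner (hsnd.comp heC)
  have k3 : Continuous fun t => ⟪fh n t, dispL2 L (e t)⟫ :=
    (hfhc n).inner ((dispL2 L).continuous.comp heC)
  have k12 : Continuous fun t => -(ρ * ⟪dispL2 L (d n t), dispL2 L (e' t)⟫) +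
      μ * ⟪(c n t).snd, (e t).snd⟫ := (k1.const_mul ρ).neg.add (k2.const_mul μ)
  have k1' : Continuous fun t => -(ρ * ⟪dispL2 L (d n t), dispL2 L (e' t)⟫) :=
    (k1.const_mul ρ).neg
  rw [intervalIntegral.integral_add (k12.intervalIntegrable _ _) (k3.intervalIntegrable _ _),
    intervalIntegral.integral_add (k1'.intervalIntegrable _ _)
      ((k2.const_mul μ).intervalIntegrable _ _), intervalIntegral.integral_neg,
    intervalIntegral.integral_const_mul, intervalIntegral.integral_const_mul]

end WeakForms

theorem sliceL2_eq_zero {L : ℝ} {ψ : ℝ × ℝ → ℝ} (hψ : Continuous ψ) {t : ℝ} (h : ∀ x, ψ (t, x) = 0) :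
    sliceL2 L hψ t = 0 := by
  refine Lp.ext ?_
  filter_upwards [coeFn_sliceL2 (L := L) hψ t, Lp.coeFn_zero ℝ 2 (seg L)] with x h1 h2
  rw [h1, h2, h]
  rfl

/-- The energy controls the velocity and the curvature. -/
theorem le_sqrt_of_energy_le {ρ a b E : ℝ} (hρ : 0 < ρ) (hb : 0 ≤ b)
    (h : ρ / 2 * a ^ 2 + b ≤ E) : a ≤ √(2 * E / ρ) := by
  refine Real.le_sqrt_of_sq_le ?_
  rw [le_div_iff₀ hρ]
  linarith

/-! ### Construction of the dissipative solution. -/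

section Assembly

variable {L : ℝ} [hL : Fact (0 < L)]

theorem energy_eq {ρ μ : ℝ} {Φ : ℝ → ℝ} (hΦ : Continuous Φ) {c : StateSpace L} {u₀ u₁ w₀ : ℝ → ℝ}
    (hu₁ : MemLp u₁ 2 (seg L)) (hw : c.snd =ᵐ[seg L] w₀) (hu : u₀ =ᵐ[seg L] disp L c) :
    energy ρ μ L Φ u₁ w₀ u₀ = ρ / 2 * ‖hu₁.toLp u₁‖ ^ 2 + μ / 2 * ‖c.snd‖ ^ 2 +
      ∫ x, Φ (disp L c x) ∂(seg L) := by
  have h1 : Integrable (fun x => u₁ x ^ 2) (seg L) := hu₁.integrable_sq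
  have h2 : Integrable (fun x => c.snd x ^ 2) (seg L) := (Lp.memLp c.snd).integrable_sq
  have h3 : Integrable (fun x => Φ (disp L c x)) (seg L) :=
    integrable_seg (hΦ.comp (continuous_disp c))
  have h12 : Integrable (fun x => ρ / 2 * u₁ x ^ 2 + μ / 2 * c.snd x ^ 2) (seg L) :=
    (h1.const_mul _).add (h2.const_mul _)
  rw [norm_toLp_sq, norm_Lp_sq, ← integral_const_mul, ← integral_const_mul,
    ← integral_add (h1.const_mul _) (h2.const_mul _), ← integral_add h12 h3]
  refine integral_congr_ae ?_
  filter_upwards [hw, hu] with x hx hx'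
  rw [hx, hx']
  ring

theorem exists_isDissipativeSolution {ρ μ : ℝ} (hρ : 0 < ρ) (hμ : 0 < μ) {Φ : ℝ → ℝ}
    (hΦ : IsAdhesionPotential Φ) {u₀ u₁ : ℝ → ℝ} (hu₀ : MemH2 L u₀) (hu₁ : MemLp u₁ 2 (seg L)) :
    ∃ u : ℝ × ℝ → ℝ, IsDissipativeSolution ρ μ L Φ u₀ u₁ u := by
  classical
  obtain ⟨w₀, c₀, hw₀, hcw, hcu⟩ := exists_state_of_memH2 hu₀
  obtain ⟨K, hK⟩ := hΦ.exists_lipschitz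
  obtain ⟨c, d, C, hC, hc0, hcd, hdc, hen, hlim⟩ :=
    exists_approximate_solutions hρ hμ.le hΦ c₀ (hu₁.toLp u₁)
  rw [← energy_eq hΦ.continuous hu₁ hcw hcu] at hen
  set E₀ := energy ρ μ L Φ u₁ w₀ u₀
  have hcc : ∀ n, Continuous (c n) := fun n =>
    continuous_iff_continuousAt.2 fun t => (hcd n t).continuousAt
  have hE : ∀ n t, ρ / 2 * ‖dispL2 L (d n t)‖ ^ 2 + μ / 2 * ‖(c n t).snd‖ ^ 2 +
      ∫ x, Φ (disp L (c n t) x) ∂(seg L) ≤ E₀ + C := fun n t =>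
    (hen n t).trans (add_le_add_right (mul_le_of_le_one_right hC (regStep_le_one n)) _)
  have hΦi : ∀ n t, 0 ≤ ∫ x, Φ (disp L (c n t) x) ∂(seg L) := fun n t =>
    integral_nonneg fun x => hΦ.nonneg _
  have hdA : ∀ n t, ‖dispL2 L (d n t)‖ ≤ √(2 * (E₀ + C) / ρ) := fun n t =>
    le_sqrt_of_energy_le hρ (b := μ / 2 * ‖(c n t).snd‖ ^ 2 + ∫ x, Φ (disp L (c n t) x) ∂(seg L))
      (add_nonneg (by positivity) (hΦi n t)) (by linarith [hE n t])
  have hcA : ∀ n t, ‖(c n t).snd‖ ≤ √(2 * (E₀ + C) / μ) := fun n t =>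
    le_sqrt_of_energy_le hμ
      (b := ρ / 2 * ‖dispL2 L (d n t)‖ ^ 2 + ∫ x, Φ (disp L (c n t) x) ∂(seg L))
      (add_nonneg (by positivity) (hΦi n t)) (by linarith [hE n t])
  -- One ultrafilter finer than `atTop` provides the limits of displacements, velocities, curvatures
  -- and forces simultaneously.
  let 𝒰 : Ultrafilter ℕ := hyperfilter ℕ
  have h𝒰 : (𝒰 : Filter ℕ) ≤ atTop := Nat.hyperfilter_le_atTop
  obtain ⟨u, huc, hU⟩ := exists_pointwise_limit hcd
    (fun n t => (hdA n t).trans (le_max_left _ (√(2 * (E₀ + C) / μ))))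
    (fun n t => (hcA n t).trans (le_max_right _ _)) hc0 𝒰
  obtain ⟨v, hV⟩ := exists_weakLim 𝒰
    (fun n => (continuous_dispField (L := L) (hdc n)).aestronglyMeasurable)
    (fun n t => dispField_slice (d n) t) hdA
  have hsnd : Continuous fun c : StateSpace L => c.snd := by fun_prop
  choose W hWm hWc using fun n => exists_measurable_slices hL.out.le (hsnd.comp (hcc n))
  obtain ⟨w, hW⟩ := exists_weakLim 𝒰 (fun n => (hWm n).aestronglyMeasurable)
    (fun n t => hWc n t) hcA
  have hψ := fun n => continuous_diffQuot hΦ.continuous (regStep n)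
  have hHc : ∀ n t, (fun x => diffQuot Φ (regStep n) (dispField L (c n) (t, x))) =ᵐ[seg L]
      compDisp (hψ n) (c n t) := by
    intro n t
    filter_upwards [coeFn_compDisp (hψ n) (c n t), ae_restrict_mem measurableSet_Ioo] with x h1 h2
    rw [h1, dispField_eq _ _ (Ioo_subset_Icc_self h2)]
  have hHb : ∀ n t, ‖compDisp (hψ n) (c n t)‖ ≤ ((seg L).real univ) ^ (2 : ENNReal).toReal⁻¹ * K := by
    intro n t
    refine Lp.norm_le_of_ae_bound K.2 ?_
    filter_upwards [coeFn_compDisp (hψ n) (c n t)] with x hx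
    rw [hx]
    exact abs_diffQuot_le hK (regStep_pos n) _
  obtain ⟨h, hH⟩ := exists_weakLim 𝒰
    (F := fun n p => diffQuot Φ (regStep n) (dispField L (c n) p))
    (fun n => ((hψ n).comp (continuous_dispField (hcc n))).aestronglyMeasurable) hHc hHb
  have hmem := hH.ae_mem_forceSubdiff hΦ h𝒰 huc hU
  choose s hs using exists_mem_forceSubdiff hΦ
  -- The inclusion is known almost everywhere but required at every point, so `h` is replaced on the
  -- exceptional set by a pointwise selection.
  let h' : ℝ × ℝ → ℝ := fun p => if h p ∈ forceSubdiff Φ (u p) then h p else s (u p)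
  have hh' : h' =ᵐ[stripMeasure L] h := by
    filter_upwards [hmem] with p hp
    exact if_pos hp
  have hB : ∀ s, |Φ s| ≤ Φ (-1) + Φ 1 := fun s => by
    rw [abs_of_nonneg (hΦ.nonneg s)]
    exact hΦ.le_max_ends s
  have hfin := ae_energy_le hρ hμ hΦ.continuous hΦ.nonneg hB hK h𝒰
    (fun n => continuous_dispField (hcc n)) huc hU hV hW (fun n t => dispField_slice (d n) t) hWc
    (E₀ := E₀) (C := C) fun n t => by
      refine le_trans (le_of_eq ?_) (hen n t)
      congr 1
      refine integral_congr_ae ?_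
      filter_upwards [ae_restrict_mem measurableSet_Ioo] with x hx
      rw [dispField_eq _ _ (Ioo_subset_Icc_self hx)]
  refine ⟨u, huc.continuousOn, v, w, h', w₀, ⟨?_, ?_, ?_⟩, ?_, ⟨?_, ?_, ?_⟩, ?_, hw₀, ?_, ?_, ?_,
    hfin.mono fun t ht => ht.1⟩
  · exact huc.locallyIntegrable.locallyIntegrableOn _
  · exact locallyIntegrableOn_of_memLp_exp hV.memLp
  · intro φ hφ hφc hsub
    have := hV.integral_mul_dt hcd hdc hc0 huc hU hφ hφc
    rw [sliceL2_eq_zero hφ.continuous fun x => image_eq_zero_of_notMem_tsupport fun hx =>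
      lt_irrefl (0 : ℝ) (hsub hx).1, inner_zero_right, add_zero] at this
    rw [partialT_one hφ, pow_one, neg_one_mul]
    exact this
  · exact memLinftyL2_of_integral_sq_le (aestronglyMeasurable_of_memLp_exp hV.memLp)
      (hfin.mono fun t ht => ht.2.1)
  · exact huc.locallyIntegrable.locallyIntegrableOn _
  · exact locallyIntegrableOn_of_memLp_exp hW.memLp
  · intro φ hφ hφc hsub
    rw [partialX_two hφ, neg_one_sq, one_mul]
    exact hW.integral_mul_dx_dx hcc huc hU hWc hφ hφc hsub
  · exact memLinftyL2_of_integral_sq_le (aestronglyMeasurable_of_memLp_exp hW.memLp)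
      (hfin.mono fun t ht => ht.2.2)
  · exact (aestronglyMeasurable_of_memLp_exp hH.memLp).congr hh'.symm
  · intro p _
    by_cases hp : h p ∈ forceSubdiff Φ (u p)
    · simp only [h', if_pos hp, hp]
    · simp only [h', if_neg hp, hs]
  · intro φ hφ hφc
    have hdt := contDiff_dt hφ
    have hdtc := hasCompactSupport_dt hφc
    have hdxx := contDiff_dx (contDiff_dx hφ)
    -- Testing the velocity identity with `φ_t` turns `-∫ v φ_t` into `∫ u φ_tt` plus the initial
    -- displacement term; the equation of motion supplies the rest.
    have e1 := hV.integral_mul_dt hcd hdc hc0 huc hU hdt hdtc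
    have e2 := WeakLim.integral_motion h𝒰 hcc hdc
      (fun n => by
        obtain ⟨K', hK'⟩ := lipschitzWith_diffQuot hK (regStep_pos n)
        exact (lipschitzWith_compDisp hK').continuous.comp (hcc n)) hV hW hWc hH hHc hlim hφ hφc
    obtain ⟨T, -, -, hT⟩ := exists_time_bound_zero hφc
    have i1 : Integrable (fun p => u p * dt (dt φ) p) (stripMeasure L) :=
      integrable_continuous_mul huc ((contDiff_dt hdt).continuous.integrable_of_hasCompactSupport
        (hasCompactSupport_dt hdtc)).restrict
        fun p hp => hT _ (tsupport_dt_subset.trans tsupport_dt_subset) p.1 p.2 hp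
    have i2 := integrable_mul_of_memLp_exp hW.memLp (memLp_exp_testFunction L hdxx.continuous
      (hasCompactSupport_dx (hasCompactSupport_dx hφc)))
    have i3 := integrable_mul_of_memLp_exp hH.memLp (memLp_exp_testFunction L hφ.continuous hφc)
    have e3 : ∫ p in strip L, (ρ * u p * partialT 2 φ p + μ * w p * partialX 2 φ p + h' p * φ p) =
        ρ * ∫ p, u p * dt (dt φ) p ∂(stripMeasure L) +
        μ * ∫ p, w p * dx (dx φ) p ∂(stripMeasure L) + ∫ p, h p * φ p ∂(stripMeasure L) := by
      have i12 : Integrable (fun p => ρ * (u p * dt (dt φ) p) + μ * (w p * dx (dx φ) p))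
        (stripMeasure L) := (i1.const_mul ρ).add (i2.const_mul μ)
      rw [← integral_const_mul, ← integral_const_mul,
        ← integral_add (i1.const_mul ρ) (i2.const_mul μ), ← integral_add i12 i3,
        partialT_two hφ, partialX_two hφ]
      refine integral_congr_ae ?_
      filter_upwards [hh'] with p hp
      rw [hp]
      ring
    have e4 : ∫ x in Ioo 0 L, ρ * u₁ x * φ (0, x) =
        ρ * ⟪hu₁.toLp u₁, sliceL2 L hφ.continuous 0⟫ := by
      rw [sliceL2, inner_toLp, ← integral_const_mul]
      simp only [mul_assoc]
    have e5 : ∫ x in Ioo 0 L, ρ * u₀ x * partialT 1 φ (0, x) =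
        ρ * ⟪dispL2 L c₀, sliceL2 L hdt.continuous 0⟫ := by
      rw [sliceL2, dispL2_apply, inner_toLp, ← integral_const_mul, partialT_one hφ]
      refine integral_congr_ae ?_
      filter_upwards [hcu] with x hx
      rw [hx]
      ring
    rw [e3, e4, e5, ← e2]
    linear_combination ρ * e1

end Assembly

end Beam

theorem theorem3p2 (ρ μ L : ℝ) (hρ : 0 < ρ) (hμ : 0 < μ) (hL : 0 < L)
    (Φ : ℝ → ℝ) (hΦ : Beam.IsAdhesionPotential Φ)
    (u₀ u₁ : ℝ → ℝ) (hu₀ : Beam.MemH2 L u₀)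
    (hu₁ : MemLp u₁ 2 (volume.restrict (Ioo 0 L))) :
    ∃ u : ℝ × ℝ → ℝ, Beam.IsDissipativeSolution ρ μ L Φ u₀ u₁ u := by
  have : Fact (0 < L) := ⟨hL⟩
  exact Beam.exists_isDissipativeSolution hρ hμ hΦ hu₀ hu₁
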